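/- Let $0<r_i<r_e$ and put $\rho=r_i/r_e$. Let $\varepsilon_c>0$, $\varepsilon_s<0$, and for $\delta>0$ let $\varepsilon_\delta$ be the permittivity on $\mathbb{R}^2$ equal to $\varepsilon_c$ in the core $\{|x|<r_i\}$, to $\varepsilon_s+i\delta$ in the shell $\{r_i<|x|<r_e\}$, and to $1$ in $\{|x|>r_e\}$. Let $f\in L^2(\mathbb{R}^2;\mathbb{C})$ have compact support contained in $\{|x|>r_e\}$ and satisfy $\int_{\mathbb{R}^2} f\,dx=0$. For $\delta>0$ let $V_\delta$ be the (continuous, $H^1_{\mathrm{loc}}$) weak solution of $$\nabla\cdot(\varepsilon_\delta\nabla V_\delta)=f\ \text{ in }\mathbb{R}^2,\qquad V_\delta(x)\to0\ \text{ as }|x|\to\infty ,$$ and let $$E_\delta=\int_{r_i<|x|<r_e}\delta\,|\nabla V_\delta|^2\,dx .$$ Let $F(x)=\frac1{2\pi}\int_{\mathbb{R}^2}\ln|x-y|\,f(y)\,dy$ be the Newtonian potential of $f$ (it is harmonic near $\{|x|\le r_e\}$), let $g_e^n=-\frac1{2\pi}\int_0^{2\pi}\frac{\partial F}{\partial r}(r_e,\theta)\,e^{-in\theta}\,d\theta$,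 $n\in\mathbb{Z}$, be the Fourier coefficients of $-\partial F/\partial\nu$ on $\{|x|=r_e\}$, and put $r_*=r_e^2/r_i$. (i) If $\varepsilon_c=-\varepsilon_s\neq1$, then there is a constant $C$ such that $E_\delta\le C$ for all $\delta>0$. (ii) If $\varepsilon_c\neq-\varepsilon_s=1$, then $r_*$ is the critical radius, in the following sense. If $f$ is supported in $\{|x|<r_*\}$ and the restriction of $F$ to $\{|x|<r_e\}$ does not extend to a harmonic function in $\{|x|<r_*\}$, then $\limsup_{\delta\to0^+}E_\delta=\infty$. If $f$ is supported in $\{|x|>r_*\}$, then $E_\delta\le C$ for all $\delta>0$, with a constant $C$ independent of $\delta$. In all cases there is a constant $C$ such that $|V_\delta(x)|<C$ for all $\delta>0$ and all $x$ with $|x|>r_e^3/r_i^2$. (iii) If $\varepsilon_c\neq-\varepsilon_s=1$ and there is a sequence of integers $n_1,n_2,\dots$ with $|n_1|<|n_2|<\cdots$ such that $$\lim_{k\to\infty}\rho^{2(|n_{k+1}|-|n_k|)}\,\frac{|g_e^{n_k}|^2}{|n_k|\,\rho^{2|n_k|}}=\infty ,$$ then $\lim_{\delta\to0^+}E_\delta=\infty$,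 and $V_\delta/\sqrt{E_\delta}\to0$ as $\delta\to0^+$, uniformly in $\{|x|>r_e^3/r_i^2\}$. -/

import Mathlib

open MeasureTheory Filter Topology
open scoped ContDiff

/-! The plane `ℝ²` is identified with `ℂ` (with its Euclidean norm and Lebesgue measure); the two
coordinate directions are `1` and `Complex.I`. -/

namespace CALR

/-- `1 / (2π) ∫ log |x - y| f(y) dy`. -/
noncomputable def newtonianPotential (f : ℂ → ℂ) (x : ℂ) : ℂ :=
  ∫ y : ℂ, ((1 / (2 * Real.pi) * Real.log ‖x - y‖ : ℝ) : ℂ) * f y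

/-- An admissible source: square integrable, of total charge zero, with compact support contained
in the open exterior of the disk of radius `re`. -/
structure IsSource (re : ℝ) (f : ℂ → ℂ) : Prop where
  memLp : MemLp f 2 volume
  compact : HasCompactSupport f
  outside : tsupport f ⊆ {x : ℂ | re < ‖x‖}
  neutral : ∫ x, f x = 0

/-- The permittivity: `εc` in the core, `εs + iδ` in the shell, `1` in the background. -/
noncomputable def permittivity (ri re εc εs δ : ℝ) (x : ℂ) : ℂ :=
  if ‖x‖ < ri then (εc : ℂ)
  else if ‖x‖ < re then (εs : ℂ) + Complex.I * (δ : ℂ)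
  else 1

/-- Test functions: complex-valued, smooth, with compact support. -/
structure IsTestFunction (φ : ℂ → ℂ) : Prop where
  smooth : ContDiff ℝ ∞ φ
  compact : HasCompactSupport φ

/-- `(p, q)` is the weak gradient of the locally integrable function `u`, and it is locally square
integrable. -/
structure HasWeakGradient (u p q : ℂ → ℂ) : Prop where
  locInt : LocallyIntegrable u volume
  memLp_fst : ∀ K : Set ℂ, IsCompact K → MemLp p 2 (volume.restrict K)
  memLp_snd : ∀ K : Set ℂ, IsCompact K → MemLp q 2 (volume.restrict K)
  weak_fst : ∀ φ : ℂ → ℂ, IsTestFunction φ →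
    ∫ x, u x * fderiv ℝ φ x 1 = - ∫ x, p x * φ x
  weak_snd : ∀ φ : ℂ → ℂ, IsTestFunction φ →
    ∫ x, u x * fderiv ℝ φ x Complex.I = - ∫ x, q x * φ x

/-- `V`, with weak gradient `(p, q)`, is the (continuous representative of the) weak solution of
`∇ · (ε_δ ∇ V) = f` in the plane which tends to zero at infinity. -/
structure IsSolution (ri re εc εs δ : ℝ) (f V p q : ℂ → ℂ) : Prop where
  continuous : Continuous V
  grad : HasWeakGradient V p q
  weak_eq : ∀ φ : ℂ → ℂ, IsTestFunction φ →
    ∫ x, permittivity ri re εc εs δ x *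
        (p x * fderiv ℝ φ x 1 + q x * fderiv ℝ φ x Complex.I) = - ∫ x, f x * φ x
  decay : Tendsto V (cocompact ℂ) (𝓝 0)

/-- The dissipated energy `∫ δ |∇ V|²` over the shell `ri ≤ |x| < re`, for a function with weak
gradient `(p, q)`. -/
noncomputable def energy (ri re δ : ℝ) (p q : ℂ → ℂ) : ℝ :=
  ∫ x in {x : ℂ | ri ≤ ‖x‖ ∧ ‖x‖ < re}, δ * (‖p x‖ ^ 2 + ‖q x‖ ^ 2)

/-- The `n`-th Fourier coefficient of `-∂F/∂ν` on the circle of radius `re`, where `F` is the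
Newtonian potential of `f` and `ν` is the outward normal. -/
noncomputable def fluxCoeff (re : ℝ) (f : ℂ → ℂ) (n : ℤ) : ℂ :=
  1 / (2 * (Real.pi : ℂ)) * ∫ θ in (0 : ℝ)..(2 * Real.pi),
    - deriv (fun t : ℝ => newtonianPotential f ((t : ℂ) * Complex.exp (Complex.I * (θ : ℂ)))) re *
      Complex.exp (- (Complex.I * (n : ℂ) * (θ : ℂ)))

/-- The gap property of the flux coefficients, with `ρ = ri / re`. -/
def GapProperty (ri re : ℝ) (f : ℂ → ℂ) : Prop :=
  ∃ n : ℕ → ℤ, StrictMono (fun k => (n k).natAbs) ∧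
    Tendsto (fun k : ℕ =>
      (ri / re) ^ (2 * ((n (k + 1)).natAbs - (n k).natAbs)) *
        (‖fluxCoeff re f (n k)‖ ^ 2 / (((n k).natAbs : ℝ) * (ri / re) ^ (2 * (n k).natAbs))))
      atTop atTop

/-- The Newtonian potential of `f`, which is harmonic in the disk of radius `re`, extends from
there to a harmonic function in the disk of radius `R`. -/
def ExtendsHarmonically (re R : ℝ) (f : ℂ → ℂ) : Prop :=
  ∃ u : ℂ → ℂ, InnerProductSpace.HarmonicOnNhd u (Metric.ball 0 R) ∧
    Set.EqOn u (newtonianPotential f) (Metric.ball 0 re)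

end CALR

open Set AddCircle
open scoped Real ENNReal ComplexConjugate

namespace CALR

/-! ### Polar coordinates -/

/-! The permittivity is radial, so the problem separates into angular modes. The separation is
carried out on the weak formulation, with `s = |z|²` as radial variable and the Wirtinger
derivatives `∂V/∂z`, `∂V/∂z̄` in place of the gradient. Where there is no source, the part of `V` of
frequency `-(m+1)` is a combination of `z̄^(m+1)` and `z^(-(m+1))`. The quantities `a` and `b` of
`RadialSystem` are the suitably normalised modes of the two derivatives, and each is constant in
every source-free layer (`RadialSystem.exists_constOn`). Positive frequencies are reduced to
negative ones by the reflection `z ↦ z̄`. Frequency zero carries no energy in the shell and, outside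
`re`, does not depend on `δ`.

Regularity at the origin, decay at infinity and the two transmission conditions leave a linear
system (`RadialSystem.three_layers`). With `e = εs + iδ`, `c = εc`, `τ = ρ^(2(m+1))`, `X =
ri^(2(m+1))` and `β` the moment of `f`, its solution is `D·bs = 2β(e + c)`, `D·as = -2βX(e - c)`,
where `D = (1 + e)(e + c) + (1 - e)(e - c)τ`. By Parseval the energy is the sum of the explicit
`modeEnergy`. In both resonant cases `|D|` is bounded below by a multiple of `δ + δ² + τ`; the
condition `εc ≠ 1` enters here.

If `e = -c + iδ`, the numerator `e + c` is small too, and every mode is controlled by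
`re^(2(m+1))|β|²`, which is summable for every admissible source. If `e = -1 + iδ`, it is not small,
and a mode dissipates at least a multiple of `δ/(δ + τ)² · re^(2(m+1))|β|²/(m+1)` for `δ ≤ 1`. For
`δ = τ` this is of order `re^(2(m+1))|β|²/(τ(m+1))`, so a bounded energy forces `β = O((m+1)
r_*^(-(m+1)))`. Since the moments are the power series coefficients of `F`, that makes `F` extend to
the disk of radius `r_*`. Conversely, a source beyond `r_*` has moments that decay fast enough to
absorb the loss `1/τ`. Under the gap property, every small `δ` lies between two consecutive values
of `τ` along the sequence, and the mode at the larger one already dissipates much.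

In the exterior the reflected coefficient `ae` is at most of order `re^(2(m+1))|β|/τ`. Divided by
`|x|^(m+1)` with `|x| > re³/ri²` it is dominated by a geometric series in `re/r`, where `r > re`
bounds the support of `f` from inside. This compares `V_δ` with the bounded function `V_1` uniformly
in `δ`, and dividing by a diverging `√E_δ` gives the last claim. -/

instance fact_two_pi_pos : Fact (0 < 2 * π) := ⟨Real.two_pi_pos⟩

/-- Polar coordinates in which the radial variable is the square of the radius. -/
noncomputable def polarMap (q : ℝ × AddCircle (2 * π)) : ℂ :=
  (√q.1 : ℝ) * (toCircle q.2 : ℂ)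

/-- The measure that `polarMap` transports to Lebesgue measure. -/
noncomputable def polarMeasure : Measure (ℝ × AddCircle (2 * π)) :=
  (ENNReal.ofReal π • volume.restrict (Ioi (0 : ℝ))).prod haarAddCircle

lemma continuous_toCircle_coe : Continuous fun t : AddCircle (2 * π) => (toCircle t : ℂ) :=
  continuous_subtype_val.comp AddCircle.continuous_toCircle

lemma continuous_polarMap : Continuous polarMap := by
  unfold polarMap
  exact (Complex.continuous_ofReal.comp (Real.continuous_sqrt.comp continuous_fst)).mul
    (continuous_toCircle_coe.comp continuous_snd)

lemma normSq_polarMap {s : ℝ} (hs : 0 ≤ s) (t : AddCircle (2 * π)) :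
    Complex.normSq (polarMap (s, t)) = s := by
  simp [polarMap, Complex.normSq_eq_norm_sq, Circle.norm_coe, hs]

lemma norm_polarMap (s : ℝ) (t : AddCircle (2 * π)) : ‖polarMap (s, t)‖ = √s := by
  simp [polarMap, abs_of_nonneg, Circle.norm_coe]

lemma lintegral_Ioi_sq (g : ℝ → ℝ≥0∞) :
    ∫⁻ s in Ioi (0 : ℝ), g s = ∫⁻ r in Ioi (0 : ℝ), ENNReal.ofReal (2 * r) * g (r ^ 2) := by
  have himg : (fun r : ℝ => r ^ 2) '' Ioi 0 = Ioi 0 := by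
    ext s
    constructor
    · rintro ⟨r, hr, rfl⟩
      exact pow_pos (mem_Ioi.1 hr) 2
    · intro hs
      exact ⟨√s, Real.sqrt_pos.2 hs, Real.sq_sqrt (le_of_lt hs)⟩
  have hder : ∀ r ∈ Ioi (0 : ℝ), HasDerivWithinAt (fun r : ℝ => r ^ 2) (2 * r) (Ioi 0) r := by
    intro r _
    simpa using (hasDerivAt_pow 2 r).hasDerivWithinAt
  have hinj : InjOn (fun r : ℝ => r ^ 2) (Ioi 0) := by
    intro a ha b hb h
    exact (pow_left_inj₀ (le_of_lt ha) (le_of_lt hb) two_ne_zero).1 h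
  conv_lhs => rw [← himg, lintegral_image_eq_lintegral_abs_deriv_mul measurableSet_Ioi hder hinj]
  refine setLIntegral_congr_fun measurableSet_Ioi fun r hr => ?_
  simp only [abs_of_pos (mul_pos two_pos (mem_Ioi.1 hr))]

/-- With `s = r²`, the area element `r dr dθ` is `π ds` times the normalised angular measure
`dθ/(2π)`. The radial density is therefore constant. -/
lemma lintegral_polarMeasure {G : ℂ → ℝ≥0∞} (hG : Measurable G) :
    ∫⁻ q, G (polarMap q) ∂polarMeasure = ∫⁻ z, G z := by
  have hm : Measurable fun q => G (polarMap q) := hG.comp continuous_polarMap.measurable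
  unfold polarMeasure
  rw [lintegral_prod _ hm.aemeasurable, lintegral_smul_measure,
    lintegral_Ioi_sq, ← Complex.lintegral_comp_polarCoord_symm, polarCoord_target,
    Measure.volume_eq_prod, ← Measure.prod_restrict, lintegral_prod]
  rotate_left
  · refine Measurable.aemeasurable ?_
    refine Measurable.smul (f := fun p : ℝ × ℝ => ENNReal.ofReal p.1) (by fun_prop) (hG.comp ?_)
    have : Measurable fun p : ℝ × ℝ => (p.1 : ℂ) * (Real.cos p.2 + Real.sin p.2 * Complex.I) := by
      fun_prop
    convert this using 1
    exact funext Complex.polarCoord_symm_apply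
  rw [smul_eq_mul, ← lintegral_const_mul]
  rotate_left
  · refine Measurable.mul (by fun_prop) ?_
    exact (hm.lintegral_prod_right').comp (by fun_prop : Measurable fun r : ℝ => r ^ 2)
  refine setLIntegral_congr_fun measurableSet_Ioi fun r hr => ?_
  have hr0 : (0 : ℝ) ≤ r := le_of_lt hr
  have hhaar : (haarAddCircle : Measure (AddCircle (2 * π))) =
      (ENNReal.ofReal (2 * π))⁻¹ • volume := by
    rw [volume_eq_smul_haarAddCircle, smul_smul, ENNReal.inv_mul_cancel
      (by simpa using Real.pi_pos) ENNReal.ofReal_ne_top, one_smul]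
  have h2 : ∫⁻ t, G (polarMap (r ^ 2, t)) ∂haarAddCircle =
      (ENNReal.ofReal (2 * π))⁻¹ * ∫⁻ θ in Ioo (-π) π, G (Complex.polarCoord.symm (r, θ)) := by
    rw [hhaar, lintegral_smul_measure, ← AddCircle.lintegral_preimage (2 * π) (-π),
      smul_eq_mul]
    congr 1
    rw [show -π + 2 * π = π by ring, setLIntegral_congr Ioo_ae_eq_Ioc.symm]
    refine setLIntegral_congr_fun measurableSet_Ioo fun θ _ => ?_
    congr 1
    simp only [polarMap, Complex.polarCoord_symm_apply, Real.sqrt_sq hr0, toCircle_apply_mk]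
    rw [div_self Real.two_pi_pos.ne', one_mul, Circle.coe_exp, Complex.exp_mul_I,
      Complex.ofReal_cos, Complex.ofReal_sin]
  have h3 : (∫⁻ θ in Ioo (-π) π, ENNReal.ofReal r • G (Complex.polarCoord.symm (r, θ))) =
      ENNReal.ofReal r * ∫⁻ θ in Ioo (-π) π, G (Complex.polarCoord.symm (r, θ)) := by
    simp only [smul_eq_mul]
    rw [lintegral_const_mul]
    refine hG.comp ?_
    simp only [Complex.polarCoord_symm_apply]
    fun_prop
  simp only [h2]
  rw [h3, ← mul_assoc, ← mul_assoc]
  congr 1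
  rw [show (2 * r) = 2 * r from rfl, mul_comm (ENNReal.ofReal π), mul_comm 2 r,
    ENNReal.ofReal_mul hr0, mul_assoc, mul_assoc, ← mul_assoc (ENNReal.ofReal 2),
    ← ENNReal.ofReal_mul zero_le_two, ENNReal.mul_inv_cancel (by simpa using Real.pi_pos)
    ENNReal.ofReal_ne_top, mul_one]

lemma measurePreserving_polarMap : MeasurePreserving polarMap polarMeasure volume := by
  refine ⟨continuous_polarMap.measurable, ?_⟩
  ext S hS
  rw [Measure.map_apply continuous_polarMap.measurable hS,
    ← lintegral_indicator_one (continuous_polarMap.measurable hS),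
    ← lintegral_indicator_one (μ := volume) hS, ← lintegral_polarMeasure
    (measurable_one.indicator hS)]
  rfl

lemma preimage_polarMap_normSq {I : Set ℝ} (hI : I ⊆ Ioi 0) :
    polarMap ⁻¹' {z | Complex.normSq z ∈ I} = I ×ˢ univ := by
  ext ⟨s, t⟩
  simp only [mem_preimage, mem_ofPred_eq, mem_prod, mem_univ, and_true]
  rcases le_or_gt 0 s with hs | hs
  · rw [normSq_polarMap hs]
  · have h1 : s ∉ I := fun h => absurd (hI h) (not_lt.2 hs.le)
    have h2 : (0 : ℝ) ∉ I := fun h => lt_irrefl (0 : ℝ) (hI h)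
    simp [polarMap, Real.sqrt_eq_zero_of_nonpos hs.le, h1, h2]

lemma measurePreserving_polarMap_restrict {I : Set ℝ} (hIm : MeasurableSet I) (hI : I ⊆ Ioi 0) :
    MeasurePreserving polarMap ((ENNReal.ofReal π • volume.restrict I).prod haarAddCircle)
      (volume.restrict {z : ℂ | Complex.normSq z ∈ I}) := by
  have h := measurePreserving_polarMap.restrict_preimage
    (s := {z : ℂ | Complex.normSq z ∈ I}) (Complex.continuous_normSq.measurable hIm)
  rw [preimage_polarMap_normSq hI] at h
  unfold polarMeasure at h
  rwa [← Measure.prod_restrict, Measure.restrict_univ, Measure.restrict_smul,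
    Measure.restrict_restrict hIm, inter_eq_left.2 hI] at h

/-! ### Angular Fourier modes -/

/-- The `k`-th Fourier coefficient of `G` on the circle of radius `√s`. -/
noncomputable def mode (G : ℂ → ℂ) (k : ℤ) (s : ℝ) : ℂ :=
  fourierCoeff (fun t : AddCircle (2 * π) => G (polarMap (s, t))) k

lemma mode_eq (G : ℂ → ℂ) (k : ℤ) (s : ℝ) :
    mode G k s = ∫ t, fourier (-k) t * G (polarMap (s, t)) ∂haarAddCircle := rfl

lemma integrable_comp_polarMap {G : ℂ → ℂ} {I : Set ℝ} (hIm : MeasurableSet I) (hI : I ⊆ Ioi 0)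
    (hG : IntegrableOn G {z | Complex.normSq z ∈ I}) :
    Integrable (fun q => G (polarMap q))
      ((ENNReal.ofReal π • volume.restrict I).prod haarAddCircle) :=
  (measurePreserving_polarMap_restrict hIm hI).integrable_comp_of_integrable hG

lemma integrable_fourier_mul {μ : Measure ℝ} [SFinite μ] {G : ℝ × AddCircle (2 * π) → ℂ}
    (hG : Integrable G (μ.prod haarAddCircle)) (k : ℤ) :
    Integrable (fun q => fourier k q.2 * G q) (μ.prod haarAddCircle) := by
  refine hG.bdd_mul (c := 1) ?_ (ae_of_all _ fun q => ?_)
  · exact ((fourier k).continuous.comp continuous_snd).aestronglyMeasurable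
  · rw [fourier_apply]
    exact (Circle.norm_coe _).le

lemma ofReal_pi_ne_zero : ENNReal.ofReal π ≠ 0 := by simpa using Real.pi_pos

lemma integrableOn_mode {G : ℂ → ℂ} {I : Set ℝ} (hIm : MeasurableSet I) (hI : I ⊆ Ioi 0)
    (hG : IntegrableOn G {z | Complex.normSq z ∈ I}) (k : ℤ) : IntegrableOn (mode G k) I := by
  have h := (integrable_fourier_mul (integrable_comp_polarMap hIm hI hG) (-k)).integral_prod_left
  rwa [integrable_smul_measure ofReal_pi_ne_zero ENNReal.ofReal_ne_top] at h

lemma fourier_natCast (l : ℕ) (t : AddCircle (2 * π)) : fourier (l : ℤ) t = (toCircle t : ℂ) ^ l := by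
  rw [fourier_apply, natCast_zsmul, toCircle_nsmul]
  simp

/-- The factor `z^l` selects the angular frequency `-l` of `G` on each circle, so test functions of
this product form suffice to isolate one mode. -/
lemma integral_mul_radial {G : ℂ → ℂ} {k : ℝ → ℂ} (l : ℕ)
    (h : Integrable fun z => G z * (k (Complex.normSq z) * z ^ l)) :
    ∫ z, G z * (k (Complex.normSq z) * z ^ l) =
      π * ∫ s in Ioi (0 : ℝ), k s * ((√s : ℝ) : ℂ) ^ l * mode G (-l) s := by
  have hi := measurePreserving_polarMap.integrable_comp_of_integrable h
  have hint := measurePreserving_polarMap.map_eq ▸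
    integral_map continuous_polarMap.aemeasurable
    (measurePreserving_polarMap.map_eq.symm ▸ h.aestronglyMeasurable)
  rw [hint]
  unfold polarMeasure at hi ⊢
  simp only [Function.comp_def] at hi
  rw [integral_prod _ hi, integral_smul_measure, ENNReal.toReal_ofReal Real.pi_pos.le,
    Complex.real_smul]
  congr 1
  refine setIntegral_congr_fun measurableSet_Ioi fun s hs => ?_
  simp only [mode_eq, neg_neg, normSq_polarMap (le_of_lt hs), fourier_natCast]
  rw [← integral_const_mul]
  congr 1
  ext t
  simp only [polarMap]
  ring

/-! ### Parseval's identity in annuli -/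

lemma lintegral_enorm_sq_eq_tsum_fourierCoeff {g : AddCircle (2 * π) → ℂ}
    (hg : MemLp g 2 haarAddCircle) :
    ∫⁻ t, ‖g t‖ₑ ^ 2 ∂haarAddCircle = ∑' k : ℤ, ‖fourierCoeff g k‖ₑ ^ 2 := by
  have hP := hasSum_sq_fourierCoeff hg.toLp
  have hcoef : ∀ k, fourierCoeff (hg.toLp : AddCircle (2 * π) → ℂ) k = fourierCoeff g k :=
    fun k => congrFun (fourierCoeff_congr_ae hg.coeFn_toLp) k
  simp only [hcoef] at hP
  have hint : ∫ t, ‖(hg.toLp : AddCircle (2 * π) → ℂ) t‖ ^ 2 ∂haarAddCircle =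
      ∫ t, ‖g t‖ ^ 2 ∂haarAddCircle := by
    refine integral_congr_ae ?_
    filter_upwards [hg.coeFn_toLp] with t ht
    rw [ht]
  rw [hint] at hP
  have hsq : ∀ w : ℂ, ‖w‖ₑ ^ 2 = ENNReal.ofReal (‖w‖ ^ 2) := fun w => by
    rw [ENNReal.ofReal_pow (norm_nonneg _), ofReal_norm]
  simp only [hsq]
  rw [← ENNReal.ofReal_tsum_of_nonneg (fun _ => by positivity) hP.summable, hP.tsum_eq,
    ofReal_integral_eq_lintegral_ofReal]
  · exact (memLp_two_iff_integrable_sq_norm hg.1).1 hg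
  · exact ae_of_all _ fun _ => by positivity

lemma aestronglyMeasurable_mode {G : ℂ → ℂ} {I : Set ℝ} (hIm : MeasurableSet I) (hI : I ⊆ Ioi 0)
    (hG : AEStronglyMeasurable G (volume.restrict {z : ℂ | Complex.normSq z ∈ I})) (k : ℤ) :
    AEStronglyMeasurable (mode G k) (volume.restrict I) := by
  have h1 := hG.comp_measurePreserving (measurePreserving_polarMap_restrict hIm hI)
  have h2 : AEStronglyMeasurable (fun q => fourier (-k) q.2 * G (polarMap q))
      ((ENNReal.ofReal π • volume.restrict I).prod haarAddCircle) :=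
    (((fourier (-k)).continuous.comp continuous_snd).aestronglyMeasurable).mul h1
  have h3 := h2.integral_prod_right'
  exact h3.mono_ac (Measure.absolutelyContinuous_smul ofReal_pi_ne_zero)

/-- By Tonelli, `G` is square integrable on almost every circle, where Parseval applies. With values
in `ℝ≥0∞`, the sum and the radial integral commute freely. -/
lemma lintegral_annulus_eq_tsum_mode {G : ℂ → ℂ} {I : Set ℝ} (hIm : MeasurableSet I)
    (hI : I ⊆ Ioi 0) (hG : MemLp G 2 (volume.restrict {z : ℂ | Complex.normSq z ∈ I})) :
    ∫⁻ z in {z : ℂ | Complex.normSq z ∈ I}, ‖G z‖ₑ ^ 2 =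
      ENNReal.ofReal π * ∑' k : ℤ, ∫⁻ s in I, ‖mode G k s‖ₑ ^ 2 := by
  have hmp := measurePreserving_polarMap_restrict hIm hI
  have hG' : AEMeasurable (fun z => ‖G z‖ₑ ^ 2)
    (volume.restrict {z : ℂ | Complex.normSq z ∈ I}) := hG.1.enorm.pow_const 2
  have hcomp := hG.1.comp_measurePreserving hmp
  have hcomp' : AEMeasurable (fun q => ‖G (polarMap q)‖ₑ ^ 2)
      ((ENNReal.ofReal π • volume.restrict I).prod haarAddCircle) := hcomp.enorm.pow_const 2
  have hfin : ∫⁻ z in {z : ℂ | Complex.normSq z ∈ I}, ‖G z‖ₑ ^ 2 ≠ ⊤ := by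
    have := hG.2
    rw [eLpNorm_lt_top_iff_lintegral_rpow_enorm_lt_top two_ne_zero ENNReal.ofNat_ne_top] at this
    simpa using this.ne
  have hpol : ∫⁻ z in {z : ℂ | Complex.normSq z ∈ I}, ‖G z‖ₑ ^ 2 =
      ENNReal.ofReal π * ∫⁻ s in I, ∫⁻ t, ‖G (polarMap (s, t))‖ₑ ^ 2 ∂haarAddCircle := by
    rw [← hmp.map_eq] at hG' ⊢
    rw [lintegral_map' hG' hmp.aemeasurable, lintegral_prod _ hcomp', lintegral_smul_measure,
      smul_eq_mul]
  have hslice : ∀ᵐ s ∂(volume.restrict I),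
      ∫⁻ t, ‖G (polarMap (s, t))‖ₑ ^ 2 ∂haarAddCircle = ∑' k : ℤ, ‖mode G k s‖ₑ ^ 2 := by
    have h1 := hcomp.prodMk_left
    rw [Measure.ae_ennreal_smul_measure_iff ofReal_pi_ne_zero] at h1
    have h2 : ∀ᵐ s ∂(volume.restrict I),
        ∫⁻ t, ‖G (polarMap (s, t))‖ₑ ^ 2 ∂haarAddCircle < ⊤ := by
      have h3 := hcomp'.lintegral_prod_right'
      rw [aemeasurable_smul_measure_iff ofReal_pi_ne_zero] at h3
      refine ae_lt_top' h3 fun htop => hfin ?_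
      rw [hpol, htop, ENNReal.mul_top ofReal_pi_ne_zero]
    filter_upwards [h1, h2] with s hs1 hs2
    refine lintegral_enorm_sq_eq_tsum_fourierCoeff ⟨hs1, ?_⟩
    rw [eLpNorm_lt_top_iff_lintegral_rpow_enorm_lt_top two_ne_zero ENNReal.ofNat_ne_top]
    simpa using hs2
  rw [hpol, lintegral_congr_ae hslice, lintegral_tsum]
  exact fun k => ((aestronglyMeasurable_mode hIm hI hG.1 k).enorm.pow_const 2)

/-! ### Functions with vanishing weak derivative -/

/-- The primitive vanishes outside the convex hull of the support of `g`; order connectedness keeps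
this hull inside `U`. -/
lemma exists_primitive_of_integral_eq_zero {U : Set ℝ} (hU : U.OrdConnected) {g : ℝ → ℂ}
    (hg : ContDiff ℝ ∞ g) (hc : HasCompactSupport g) (hs : tsupport g ⊆ U) (h0 : ∫ s, g s = 0) :
    ∃ G : ℝ → ℂ, ContDiff ℝ ∞ G ∧ HasCompactSupport G ∧ tsupport G ⊆ U ∧ deriv G = g := by
  rcases (tsupport g).eq_empty_or_nonempty with hE | hne
  · refine ⟨0, contDiff_const, HasCompactSupport.zero, by simp [tsupport], ?_⟩
    have : g = 0 := by
      rwa [tsupport_eq_empty_iff] at hE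
    rw [this]
    ext s
    simp
  have hc' : IsCompact (tsupport g) := hc
  obtain ⟨c, hcm, hcl⟩ := hc'.exists_isLeast hne
  obtain ⟨d, hdm, hdl⟩ := hc'.exists_isGreatest hne
  have hcU := hs hcm
  have hdU := hs hdm
  have hz : ∀ s, s ∉ Icc c d → g s = 0 := fun s hsn => by
    by_contra hne
    exact hsn ⟨hcl (subset_tsupport _ hne), hdl (subset_tsupport _ hne)⟩
  have hder : ∀ s, HasDerivAt (fun s => ∫ x in c..s, g x) (g s) s := fun s =>
    intervalIntegral.integral_hasDerivAt_right (hg.continuous.intervalIntegrable _ _)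
      (hg.continuous.stronglyMeasurableAtFilter _ _) hg.continuous.continuousAt
  have hderiv : deriv (fun s => ∫ x in c..s, g x) = g := funext fun s => (hder s).deriv
  have hzero : ∀ s, s ∉ Icc c d → (∫ x in c..s, g x) = 0 := by
    intro s hsn
    by_cases hsc : s < c
    · rw [intervalIntegral.integral_symm, neg_eq_zero, intervalIntegral.integral_of_le hsc.le,
        ← integral_Ico_eq_integral_Ioc]
      refine setIntegral_eq_zero_of_forall_eq_zero fun x hx => hz x fun hx' => ?_
      exact absurd hx.2 (not_lt.2 hx'.1)
    · have hds : d < s := by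
        by_contra hds
        exact hsn ⟨not_lt.1 hsc, not_lt.1 hds⟩
      rw [intervalIntegral.integral_of_le (not_lt.1 hsc), ← integral_Icc_eq_integral_Ioc,
        setIntegral_eq_integral_of_forall_compl_eq_zero, h0]
      exact fun x hx => hz x fun hx' => hx ⟨hx'.1, hx'.2.trans hds.le⟩
  have hsupp : tsupport (fun s => ∫ x in c..s, g x) ⊆ Icc c d := by
    refine closure_minimal ?_ isClosed_Icc
    intro s hs
    by_contra hsn
    exact hs (hzero s hsn)
  refine ⟨fun s => ∫ x in c..s, g x, ?_, ?_, ?_, hderiv⟩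
  · rw [contDiff_infty_iff_deriv, hderiv]
    exact ⟨fun s => (hder s).differentiableAt, hg⟩
  · exact isCompact_Icc.of_isClosed_subset (isClosed_tsupport _) hsupp
  · exact hsupp.trans (hU.out hcU hdU)

lemma ae_eq_zero_of_integral_mul_eq_zero {u : ℝ → ℂ} {U : Set ℝ} (hU : IsOpen U)
    (hu : LocallyIntegrableOn u U)
    (h : ∀ g : ℝ → ℂ, ContDiff ℝ ∞ g → HasCompactSupport g → tsupport g ⊆ U →
      ∫ s, g s * u s = 0) : ∀ᵐ s, s ∈ U → u s = 0 := by
  refine hU.ae_eq_zero_of_integral_contDiff_smul_eq_zero hu fun g hg hc hs => ?_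
  have hsub : tsupport (fun s => (g s : ℂ)) ⊆ tsupport g :=
    closure_mono fun s hs h0 => hs (by simp [h0])
  have := h (fun s => (g s : ℂ)) (Complex.ofRealCLM.contDiff.comp hg)
    (hc.isCompact.of_isClosed_subset (isClosed_tsupport _) hsub) (hsub.trans hs)
  simpa only [Complex.real_smul] using this

lemma integrable_mul_of_tsupport_subset {u g : ℝ → ℂ} {U : Set ℝ}
    (hu : LocallyIntegrableOn u U) (hg : Continuous g) (hc : HasCompactSupport g)
    (hs : tsupport g ⊆ U) : Integrable fun s => g s * u s := by
  have h1 : IntegrableOn u (tsupport g) := hu.integrableOn_compact_subset hs hc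
  have h2 : IntegrableOn (fun s => g s * u s) (tsupport g) :=
    h1.continuousOn_mul hg.continuousOn hc
  refine (integrableOn_iff_integrable_of_support_subset ?_).1 h2
  intro s hs
  exact subset_tsupport _ (left_ne_zero_of_mul hs)

lemma exists_smooth_integral_eq_one {U : Set ℝ} (hU : IsOpen U) (hne : U.Nonempty) :
    ∃ k : ℝ → ℂ, ContDiff ℝ ∞ k ∧ HasCompactSupport k ∧ tsupport k ⊆ U ∧ ∫ s, k s = 1 := by
  obtain ⟨x, hx⟩ := hne
  obtain ⟨r, hr, hrU⟩ := Metric.isOpen_iff.1 hU x hx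
  let b : ContDiffBump x := ⟨r / 4, r / 2, by positivity, by linarith⟩
  have hbU : tsupport b ⊆ U := by
    rw [b.tsupport_eq]
    exact (Metric.closedBall_subset_ball (by show r / 2 < r; linarith)).trans hrU
  let k : ℝ → ℂ := fun s => (b.normed volume s : ℂ)
  have hkt : tsupport k ⊆ tsupport b := by
    rw [b.tsupport_eq, ← b.tsupport_normed_eq (μ := volume)]
    refine closure_mono fun s hs h0 => hs ?_
    simp [k, h0]
  refine ⟨k, Complex.ofRealCLM.contDiff.comp b.contDiff_normed,
    b.hasCompactSupport.isCompact.of_isClosed_subset (isClosed_tsupport _) hkt, hkt.trans hbU, ?_⟩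
  simp only [k]
  rw [integral_complex_ofReal, b.integral_normed, Complex.ofReal_one]

/-- The du Bois-Reymond lemma. For a fixed bump `k` of integral one, `g - (∫ g) k` has mean zero,
hence is the derivative of a test function in `U`; the constant is `∫ k u`. -/
lemma ae_eq_const_of_integral_deriv_mul_eq_zero {u : ℝ → ℂ} {U : Set ℝ} (hU : IsOpen U)
    (hU' : U.OrdConnected) (hne : U.Nonempty) (hu : LocallyIntegrableOn u U)
    (h : ∀ g : ℝ → ℂ, ContDiff ℝ ∞ g → HasCompactSupport g → tsupport g ⊆ U →
      ∫ s, deriv g s * u s = 0) : ∃ c : ℂ, ∀ᵐ s, s ∈ U → u s = c := by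
  obtain ⟨k, hk, hkc, hkU, hk1⟩ := exists_smooth_integral_eq_one hU hne
  set c : ℂ := ∫ s, k s * u s with hcdef
  refine ⟨c, ?_⟩
  have key := ae_eq_zero_of_integral_mul_eq_zero (u := fun s => u s - c) hU
    (hu.sub (locallyIntegrableOn_const c)) ?_
  · filter_upwards [key] with s hs hsU
    exact sub_eq_zero.1 (hs hsU)
  intro g hg hgc hgU
  have hgi : Integrable g := hg.continuous.integrable_of_hasCompactSupport hgc
  have hki : Integrable k := hk.continuous.integrable_of_hasCompactSupport hkc
  set I : ℂ := ∫ s, g s with hI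
  have hts : tsupport (fun s => g s - I * k s) ⊆ tsupport g ∪ tsupport k := by
    refine closure_minimal ?_ ((isClosed_tsupport _).union (isClosed_tsupport _))
    intro s hs
    by_contra hn
    rw [mem_union, not_or] at hn
    exact hs (by simp [image_eq_zero_of_notMem_tsupport hn.1,
      image_eq_zero_of_notMem_tsupport hn.2])
  obtain ⟨G, hG, hGc, hGU, hGd⟩ := exists_primitive_of_integral_eq_zero hU'
    (g := fun s => g s - I * k s) (hg.sub (contDiff_const.mul hk))
    ((hgc.isCompact.union hkc).of_isClosed_subset (isClosed_tsupport _) hts)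
    (hts.trans (union_subset hgU hkU))
    (by rw [integral_sub hgi (hki.const_mul I), integral_const_mul, hk1, ← hI]; ring)
  have h1 := h G hG hGc hGU
  rw [hGd] at h1
  have hgu := integrable_mul_of_tsupport_subset hu hg.continuous hgc hgU
  have hku := integrable_mul_of_tsupport_subset hu hk.continuous hkc hkU
  have h2 : ∫ s, (g s - I * k s) * u s = (∫ s, g s * u s) - I * c := by
    rw [hcdef, ← integral_const_mul, ← integral_sub hgu (hku.const_mul I)]
    congr 1
    ext s
    ring
  have h3 : ∫ s, g s * (u s - c) = (∫ s, g s * u s) - I * c := by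
    rw [hI, ← integral_mul_const, ← integral_sub hgu (hgi.mul_const c)]
    congr 1
    ext s
    ring
  rw [h3, ← h2, h1]

/-! ### The radial system satisfied by the angular modes -/

/-- Smooth functions on the line with compact support contained in `U`. -/
structure IsBumpOn (U : Set ℝ) (g : ℝ → ℂ) : Prop where
  smooth : ContDiff ℝ ∞ g
  compact : HasCompactSupport g
  supp : tsupport g ⊆ U

namespace IsBumpOn

variable {U U' : Set ℝ} {g : ℝ → ℂ}

lemma mono (h : IsBumpOn U g) (hU : U ⊆ U') : IsBumpOn U' g := ⟨h.1, h.2, h.3.trans hU⟩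

lemma eq_zero (h : IsBumpOn U g) {s : ℝ} (hs : s ∉ U) : g s = 0 :=
  image_eq_zero_of_notMem_tsupport fun h' => hs (h.3 h')

protected lemma deriv (h : IsBumpOn U g) : IsBumpOn U (deriv g) :=
  ⟨(contDiff_infty_iff_deriv.1 h.1).2, h.2.deriv, tsupport_deriv_subset.trans h.3⟩

lemma differentiable (h : IsBumpOn U g) : Differentiable ℝ g := h.1.differentiable (by simp)

lemma continuous (h : IsBumpOn U g) : Continuous g := h.1.continuous

lemma mul_contDiffOn (h : IsBumpOn U g) (hU : IsOpen U) {k : ℝ → ℂ} (hk : ContDiffOn ℝ ∞ k U) :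
    IsBumpOn U fun s => g s * k s := by
  have hsub : tsupport (fun s => g s * k s) ⊆ tsupport g :=
    closure_mono fun s hs => left_ne_zero_of_mul hs
  refine ⟨contDiff_iff_contDiffAt.2 fun s => ?_,
    h.2.isCompact.of_isClosed_subset (isClosed_tsupport _) hsub, hsub.trans h.3⟩
  by_cases hs : s ∈ U
  · exact h.1.contDiffAt.mul (hk.contDiffAt (hU.mem_nhds hs))
  · have hs' : s ∉ tsupport g := fun h' => hs (h.3 h')
    refine (contDiffAt_const (c := (0 : ℂ))).congr_of_eventuallyEq ?_
    filter_upwards [(isClosed_tsupport g).isOpen_compl.mem_nhds hs'] with x hx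
    rw [image_eq_zero_of_notMem_tsupport hx, zero_mul]

lemma integrable_mul (h : IsBumpOn U g) {u : ℝ → ℂ} (hu : LocallyIntegrableOn u U) :
    Integrable fun s => g s * u s :=
  integrable_mul_of_tsupport_subset hu h.continuous h.2 h.3

end IsBumpOn

lemma contDiffOn_inv_pow (n : ℕ) : ContDiffOn ℝ ∞ (fun s : ℝ => ((s : ℂ) ^ n)⁻¹) (Ioi 0) := by
  refine ContDiffOn.inv ?_ fun s hs => pow_ne_zero _ (by exact_mod_cast (ne_of_gt hs))
  exact ((Complex.ofRealCLM.contDiff).pow n).contDiffOn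

/-- The system linking the modes `a`, `b` of the gradient and `v` of the potential, in terms of the
squared radius. The permittivity is `ε` and `S` is the source functional. -/
structure RadialSystem (m : ℕ) (ε : ℝ → ℂ) (S : (ℝ → ℂ) → ℂ) (a b v : ℝ → ℂ) : Prop where
  a_int : LocallyIntegrableOn a (Ioi 0)
  b_int : LocallyIntegrableOn b (Ioi 0)
  v_cont : ContinuousOn v (Ioi 0)
  algebraic : ∀ᵐ s : ℝ, s ∈ Ioi (0 : ℝ) → a s = (s : ℂ) ^ (m + 1) * b s - (m + 1) * v s
  potential : ∀ h, IsBumpOn (Ioi 0) h → ∫ s, h s * ((s : ℂ) ^ m * b s) = -∫ s, deriv h s * v s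
  flux : ∀ h, IsBumpOn (Ioi 0) h →
    ∫ s, ε s * (deriv h s * a s + (s * deriv h s + (m + 1) * h s) * ((s : ℂ) ^ m * b s)) = S h
  v_zero : Tendsto v (𝓝[>] 0) (𝓝 0)
  v_infty : Tendsto (fun s : ℝ => v s / (s : ℂ) ^ (m + 1)) atTop (𝓝 0)

namespace RadialSystem

variable {m : ℕ} {ε : ℝ → ℂ} {S : (ℝ → ℂ) → ℂ} {a b v : ℝ → ℂ}

lemma pow_mul_b_int (H : RadialSystem m ε S a b v) (n : ℕ) :
    LocallyIntegrableOn (fun s : ℝ => (s : ℂ) ^ n * b s) (Ioi 0) :=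
  H.b_int.continuousOn_mul (by fun_prop) isOpen_Ioi.isLocallyClosed

lemma v_int (H : RadialSystem m ε S a b v) : LocallyIntegrableOn v (Ioi 0) :=
  H.v_cont.locallyIntegrableOn measurableSet_Ioi

/-- The two halves of the flux integrand have equal integrals when no permittivity is present. Where
`ε` is constant, the flux equation thus becomes an equation for `a` alone, or for `b` alone. -/
lemma integral_deriv_mul_a (H : RadialSystem m ε S a b v) {h : ℝ → ℂ} (hh : IsBumpOn (Ioi 0) h) :
    ∫ s, deriv h s * a s =
      ∫ s, (s * deriv h s + (m + 1) * h s) * ((s : ℂ) ^ m * b s) := by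
  have h1 : ∫ s, deriv h s * a s = ∫ s, (deriv h s * ((s : ℂ) ^ (m + 1) * b s) -
      (m + 1) * (deriv h s * v s)) := by
    refine integral_congr_ae ?_
    filter_upwards [H.algebraic] with s hs
    by_cases hs0 : s ∈ Ioi (0 : ℝ)
    · rw [hs hs0]; ring
    · rw [hh.deriv.eq_zero hs0]; ring
  have i1 := hh.deriv.integrable_mul (H.pow_mul_b_int (m + 1))
  have i2 := hh.deriv.integrable_mul H.v_int
  have i3 := hh.integrable_mul (H.pow_mul_b_int m)
  rw [h1, integral_sub i1 (i2.const_mul _), integral_const_mul, ← neg_eq_iff_eq_neg.2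
    (H.potential h hh), mul_neg, sub_neg_eq_add, ← integral_const_mul,
    ← integral_add i1 (i3.const_mul _)]
  congr 1
  ext s
  ring

lemma two_mul_integral_deriv_mul_a (H : RadialSystem m ε S a b v) {J : Set ℝ} (hJ : J ⊆ Ioi 0)
    {e : ℂ} (he : ∀ s ∈ J, ε s = e) {h : ℝ → ℂ} (hh : IsBumpOn J h) :
    2 * e * ∫ s, deriv h s * a s = S h := by
  have hh' := hh.mono hJ
  have i1 := hh'.deriv.integrable_mul H.a_int
  have i2 := hh'.deriv.integrable_mul (H.pow_mul_b_int (m + 1))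
  have i3 := (hh'.integrable_mul (H.pow_mul_b_int m)).const_mul (m + 1 : ℂ)
  have i4 : Integrable fun s : ℝ => (s * deriv h s + (m + 1) * h s) * ((s : ℂ) ^ m * b s) := by
    refine (i2.add i3).congr (ae_of_all _ fun s => ?_)
    simp only [Pi.add_apply]
    ring
  rw [← H.flux h hh']
  have : ∀ s : ℝ, ε s * (deriv h s * a s + (s * deriv h s + (m + 1) * h s) * ((s : ℂ) ^ m * b s)) =
      e * (deriv h s * a s + (s * deriv h s + (m + 1) * h s) * ((s : ℂ) ^ m * b s)) := by
    intro s
    by_cases hs : s ∈ J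
    · rw [he s hs]
    · rw [hh.eq_zero hs, hh.deriv.eq_zero hs]; ring
  simp only [this]
  rw [integral_const_mul, integral_add i1 i4, ← H.integral_deriv_mul_a hh']
  ring

/-- The choice `h = g s^(-(m+1))` works because `s h' + (m+1) h = s^(-m) g'`, which cancels the
weight `s^m` in front of `b`. -/
lemma two_mul_integral_deriv_mul_b (H : RadialSystem m ε S a b v) {J : Set ℝ} (hJ : J ⊆ Ioi 0)
    (hJo : IsOpen J) {e : ℂ} (he : ∀ s ∈ J, ε s = e) {g : ℝ → ℂ} (hg : IsBumpOn J g) :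
    2 * e * ∫ s, deriv g s * b s = S fun s => g s * ((s : ℂ) ^ (m + 1))⁻¹ := by
  have hh := hg.mul_contDiffOn hJo ((contDiffOn_inv_pow (m + 1)).mono hJ)
  rw [← H.two_mul_integral_deriv_mul_a hJ he hh, H.integral_deriv_mul_a (hh.mono hJ)]
  congr 2
  ext s
  by_cases hs : s ∈ J
  · have hs0 : (s : ℂ) ≠ 0 := by exact_mod_cast (ne_of_gt (hJ hs))
    have hd : deriv (fun s : ℝ => g s * ((s : ℂ) ^ (m + 1))⁻¹) s =
        deriv g s * ((s : ℂ) ^ (m + 1))⁻¹ +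
          g s * (-((m + 1) * (s : ℂ) ^ m) / ((s : ℂ) ^ (m + 1)) ^ 2) := by
      have h1 : HasDerivAt (fun s : ℝ => (s : ℂ) ^ (m + 1)) ((m + 1) * (s : ℂ) ^ m) s := by
        have := ((hasDerivAt_id (s : ℂ)).pow (m + 1)).comp_ofReal
        simpa using this
      exact ((hg.differentiable s).hasDerivAt.mul (h1.inv (pow_ne_zero _ hs0))).deriv
    rw [hd]
    field_simp
    ring
  · rw [hh.deriv.eq_zero hs, hh.eq_zero hs, hg.deriv.eq_zero hs]
    ring

end RadialSystem

/-- A source-free piece of the radial system: there `a` and `b` are constant. -/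
structure ConstOn (m : ℕ) (a b v : ℝ → ℂ) (J : Set ℝ) (ca cb : ℂ) : Prop where
  a_eq : ∀ᵐ s, s ∈ J → a s = ca
  b_eq : ∀ᵐ s, s ∈ J → b s = cb
  v_eq : ∀ s ∈ J, (m + 1) * v s = (s : ℂ) ^ (m + 1) * cb - ca

lemma eqOn_of_ae_eq {J : Set ℝ} (hJ : IsOpen J) {u w : ℝ → ℂ} (hu : ContinuousOn u J)
    (hw : ContinuousOn w J) (h : ∀ᵐ s, s ∈ J → u s = w s) : EqOn u w J := by
  refine Measure.eqOn_open_of_ae_eq (μ := volume) ?_ hJ hu hw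
  rwa [EventuallyEq, ae_restrict_iff' hJ.measurableSet]

namespace RadialSystem

variable {m : ℕ} {ε : ℝ → ℂ} {S : (ℝ → ℂ) → ℂ} {a b v : ℝ → ℂ}

lemma exists_constOn (H : RadialSystem m ε S a b v) {J : Set ℝ} (hJ : J ⊆ Ioi 0)
    (hJo : IsOpen J) (hJc : J.OrdConnected) (hJn : J.Nonempty) {e : ℂ} (he0 : e ≠ 0)
    (he : ∀ s ∈ J, ε s = e) (hS : ∀ h, IsBumpOn J h → S h = 0) :
    ∃ ca cb, ConstOn m a b v J ca cb := by
  obtain ⟨ca, hca⟩ := ae_eq_const_of_integral_deriv_mul_eq_zero hJo hJc hJn (H.a_int.mono_set hJ)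
    fun g h1 h2 h3 => by
      have := H.two_mul_integral_deriv_mul_a hJ he ⟨h1, h2, h3⟩
      rw [hS g ⟨h1, h2, h3⟩] at this
      simpa [he0] using this
  obtain ⟨cb, hcb⟩ := ae_eq_const_of_integral_deriv_mul_eq_zero hJo hJc hJn (H.b_int.mono_set hJ)
    fun g h1 h2 h3 => by
      have hg : IsBumpOn J g := ⟨h1, h2, h3⟩
      have := H.two_mul_integral_deriv_mul_b hJ hJo he hg
      rw [hS _ (hg.mul_contDiffOn hJo ((contDiffOn_inv_pow (m + 1)).mono hJ))] at this
      simpa [he0] using this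
  refine ⟨ca, cb, hca, hcb, eqOn_of_ae_eq hJo ?_ (by fun_prop) ?_⟩
  · exact continuousOn_const.mul (H.v_cont.mono hJ)
  · filter_upwards [hca, hcb, H.algebraic] with s h1 h2 h3 hs
    have := h3 (hJ hs)
    rw [h1 hs, h2 hs] at this
    rw [this]; ring

end RadialSystem

/-- A smooth cutoff which is `1` on `[p, q]` with support in `(p', q')`. -/
lemma exists_cutoff {p' p q q' : ℝ} (h1 : p' < p) (h3 : q < q') :
    ∃ g : ℝ → ℂ, IsBumpOn (Ioo p' q') g ∧ ∀ s ∈ Icc p q, g s = 1 := by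
  obtain ⟨g, hg, -, hsupp, hg1⟩ := exists_contMDiff_support_eq_eq_one_iff (n := ⊤)
    (modelWithCornersSelf ℝ ℝ) (isOpen_Ioo (a := (p' + p) / 2) (b := (q + q') / 2))
    (isClosed_Icc (a := p) (b := q)) (fun s hs => ⟨by linarith [hs.1], by linarith [hs.2]⟩)
  have hsub : tsupport (fun s => (g s : ℂ)) ⊆ Icc ((p' + p) / 2) ((q + q') / 2) := by
    refine closure_minimal (fun s hs => ?_) isClosed_Icc
    have : s ∈ Function.support g := fun h0 => hs (by simp [h0])
    rw [hsupp] at this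
    exact Ioo_subset_Icc_self this
  refine ⟨fun s => (g s : ℂ), ⟨Complex.ofRealCLM.contDiff.comp hg.contDiff,
    isCompact_Icc.of_isClosed_subset (isClosed_tsupport _) hsub,
    hsub.trans fun s hs => ⟨by linarith [hs.1], by linarith [hs.2]⟩⟩, fun s hs => ?_⟩
  simp only [(hg1 s).1 hs, Complex.ofReal_one]

/-- Taken with `p = q` it gives the jump of `u` at an interface. Taken with `p < q` it jumps over
the annulus carrying the source, where `u` is not known but `g` is constant. -/
lemma integral_deriv_mul_piecewise {α p q β : ℝ} (hpq : p ≤ q) {g u : ℝ → ℂ}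
    (hg : IsBumpOn (Ioo α β) g) {c₁ c₂ : ℂ} (h1 : ∀ᵐ s, s ∈ Ioo α p → u s = c₁)
    (h2 : ∀ᵐ s, s ∈ Ioo q β → u s = c₂) (h0 : ∀ s ∈ Ioo p q, deriv g s = 0) :
    Integrable (fun s => deriv g s * u s) ∧ ∫ s, deriv g s * u s = c₁ * g p - c₂ * g q := by
  have hd : Integrable (deriv g) :=
    hg.deriv.continuous.integrable_of_hasCompactSupport hg.deriv.compact
  have hae : (fun s => deriv g s * u s) =ᵐ[volume] fun s =>
      (Iic p).indicator (fun s => deriv g s * c₁) s +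
        (Ioi q).indicator (fun s => deriv g s * c₂) s := by
    have hp : ∀ᵐ s : ℝ, s ≠ p := compl_mem_ae_iff.2 (measure_singleton p)
    have hq : ∀ᵐ s : ℝ, s ≠ q := compl_mem_ae_iff.2 (measure_singleton q)
    filter_upwards [h1, h2, hp, hq] with s hs1 hs2 hsp hsq
    by_cases hs : s ∈ Ioo α β
    · rcases lt_or_gt_of_ne hsp with hlt | hgt
      · rw [hs1 ⟨hs.1, hlt⟩, indicator_of_mem (show s ∈ Iic p from hlt.le),
          indicator_of_notMem (show s ∉ Ioi q from not_lt.2 (hlt.le.trans hpq)), add_zero]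
      · rw [indicator_of_notMem (show s ∉ Iic p from not_le.2 hgt), zero_add]
        rcases lt_or_gt_of_ne hsq with hlt' | hgt'
        · rw [indicator_of_notMem (show s ∉ Ioi q from not_lt.2 hlt'.le), h0 s ⟨hgt, hlt'⟩, zero_mul]
        · rw [hs2 ⟨hgt', hs.2⟩, indicator_of_mem (show s ∈ Ioi q from hgt')]
    · simp [indicator, hg.deriv.eq_zero hs]
  have i1 : Integrable ((Iic p).indicator fun s => deriv g s * c₁) :=
    (hd.mul_const c₁).indicator measurableSet_Iic
  have i2 : Integrable ((Ioi q).indicator fun s => deriv g s * c₂) :=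
    (hd.mul_const c₂).indicator measurableSet_Ioi
  refine ⟨(i1.add i2).congr hae.symm, ?_⟩
  have hC : ContDiff ℝ 1 g := hg.smooth.of_le (by exact_mod_cast le_top)
  rw [integral_congr_ae hae, integral_add i1 i2, integral_indicator measurableSet_Iic,
    integral_indicator measurableSet_Ioi, integral_mul_const, integral_mul_const,
    HasCompactSupport.integral_Iic_deriv_eq hC hg.compact,
    HasCompactSupport.integral_Ioi_deriv_eq hC hg.compact]
  ring

namespace RadialSystem

variable {m : ℕ} {ε : ℝ → ℂ} {S : (ℝ → ℂ) → ℂ} {a b v : ℝ → ℂ}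

/-- The transmission conditions: continuity of the potential `v` across `σ`, and continuity of the
normal flux, read off by testing with a cutoff equal to `1` at `σ`. -/
lemma interface (H : RadialSystem m ε S a b v) {α σ β : ℝ} (hα : 0 ≤ α) (h1 : α < σ) (h2 : σ < β)
    {e₁ e₂ a₁ a₂ b₁ b₂ : ℂ} (hε₁ : ∀ s ∈ Ioo α σ, ε s = e₁) (hε₂ : ∀ s ∈ Ioo σ β, ε s = e₂)
    (hc₁ : ConstOn m a b v (Ioo α σ) a₁ b₁) (hc₂ : ConstOn m a b v (Ioo σ β) a₂ b₂)
    (hS : ∀ h, IsBumpOn (Ioo α β) h → S h = 0) :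
    (σ : ℂ) ^ (m + 1) * b₁ - a₁ = (σ : ℂ) ^ (m + 1) * b₂ - a₂ ∧
      e₁ * (a₁ + (σ : ℂ) ^ (m + 1) * b₁) = e₂ * (a₂ + (σ : ℂ) ^ (m + 1) * b₂) := by
  have hσ : 0 < σ := hα.trans_lt h1
  constructor
  · have hv : ContinuousAt v σ := H.v_cont.continuousAt (Ioi_mem_nhds hσ)
    have hp : ∀ c d : ℂ, Continuous fun s : ℝ => (s : ℂ) ^ (m + 1) * d - c := fun c d => by fun_prop
    have hv' : Tendsto (fun s => (m + 1 : ℂ) * v s) (𝓝 σ) (𝓝 ((m + 1) * v σ)) :=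
      hv.const_mul _
    have hl : Tendsto (fun s => (m + 1 : ℂ) * v s) (𝓝[<] σ) (𝓝 ((σ : ℂ) ^ (m + 1) * b₁ - a₁)) := by
      refine (((hp a₁ b₁).tendsto σ).mono_left nhdsWithin_le_nhds).congr' ?_
      filter_upwards [Ioo_mem_nhdsLT h1] with s hs
      exact (hc₁.v_eq s hs).symm
    have hr : Tendsto (fun s => (m + 1 : ℂ) * v s) (𝓝[>] σ) (𝓝 ((σ : ℂ) ^ (m + 1) * b₂ - a₂)) := by
      refine (((hp a₂ b₂).tendsto σ).mono_left nhdsWithin_le_nhds).congr' ?_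
      filter_upwards [Ioo_mem_nhdsGT h2] with s hs
      exact (hc₂.v_eq s hs).symm
    rw [tendsto_nhds_unique hl (hv'.mono_left nhdsWithin_le_nhds),
      tendsto_nhds_unique hr (hv'.mono_left nhdsWithin_le_nhds)]
  · obtain ⟨h, hh, hh1⟩ := exists_cutoff h1 h2
    have hhσ : h σ = 1 := hh1 σ ⟨le_rfl, le_rfl⟩
    have hsub : Ioo α β ⊆ Ioi 0 := fun s hs => hα.trans_lt hs.1
    have hk : IsBumpOn (Ioo α β) fun s => h s * (s : ℂ) ^ (m + 1) :=
      hh.mul_contDiffOn isOpen_Ioo ((Complex.ofRealCLM.contDiff).pow (m + 1)).contDiffOn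
    -- The coefficient of `b` in the flux equation is an exact derivative, so both terms reduce to
    -- jumps.
    have hkd : ∀ s : ℝ, deriv (fun s : ℝ => h s * (s : ℂ) ^ (m + 1)) s =
        (s * deriv h s + (m + 1) * h s) * (s : ℂ) ^ m := by
      intro s
      have h1 : HasDerivAt (fun s : ℝ => (s : ℂ) ^ (m + 1)) ((m + 1) * (s : ℂ) ^ m) s := by
        have := ((hasDerivAt_id (s : ℂ)).pow (m + 1)).comp_ofReal
        simpa using this
      refine ((hh.differentiable s).hasDerivAt.mul h1).deriv.trans ?_
      ring
    obtain ⟨i1, e1⟩ := integral_deriv_mul_piecewise (le_refl σ) hh (u := fun s => ε s * a s)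
      (c₁ := e₁ * a₁) (c₂ := e₂ * a₂)
      (by filter_upwards [hc₁.a_eq] with s hs hs'; rw [hs hs', hε₁ s hs'])
      (by filter_upwards [hc₂.a_eq] with s hs hs'; rw [hs hs', hε₂ s hs']) (by simp)
    obtain ⟨i2, e2⟩ := integral_deriv_mul_piecewise (le_refl σ) hk (u := fun s => ε s * b s)
      (c₁ := e₁ * b₁) (c₂ := e₂ * b₂)
      (by filter_upwards [hc₁.b_eq] with s hs hs'; rw [hs hs', hε₁ s hs'])
      (by filter_upwards [hc₂.b_eq] with s hs hs'; rw [hs hs', hε₂ s hs']) (by simp)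
    have hf := H.flux h (hh.mono hsub)
    rw [hS h hh] at hf
    have : ∀ s : ℝ, ε s * (deriv h s * a s + (s * deriv h s + (m + 1) * h s) *
        ((s : ℂ) ^ m * b s)) = deriv h s * (ε s * a s) +
          deriv (fun s : ℝ => h s * (s : ℂ) ^ (m + 1)) s * (ε s * b s) := fun s => by
      rw [hkd]; ring
    simp only [this] at hf
    rw [integral_add i1 i2, e1, e2, hhσ] at hf
    linear_combination hf

/-- The constant `ca` is the amplitude of the solution singular at the origin, which the limit of
`v` at `0` excludes. -/
lemma core_a_eq_zero (H : RadialSystem m ε S a b v) {σ : ℝ} (hσ : 0 < σ) {ca cb : ℂ}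
    (hc : ConstOn m a b v (Ioo 0 σ) ca cb) : ca = 0 := by
  have h1 : Tendsto (fun s => (m + 1 : ℂ) * v s) (𝓝[>] 0) (𝓝 ((m + 1) * 0)) :=
    H.v_zero.const_mul _
  have h2 : Tendsto (fun s => (m + 1 : ℂ) * v s) (𝓝[>] 0) (𝓝 (((0 : ℝ) : ℂ) ^ (m + 1) * cb - ca)) := by
    have hp : Continuous fun s : ℝ => (s : ℂ) ^ (m + 1) * cb - ca := by fun_prop
    refine ((hp.tendsto 0).mono_left nhdsWithin_le_nhds).congr' ?_
    filter_upwards [Ioo_mem_nhdsGT hσ] with s hs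
    exact (hc.v_eq s hs).symm
  have := tendsto_nhds_unique h1 h2
  simpa using this

/-- The constant `cb` is the amplitude of the growing solution, which the condition at infinity
excludes. -/
lemma infty_b_eq_zero (H : RadialSystem m ε S a b v) {σ : ℝ} {ca cb : ℂ}
    (hc : ConstOn m a b v (Ioi σ) ca cb) : cb = 0 := by
  have h1 : Tendsto (fun s : ℝ => (m + 1 : ℂ) * (v s / (s : ℂ) ^ (m + 1))) atTop
      (𝓝 ((m + 1) * 0)) := H.v_infty.const_mul _
  have hinv : Tendsto (fun s : ℝ => ((s : ℂ) ^ (m + 1))⁻¹) atTop (𝓝 0) := by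
    have := (tendsto_pow_atTop (α := ℝ) (Nat.succ_ne_zero m)).inv_tendsto_atTop
    have := (Complex.continuous_ofReal.tendsto 0).comp this
    simpa [Function.comp_def] using this
  have h2 : Tendsto (fun s : ℝ => (m + 1 : ℂ) * (v s / (s : ℂ) ^ (m + 1))) atTop
      (𝓝 (cb - ca * 0)) := by
    refine (tendsto_const_nhds.sub (hinv.const_mul ca)).congr' ?_
    filter_upwards [Ioi_mem_atTop σ, Ioi_mem_atTop (0 : ℝ)] with s hs hs0
    have hs0' : (s : ℂ) ≠ 0 := by exact_mod_cast (ne_of_gt hs0)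
    rw [← mul_div_assoc, hc.v_eq s hs]
    field_simp
  have := tendsto_nhds_unique h1 h2
  simpa using this.symm

end RadialSystem

/-! ### Three concentric layers -/

namespace RadialSystem

variable {m : ℕ} {ε ε' : ℝ → ℂ} {S : (ℝ → ℂ) → ℂ} {a b v a' b' v' : ℝ → ℂ}

/-- Beyond the source `b` vanishes, so its value below the source equals the jump across it. A
cutoff equal to `1` on `[R, T]` measures that jump through `S` alone. -/
lemma exterior_b_eq (H : RadialSystem m ε S a b v) {σ R T : ℝ} (hσ : 0 < σ) (hR : σ < R)
    (hT : R < T) (hε : ∀ s ∈ Ioi σ, ε s = 1) (hS : ∀ h, IsBumpOn (Ioi T) h → S h = 0)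
    {β : ℂ} (hβ : ∀ g, IsBumpOn (Ioi σ) g → (∀ s ∈ Icc R T, g s = 1) →
      S (fun s => g s * ((s : ℂ) ^ (m + 1))⁻¹) = 2 * β) {ae be : ℂ}
    (hc : ConstOn m a b v (Ioo σ R) ae be) : be = β := by
  have hσT : σ < T := hR.trans hT
  obtain ⟨a₀, b₀, hc₀⟩ := H.exists_constOn (J := Ioi T) (Ioi_subset_Ioi (hσ.trans hσT).le) isOpen_Ioi
    ordConnected_Ioi nonempty_Ioi one_ne_zero (fun s hs => hε s (hσT.trans hs)) hS
  have hb₀ := H.infty_b_eq_zero hc₀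
  obtain ⟨g, hg, hg1⟩ := exists_cutoff hR (lt_add_one T)
  have hg' : IsBumpOn (Ioi σ) g := hg.mono Ioo_subset_Ioi_self
  have h1 := H.two_mul_integral_deriv_mul_b (Ioi_subset_Ioi hσ.le) isOpen_Ioi hε hg'
  obtain ⟨-, h2⟩ := integral_deriv_mul_piecewise hT.le hg (u := b) (c₁ := be) (c₂ := b₀) hc.b_eq
    (by filter_upwards [hc₀.b_eq] with s hs hs'; exact hs hs'.1) (fun s hs => by
      have : g =ᶠ[𝓝 s] fun _ => 1 := by
        filter_upwards [Ioo_mem_nhds hs.1 hs.2] with x hx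
        exact hg1 x ⟨hx.1.le, hx.2.le⟩
      rw [this.deriv_eq, deriv_const])
  rw [hβ g hg' hg1, h2, hg1 R ⟨le_rfl, hT.le⟩, hg1 T ⟨hT.le, le_rfl⟩, hb₀] at h1
  linear_combination h1 / 2

/-- Two conditions at each of the two interfaces. Eliminating the core amplitude at `σ₁` gives the
first relation, eliminating `ae` at `σ₂` the second. -/
lemma three_layers (H : RadialSystem m ε S a b v) {σ₁ σ₂ R T : ℝ} (hσ₁ : 0 < σ₁) (hσ : σ₁ < σ₂)
    (hR : σ₂ < R) (hT : R < T) {ec es : ℂ} (hec : ec ≠ 0) (hes : es ≠ 0)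
    (hεc : ∀ s ∈ Ioo 0 σ₁, ε s = ec) (hεs : ∀ s ∈ Ioo σ₁ σ₂, ε s = es)
    (hεe : ∀ s ∈ Ioi σ₂, ε s = 1) (hS : ∀ h, IsBumpOn (Ioo 0 R) h → S h = 0)
    (hS' : ∀ h, IsBumpOn (Ioi T) h → S h = 0)
    {β : ℂ} (hβ : ∀ g, IsBumpOn (Ioi σ₂) g → (∀ s ∈ Icc R T, g s = 1) →
      S (fun s => g s * ((s : ℂ) ^ (m + 1))⁻¹) = 2 * β) :
    ∃ as bs ae, ConstOn m a b v (Ioo σ₁ σ₂) as bs ∧ ConstOn m a b v (Ioo σ₂ R) ae β ∧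
      (es + ec) * as = -((es - ec) * (σ₁ : ℂ) ^ (m + 1) * bs) ∧
      2 * (σ₂ : ℂ) ^ (m + 1) * β = (1 + es) * (σ₂ : ℂ) ^ (m + 1) * bs + (es - 1) * as ∧
      ae = (σ₂ : ℂ) ^ (m + 1) * β - (σ₂ : ℂ) ^ (m + 1) * bs + as := by
  have hσ₂ : 0 < σ₂ := hσ₁.trans hσ
  obtain ⟨ac, bc, hcc⟩ := H.exists_constOn (J := Ioo 0 σ₁) Ioo_subset_Ioi_self isOpen_Ioo
    ordConnected_Ioo (nonempty_Ioo.2 hσ₁) hec hεc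
    fun h hh => hS h (hh.mono (Ioo_subset_Ioo_right (hσ.trans hR).le))
  obtain ⟨as, bs, hcs⟩ := H.exists_constOn (J := Ioo σ₁ σ₂)
    (Ioo_subset_Ioi_self.trans (Ioi_subset_Ioi hσ₁.le)) isOpen_Ioo
    ordConnected_Ioo (nonempty_Ioo.2 hσ) hes hεs
    fun h hh => hS h (hh.mono (Ioo_subset_Ioo hσ₁.le hR.le))
  obtain ⟨ae, be, hce⟩ := H.exists_constOn (J := Ioo σ₂ R)
    (Ioo_subset_Ioi_self.trans (Ioi_subset_Ioi hσ₂.le)) isOpen_Ioo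
    ordConnected_Ioo (nonempty_Ioo.2 hR) one_ne_zero (fun s hs => hεe s hs.1)
    fun h hh => hS h (hh.mono (Ioo_subset_Ioo_left hσ₂.le))
  obtain rfl : be = β := H.exterior_b_eq hσ₂ hR hT hεe hS' hβ hce
  obtain rfl : ac = 0 := H.core_a_eq_zero hσ₁ hcc
  obtain ⟨h1, h2⟩ := H.interface le_rfl hσ₁ hσ hεc hεs hcc hcs
    fun h hh => hS h (hh.mono (Ioo_subset_Ioo_right hR.le))
  obtain ⟨h3, h4⟩ := H.interface hσ₁.le hσ hR hεs (fun s hs => hεe s hs.1) hcs hce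
    fun h hh => hS h (hh.mono (Ioo_subset_Ioo_left hσ₁.le))
  refine ⟨as, bs, ae, hcs, hce, ?_, ?_, ?_⟩
  · linear_combination ec * h1 - h2
  · linear_combination -h3 - h4
  · linear_combination h3

/-- The difference of two solutions with the same source is source-free in the whole exterior, even
on the support of the source. The two `b` agree near the interface, hence everywhere outside, and
only the decaying solution remains. -/
lemma exterior_sub (H : RadialSystem m ε S a b v) (H' : RadialSystem m ε' S a' b' v')
    {σ R : ℝ} (hσ : 0 < σ) (hR : σ < R)
    (hε : ∀ s ∈ Ioi σ, ε s = 1) (hε' : ∀ s ∈ Ioi σ, ε' s = 1) {ae ae' be : ℂ}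
    (hc : ConstOn m a b v (Ioo σ R) ae be) (hc' : ConstOn m a' b' v' (Ioo σ R) ae' be) :
    ∀ s ∈ Ioi σ, (m + 1) * (v s - v' s) = -(ae - ae') := by
  have hJ : Ioi σ ⊆ Ioi 0 := Ioi_subset_Ioi hσ.le
  -- A constant difference on the exterior is identified at one generic point of `(σ, R)`, a set of
  -- positive measure.
  have hfin : ∀ {c c' : ℂ} {u u' : ℝ → ℂ} {d : ℂ}, (∀ᵐ s, s ∈ Ioo σ R → u s = c) →
      (∀ᵐ s, s ∈ Ioo σ R → u' s = c') → (∀ᵐ s, s ∈ Ioi σ → u s - u' s = d) → d = c - c' := by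
    intro c c' u u' d h1 h2 h3
    have : ∃ s, s ∈ Ioo σ R ∧ u s = c ∧ u' s = c' ∧ u s - u' s = d := by
      have hpos : volume (Ioo σ R) ≠ 0 := by simp [hR]
      have hfr : ∃ᵐ s, s ∈ Ioo σ R := frequently_ae_mem_iff.2 hpos
      obtain ⟨s, hs, h1, h2, h3⟩ := (hfr.and_eventually (h1.and (h2.and h3))).exists
      exact ⟨s, hs, h1 hs, h2 hs, h3 hs.1⟩
    obtain ⟨s, -, h1, h2, h3⟩ := this
    rw [← h3, h1, h2]
  obtain ⟨da, hda⟩ := ae_eq_const_of_integral_deriv_mul_eq_zero (u := fun s => a s - a' s)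
    isOpen_Ioi ordConnected_Ioi nonempty_Ioi ((H.a_int.sub H'.a_int).mono_set hJ) fun g h1 h2 h3 => by
      have hg : IsBumpOn (Ioi σ) g := ⟨h1, h2, h3⟩
      have e := H.two_mul_integral_deriv_mul_a hJ hε hg
      have e' := H'.two_mul_integral_deriv_mul_a hJ hε' hg
      simp only [mul_sub]
      rw [integral_sub ((hg.mono hJ).deriv.integrable_mul H.a_int)
        ((hg.mono hJ).deriv.integrable_mul H'.a_int)]
      linear_combination (e - e') / 2
  obtain ⟨db, hdb⟩ := ae_eq_const_of_integral_deriv_mul_eq_zero (u := fun s => b s - b' s)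
    isOpen_Ioi ordConnected_Ioi nonempty_Ioi ((H.b_int.sub H'.b_int).mono_set hJ) fun g h1 h2 h3 => by
      have hg : IsBumpOn (Ioi σ) g := ⟨h1, h2, h3⟩
      have e := H.two_mul_integral_deriv_mul_b hJ isOpen_Ioi hε hg
      have e' := H'.two_mul_integral_deriv_mul_b hJ isOpen_Ioi hε' hg
      simp only [mul_sub]
      rw [integral_sub ((hg.mono hJ).deriv.integrable_mul H.b_int)
        ((hg.mono hJ).deriv.integrable_mul H'.b_int)]
      linear_combination (e - e') / 2
  have hda' := hfin hc.a_eq hc'.a_eq hda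
  have hdb' := hfin hc.b_eq hc'.b_eq hdb
  refine eqOn_of_ae_eq (u := fun s => (m + 1) * (v s - v' s)) (w := fun _ => -(ae - ae'))
    isOpen_Ioi ?_ continuousOn_const ?_
  · exact continuousOn_const.mul ((H.v_cont.mono hJ).sub (H'.v_cont.mono hJ))
  · filter_upwards [hda, hdb, H.algebraic, H'.algebraic] with s h1 h2 h3 h4 hs
    have e1 := h1 hs
    have e2 := h2 hs
    rw [h3 (hJ hs), h4 (hJ hs), hda'] at e1
    rw [hdb'] at e2
    linear_combination (s : ℂ) ^ (m + 1) * e2 - e1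

end RadialSystem

/-! ### Radial test functions -/

lemma IsBumpOn.exists_vanish {U : Set ℝ} {h : ℝ → ℂ} (hh : IsBumpOn U h) :
    ∃ T : ℝ, 0 < T ∧ ∀ s, T ≤ s → h s = 0 := by
  obtain ⟨r, hr⟩ := hh.compact.isCompact.isBounded.subset_closedBall 0
  refine ⟨max r 0 + 1, by positivity, fun s hs => image_eq_zero_of_notMem_tsupport fun h' => ?_⟩
  have := hr h'
  rw [Metric.mem_closedBall, Real.dist_eq, sub_zero] at this
  linarith [le_abs_self s, le_max_left r 0]

lemma contDiff_normSq : ContDiff ℝ ∞ fun z : ℂ => Complex.normSq z := by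
  have : (fun z : ℂ => Complex.normSq z) = fun z => ‖z‖ ^ 2 := by
    ext z; exact Complex.normSq_eq_norm_sq z
  rw [this]
  exact contDiff_norm_sq ℝ

lemma IsBumpOn.isTestFunction {U : Set ℝ} {h : ℝ → ℂ} (hh : IsBumpOn U h) (l : ℕ) :
    IsTestFunction fun z => h (Complex.normSq z) * z ^ l := by
  refine ⟨(hh.smooth.comp contDiff_normSq).mul (contDiff_id.pow l), ?_⟩
  obtain ⟨T, hT, hT'⟩ := hh.exists_vanish
  refine HasCompactSupport.intro (isCompact_closedBall (0 : ℂ) (√T)) fun z hz => ?_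
  rw [hT', zero_mul]
  rw [Metric.mem_closedBall, dist_zero_right, not_le] at hz
  rw [Complex.normSq_eq_norm_sq]
  exact (Real.sqrt_le_left (norm_nonneg z)).1 hz.le

lemma IsBumpOn.fderiv_radial {U : Set ℝ} {h : ℝ → ℂ} (hh : IsBumpOn U h) (l : ℕ) (z w : ℂ) :
    fderiv ℝ (fun z => h (Complex.normSq z) * z ^ l) z w =
      deriv h (Complex.normSq z) * ((2 * (z.re * w.re + z.im * w.im) : ℝ) : ℂ) * z ^ l +
        h (Complex.normSq z) * (l * z ^ (l - 1) * w) := by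
  have hd : DifferentiableAt ℝ (fun z => h (Complex.normSq z) * z ^ l) z :=
    ((hh.isTestFunction l).smooth.differentiable (by simp)) z
  -- The derivative is computed along the real line through `z` in the direction `w`.
  have hline : HasDerivAt (fun t : ℝ => z + t * w) w 0 := by
    have := ((Complex.ofRealCLM.hasDerivAt (x := (0 : ℝ))).mul_const w).const_add z
    simpa using this
  have h1 : HasDerivAt (fun t : ℝ => h (Complex.normSq (z + t * w)) * (z + t * w) ^ l)
      (fderiv ℝ (fun z => h (Complex.normSq z) * z ^ l) z w) 0 := by
    have hd' : HasFDerivAt (fun z => h (Complex.normSq z) * z ^ l)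
        (fderiv ℝ (fun z => h (Complex.normSq z) * z ^ l) z) (z + ((0 : ℝ) : ℂ) * w) := by
      simpa using hd.hasFDerivAt
    exact hd'.comp_hasDerivAt (0 : ℝ) hline
  have hn : HasDerivAt (fun t : ℝ => Complex.normSq (z + t * w))
      (2 * (z.re * w.re + z.im * w.im)) 0 := by
    have e : (fun t : ℝ => Complex.normSq (z + t * w)) =
        fun t : ℝ => (z.re + t * w.re) * (z.re + t * w.re) +
          (z.im + t * w.im) * (z.im + t * w.im) := by
      ext t
      simp [Complex.normSq_apply]
    rw [e]
    have a1 : HasDerivAt (fun t : ℝ => z.re + t * w.re) w.re 0 := by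
      simpa using ((hasDerivAt_id (0 : ℝ)).mul_const w.re).const_add z.re
    have a2 : HasDerivAt (fun t : ℝ => z.im + t * w.im) w.im 0 := by
      simpa using ((hasDerivAt_id (0 : ℝ)).mul_const w.im).const_add z.im
    refine ((a1.mul a1).add (a2.mul a2)).congr_deriv ?_
    simp only [zero_mul, add_zero]
    ring
  have h2 : HasDerivAt (fun t : ℝ => h (Complex.normSq (z + t * w)))
      ((2 * (z.re * w.re + z.im * w.im)) • deriv h (Complex.normSq z)) 0 := by
    have hd' : HasDerivAt h (deriv h (Complex.normSq z)) (Complex.normSq (z + ((0 : ℝ) : ℂ) * w)) := by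
      simpa using (hh.differentiable (Complex.normSq z)).hasDerivAt
    exact hd'.scomp (0 : ℝ) hn
  have h3 := h2.mul (hline.pow l)
  rw [h1.unique h3]
  simp only [Complex.ofReal_zero, zero_mul, add_zero, Complex.real_smul, Pi.pow_apply]
  ring

lemma integrable_mul_radial {G : ℂ → ℂ} (hG : LocallyIntegrable G) {k : ℝ → ℂ} (hk : Measurable k)
    {C T : ℝ} (hC : ∀ s, ‖k s‖ ≤ C) (hT : ∀ s, T ≤ s → k s = 0) (l : ℕ) :
    Integrable fun z => G z * (k (Complex.normSq z) * z ^ l) := by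
  have h1 : IntegrableOn G (Metric.closedBall (0 : ℂ) √T) :=
    hG.integrableOn_isCompact (isCompact_closedBall _ _)
  have h2 : IntegrableOn (fun z => z ^ l * G z) (Metric.closedBall (0 : ℂ) √T) :=
    h1.continuousOn_mul (by fun_prop) (isCompact_closedBall _ _)
  have h3 : IntegrableOn (fun z => k (Complex.normSq z) * (z ^ l * G z))
      (Metric.closedBall (0 : ℂ) √T) := by
    refine Integrable.bdd_mul (c := C) h2 ?_ (ae_of_all _ fun z => hC _)
    exact (hk.comp Complex.continuous_normSq.measurable).aestronglyMeasurable
  have h4 : Integrable fun z => k (Complex.normSq z) * (z ^ l * G z) := by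
    refine (integrableOn_iff_integrable_of_support_subset fun z hz => ?_).1 h3
    by_contra hn
    rw [Metric.mem_closedBall, dist_zero_right, not_le] at hn
    refine left_ne_zero_of_mul hz (hT _ ?_)
    rw [Complex.normSq_eq_norm_sq]
    exact (Real.sqrt_le_left (norm_nonneg z)).1 hn.le
  refine h4.congr (ae_of_all _ fun z => ?_)
  simp only
  ring

lemma IsBumpOn.integrable_mul_radial {G : ℂ → ℂ} (hG : LocallyIntegrable G) {U : Set ℝ}
    {h : ℝ → ℂ} (hh : IsBumpOn U h) (l : ℕ) :
    Integrable fun z => G z * (h (Complex.normSq z) * z ^ l) := by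
  obtain ⟨T, -, hT⟩ := hh.exists_vanish
  obtain ⟨C, hC⟩ := hh.compact.exists_bound_of_continuous hh.continuous
  exact CALR.integrable_mul_radial hG hh.continuous.measurable hC hT l

/-! ### From weak solutions to radial systems -/

/-- The Wirtinger derivative `∂u/∂z` of a function with gradient `(p, q)`. -/
noncomputable def gradZ (p q : ℂ → ℂ) (z : ℂ) : ℂ := (p z - Complex.I * q z) / 2

/-- The Wirtinger derivative `∂u/∂z̄` of a function with gradient `(p, q)`. -/
noncomputable def gradZbar (p q : ℂ → ℂ) (z : ℂ) : ℂ := (p z + Complex.I * q z) / 2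

lemma locallyIntegrable_of_memLp_two {p : ℂ → ℂ}
    (hp : ∀ K : Set ℂ, IsCompact K → MemLp p 2 (volume.restrict K)) : LocallyIntegrable p := by
  rw [locallyIntegrable_iff]
  intro K hK
  have : IsFiniteMeasure (volume.restrict K) := ⟨by simpa using hK.measure_lt_top⟩
  exact (hp K hK).integrable (by norm_num)

namespace HasWeakGradient

variable {V p q : ℂ → ℂ}

lemma locallyIntegrable_fst (hg : HasWeakGradient V p q) : LocallyIntegrable p :=
  locallyIntegrable_of_memLp_two hg.memLp_fst

lemma locallyIntegrable_snd (hg : HasWeakGradient V p q) : LocallyIntegrable q :=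
  locallyIntegrable_of_memLp_two hg.memLp_snd

lemma memLp_gradZ (hg : HasWeakGradient V p q) {K : Set ℂ} (hK : IsCompact K) :
    MemLp (gradZ p q) 2 (volume.restrict K) := by
  have h := ((hg.memLp_fst K hK).sub ((hg.memLp_snd K hK).const_mul Complex.I)).const_mul (1 / 2)
  convert h using 1
  ext z
  simp only [gradZ, Pi.sub_apply]
  ring

lemma memLp_gradZbar (hg : HasWeakGradient V p q) {K : Set ℂ} (hK : IsCompact K) :
    MemLp (gradZbar p q) 2 (volume.restrict K) := by
  have h := ((hg.memLp_fst K hK).add ((hg.memLp_snd K hK).const_mul Complex.I)).const_mul (1 / 2)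
  convert h using 1
  ext z
  simp only [gradZbar, Pi.add_apply]
  ring

lemma locallyIntegrable_gradZ (hg : HasWeakGradient V p q) : LocallyIntegrable (gradZ p q) :=
  locallyIntegrable_of_memLp_two fun _ hK => hg.memLp_gradZ hK

lemma locallyIntegrable_gradZbar (hg : HasWeakGradient V p q) :
    LocallyIntegrable (gradZbar p q) :=
  locallyIntegrable_of_memLp_two fun _ hK => hg.memLp_gradZbar hK

lemma integrable_mul_fderiv {G φ : ℂ → ℂ} (hG : LocallyIntegrable G) (hφ : IsTestFunction φ)
    (w : ℂ) : Integrable fun z => G z * fderiv ℝ φ z w := by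
  have h := hG.integrable_smul_left_of_hasCompactSupport (g := fun z => fderiv ℝ φ z w)
    ((hφ.smooth.continuous_fderiv (by simp)).clm_apply continuous_const)
    (hφ.compact.fderiv_apply (𝕜 := ℝ) w)
  exact h.congr (ae_of_all _ fun z => by simp [mul_comm])

/-- Integration by parts with `∂/∂z̄ (h(|z|²) z^l) = h'(|z|²) z^(l+1)`, the factor `z^l` being
holomorphic. -/
lemma integral_gradZbar (hg : HasWeakGradient V p q) {U : Set ℝ} {h : ℝ → ℂ}
    (hh : IsBumpOn U h) (l : ℕ) :
    ∫ z, gradZbar p q z * (h (Complex.normSq z) * z ^ l) =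
      -∫ z, V z * (deriv h (Complex.normSq z) * z ^ (l + 1)) := by
  have hφ := hh.isTestFunction l
  have e1 := hg.weak_fst _ hφ
  have e2 := hg.weak_snd _ hφ
  have i1 := hh.integrable_mul_radial hg.locallyIntegrable_fst l
  have i2 := hh.integrable_mul_radial hg.locallyIntegrable_snd l
  have j1 := integrable_mul_fderiv hg.locInt hφ 1
  have j2 := integrable_mul_fderiv hg.locInt hφ Complex.I
  have l1 : ∫ z, gradZbar p q z * (h (Complex.normSq z) * z ^ l) =
      ((∫ z, p z * (h (Complex.normSq z) * z ^ l)) +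
        Complex.I * ∫ z, q z * (h (Complex.normSq z) * z ^ l)) / 2 := by
    rw [← integral_const_mul, ← integral_add i1 (i2.const_mul _), ← integral_div]
    congr 1
    ext z
    simp only [gradZbar]
    ring
  have l2 : ∫ z, V z * (deriv h (Complex.normSq z) * z ^ (l + 1)) =
      ((∫ z, V z * fderiv ℝ (fun z => h (Complex.normSq z) * z ^ l) z 1) + Complex.I *
        ∫ z, V z * fderiv ℝ (fun z => h (Complex.normSq z) * z ^ l) z Complex.I) / 2 := by
    rw [← integral_const_mul, ← integral_add j1 (j2.const_mul _), ← integral_div]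
    congr 1
    ext z
    rw [hh.fderiv_radial, hh.fderiv_radial]
    simp only [Complex.one_re, Complex.one_im, Complex.I_re, Complex.I_im]
    push_cast
    have hz := Complex.re_add_im z
    have hI := Complex.I_mul_I
    linear_combination (-V z * deriv h (Complex.normSq z) * z ^ l) * hz -
      (V z * h (Complex.normSq z) * l * z ^ (l - 1) / 2) * hI
  rw [l1, l2, e1, e2]
  ring

/-- Integration by parts against `∂/∂z`, which also differentiates the power: hence the Euler type
factor. The exponent is `n + 1` so that the derivative keeps a power `z^n`. -/
lemma integral_gradZ (hg : HasWeakGradient V p q) {U : Set ℝ} {h : ℝ → ℂ}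
    (hh : IsBumpOn U h) (n : ℕ) :
    ∫ z, gradZ p q z * (h (Complex.normSq z) * z ^ (n + 1)) =
      -∫ z, V z * ((Complex.normSq z * deriv h (Complex.normSq z) +
        (n + 1) * h (Complex.normSq z)) * z ^ n) := by
  have hφ := hh.isTestFunction (n + 1)
  have e1 := hg.weak_fst _ hφ
  have e2 := hg.weak_snd _ hφ
  have i1 := hh.integrable_mul_radial hg.locallyIntegrable_fst (n + 1)
  have i2 := hh.integrable_mul_radial hg.locallyIntegrable_snd (n + 1)
  have j1 := integrable_mul_fderiv hg.locInt hφ 1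
  have j2 := integrable_mul_fderiv hg.locInt hφ Complex.I
  have l1 : ∫ z, gradZ p q z * (h (Complex.normSq z) * z ^ (n + 1)) =
      ((∫ z, p z * (h (Complex.normSq z) * z ^ (n + 1))) -
        Complex.I * ∫ z, q z * (h (Complex.normSq z) * z ^ (n + 1))) / 2 := by
    rw [← integral_const_mul, ← integral_sub i1 (i2.const_mul _), ← integral_div]
    congr 1
    ext z
    simp only [gradZ]
    ring
  have l2 : ∫ z, V z * ((Complex.normSq z * deriv h (Complex.normSq z) +
        (n + 1) * h (Complex.normSq z)) * z ^ n) =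
      ((∫ z, V z * fderiv ℝ (fun z => h (Complex.normSq z) * z ^ (n + 1)) z 1) - Complex.I *
        ∫ z, V z * fderiv ℝ (fun z => h (Complex.normSq z) * z ^ (n + 1)) z Complex.I) / 2 := by
    rw [← integral_const_mul, ← integral_sub j1 (j2.const_mul _), ← integral_div]
    congr 1
    ext z
    rw [hh.fderiv_radial, hh.fderiv_radial]
    simp only [Complex.one_re, Complex.one_im, Complex.I_re, Complex.I_im, Nat.add_sub_cancel]
    have hz := Complex.re_add_im z
    have hI := Complex.I_mul_I
    have hn : ((Complex.normSq z : ℝ) : ℂ) = (z.re - z.im * Complex.I) * z := by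
      rw [Complex.normSq_apply]
      push_cast
      linear_combination (z.re - z.im * Complex.I) * hz + (z.im : ℂ) ^ 2 * hI
    have hpow : z ^ (n + 1) = z * z ^ n := pow_succ' z n
    generalize hN : Complex.normSq z = N at hn ⊢
    rw [hn, hpow]
    push_cast
    linear_combination (V z * h N * (n + 1) * z ^ n / 2) * hI
  rw [l1, l2, e1, e2]
  ring

end HasWeakGradient

/-- The permittivity as a function of the squared radius. -/
noncomputable def radialPermittivity (ri re εc εs δ : ℝ) (s : ℝ) : ℂ :=
  if s < ri ^ 2 then (εc : ℂ) else if s < re ^ 2 then (εs : ℂ) + Complex.I * (δ : ℂ) else 1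

lemma permittivity_eq {ri re : ℝ} (hri : 0 < ri) (hre : ri < re) (εc εs δ : ℝ) (z : ℂ) :
    permittivity ri re εc εs δ z = radialPermittivity ri re εc εs δ (Complex.normSq z) := by
  have h1 : ‖z‖ < ri ↔ Complex.normSq z < ri ^ 2 := by
    rw [Complex.normSq_eq_norm_sq, pow_lt_pow_iff_left₀ (norm_nonneg z) hri.le two_ne_zero]
  have h2 : ‖z‖ < re ↔ Complex.normSq z < re ^ 2 := by
    rw [Complex.normSq_eq_norm_sq, pow_lt_pow_iff_left₀ (norm_nonneg z) (hri.trans hre).le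
      two_ne_zero]
  simp only [permittivity, radialPermittivity, h1, h2]

lemma measurable_radialPermittivity (ri re εc εs δ : ℝ) :
    Measurable (radialPermittivity ri re εc εs δ) := by
  unfold radialPermittivity
  exact Measurable.ite measurableSet_Iio measurable_const
    (Measurable.ite measurableSet_Iio measurable_const measurable_const)

lemma norm_radialPermittivity_le (ri re εc εs δ s : ℝ) :
    ‖radialPermittivity ri re εc εs δ s‖ ≤ ‖(εc : ℂ)‖ + ‖(εs : ℂ) + Complex.I * (δ : ℂ)‖ + 1 := by
  have h1 := norm_nonneg (εc : ℂ)
  have h2 := norm_nonneg ((εs : ℂ) + Complex.I * (δ : ℂ))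
  unfold radialPermittivity
  split_ifs
  · linarith
  · linarith
  · rw [norm_one]; linarith

lemma integrable_mul_permittivity_radial {G : ℂ → ℂ} (hG : LocallyIntegrable G)
    (ri re εc εs δ : ℝ) {U : Set ℝ} {h : ℝ → ℂ} (hh : IsBumpOn U h) (l : ℕ) :
    Integrable fun z => G z * ((radialPermittivity ri re εc εs δ (Complex.normSq z) *
      h (Complex.normSq z)) * z ^ l) := by
  obtain ⟨T, -, hT⟩ := hh.exists_vanish
  obtain ⟨C, hC⟩ := hh.compact.exists_bound_of_continuous hh.continuous
  refine integrable_mul_radial hG (k := fun s => radialPermittivity ri re εc εs δ s * h s)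
    ((measurable_radialPermittivity ri re εc εs δ).mul hh.continuous.measurable)
    (C := (‖(εc : ℂ)‖ + ‖(εs : ℂ) + Complex.I * (δ : ℂ)‖ + 1) * C) (fun s => ?_)
    (fun s hs => by rw [hT s hs, mul_zero]) l
  rw [norm_mul]
  exact mul_le_mul (norm_radialPermittivity_le ..) (hC s) (norm_nonneg _) (by positivity)

lemma IsBumpOn.add {U : Set ℝ} {g h : ℝ → ℂ} (hg : IsBumpOn U g) (hh : IsBumpOn U h) :
    IsBumpOn U fun s => g s + h s := by
  have hsub : tsupport (fun s => g s + h s) ⊆ tsupport g ∪ tsupport h := by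
    refine closure_minimal ?_ ((isClosed_tsupport _).union (isClosed_tsupport _))
    intro s hs
    by_contra hn
    rw [mem_union, not_or] at hn
    exact hs (by simp [image_eq_zero_of_notMem_tsupport hn.1,
      image_eq_zero_of_notMem_tsupport hn.2])
  exact ⟨hg.smooth.add hh.smooth, (hg.compact.isCompact.union hh.compact).of_isClosed_subset
    (isClosed_tsupport _) hsub, hsub.trans (union_subset hg.supp hh.supp)⟩

lemma IsBumpOn.id_mul {U : Set ℝ} {h : ℝ → ℂ} (hU : IsOpen U) (hh : IsBumpOn U h) :
    IsBumpOn U fun s => (s : ℂ) * h s := by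
  have := hh.mul_contDiffOn hU (Complex.ofRealCLM.contDiff.contDiffOn)
  simpa [mul_comm] using this

lemma IsBumpOn.const_mul {U : Set ℝ} {h : ℝ → ℂ} (hU : IsOpen U) (hh : IsBumpOn U h) (c : ℂ) :
    IsBumpOn U fun s => c * h s := by
  have := hh.mul_contDiffOn hU (contDiffOn_const (c := c))
  simpa [mul_comm] using this

lemma IsBumpOn.euler {U : Set ℝ} {h : ℝ → ℂ} (hU : IsOpen U) (hh : IsBumpOn U h) (c : ℂ) :
    IsBumpOn U fun s => (s : ℂ) * deriv h s + c * h s :=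
  (hh.deriv.id_mul hU).add (hh.const_mul hU c)

namespace IsSolution

variable {ri re εc εs δ : ℝ} {f V p q : ℂ → ℂ}

/-- The weak equation tested with `φ = h(|z|²) z^(m+1)`, using `∇V·∇φ = 2(V_z φ_z̄ + V_z̄ φ_z)`. -/
lemma integral_flux (hri : 0 < ri) (hre : ri < re) (hs : IsSolution ri re εc εs δ f V p q)
    {U : Set ℝ} (hU : IsOpen U) {h : ℝ → ℂ} (hh : IsBumpOn U h) (m : ℕ) :
    2 * ((∫ z, gradZ p q z * ((radialPermittivity ri re εc εs δ (Complex.normSq z) *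
        deriv h (Complex.normSq z)) * z ^ (m + 2))) +
      ∫ z, gradZbar p q z * ((radialPermittivity ri re εc εs δ (Complex.normSq z) *
        (Complex.normSq z * deriv h (Complex.normSq z) + (m + 1) * h (Complex.normSq z))) *
          z ^ m)) =
      -∫ z, f z * (h (Complex.normSq z) * z ^ (m + 1)) := by
  have i1 := integrable_mul_permittivity_radial hs.grad.locallyIntegrable_gradZ ri re εc εs δ
    hh.deriv (m + 2)
  have i2 := integrable_mul_permittivity_radial hs.grad.locallyIntegrable_gradZbar ri re εc εs δ
    (hh.euler hU (m + 1)) m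
  rw [← hs.weak_eq _ (hh.isTestFunction (m + 1)), ← integral_add i1 i2, ← integral_const_mul]
  congr 1
  ext z
  rw [permittivity_eq hri hre, hh.fderiv_radial, hh.fderiv_radial]
  simp only [Complex.one_re, Complex.one_im, Complex.I_re, Complex.I_im, Nat.add_sub_cancel,
    gradZ, gradZbar]
  have hz := Complex.re_add_im z
  have hI := Complex.I_mul_I
  have hn : ((Complex.normSq z : ℝ) : ℂ) = (z.re - z.im * Complex.I) * z := by
    rw [Complex.normSq_apply]
    push_cast
    linear_combination (z.re - z.im * Complex.I) * hz + (z.im : ℂ) ^ 2 * hI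
  generalize hN : Complex.normSq z = N at hn ⊢
  generalize hE : radialPermittivity ri re εc εs δ N = E
  have hpow : z ^ (m + 1) = z * z ^ m := pow_succ' z m
  have hpow2 : z ^ (m + 2) = z * (z * z ^ m) := by ring
  rw [hn, hpow, hpow2]
  push_cast
  linear_combination (-E * z * z ^ m * deriv h N * (p z - Complex.I * q z)) * hz +
    (-E * z * z ^ m * deriv h N * q z * z.im * 2) * hI

end IsSolution

lemma continuous_mode {V : ℂ → ℂ} (hV : Continuous V) (k : ℤ) : Continuous (mode V k) := by
  have h : Continuous (Function.uncurry fun (s : ℝ) (t : AddCircle (2 * π)) =>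
      fourier (-k) t * V (polarMap (s, t))) :=
    ((fourier (-k)).continuous.comp continuous_snd).mul (hV.comp continuous_polarMap)
  have := continuous_parametric_integral_of_continuous (μ := haarAddCircle) h isCompact_univ
  rw [Measure.restrict_univ] at this
  exact this

lemma norm_mode_le {V : ℂ → ℂ} {C : ℝ} (k : ℤ) (s : ℝ) (hC : ∀ t, ‖V (polarMap (s, t))‖ ≤ C) :
    ‖mode V k s‖ ≤ C := by
  rw [mode_eq]
  refine (norm_integral_le_of_norm_le_const (C := C) (ae_of_all _ fun t => ?_)).trans (by simp)
  rw [norm_mul, fourier_apply, Circle.norm_coe, one_mul]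
  exact hC t

lemma exists_bound_of_tendsto_cocompact {V : ℂ → ℂ} (hV : Continuous V)
    (h0 : Tendsto V (cocompact ℂ) (𝓝 0)) : ∃ C, ∀ z, ‖V z‖ ≤ C := by
  let W : ZeroAtInftyContinuousMap ℂ ℂ := ⟨⟨V, hV⟩, h0⟩
  obtain ⟨C, hC⟩ := (isBounded_iff_forall_norm_le).1 (ZeroAtInftyContinuousMap.isBounded_range W)
  exact ⟨C, fun z => hC _ ⟨z, rfl⟩⟩

lemma locallyIntegrableOn_mode {G : ℂ → ℂ} (hG : LocallyIntegrable G) (k : ℤ) :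
    LocallyIntegrableOn (mode G k) (Ioi 0) := by
  intro x hx
  have hmem : Ioo 0 (x + 1) ∈ 𝓝[Ioi 0] x :=
    mem_nhdsWithin_of_mem_nhds (Ioo_mem_nhds hx (lt_add_one x))
  refine ⟨Ioo 0 (x + 1), hmem, integrableOn_mode measurableSet_Ioo Ioo_subset_Ioi_self ?_ k⟩
  · refine (hG.integrableOn_isCompact (isCompact_closedBall (0 : ℂ) √(x + 1))).mono_set ?_
    intro z hz
    rw [mem_ofPred_eq] at hz
    rw [Metric.mem_closedBall, dist_zero_right]
    refine Real.le_sqrt_of_sq_le ?_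
    rw [← Complex.normSq_eq_norm_sq]
    exact hz.2.le

lemma IsBumpOn.setIntegral_Ioi {h : ℝ → ℂ} (hh : IsBumpOn (Ioi 0) h) (u : ℝ → ℂ) :
    ∫ s in Ioi (0 : ℝ), h s * u s = ∫ s, h s * u s :=
  setIntegral_eq_integral_of_forall_compl_eq_zero fun s hs => by rw [hh.eq_zero hs, zero_mul]

lemma IsBumpOn.integral_mul_radial {G : ℂ → ℂ} (hG : LocallyIntegrable G) {h : ℝ → ℂ}
    (hh : IsBumpOn (Ioi 0) h) (l : ℕ) :
    ∫ z, G z * (h (Complex.normSq z) * z ^ l) =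
      π * ∫ s, h s * (((√s : ℝ) : ℂ) ^ l * mode G (-l) s) := by
  rw [CALR.integral_mul_radial l (hh.integrable_mul_radial hG l), ← hh.setIntegral_Ioi]
  simp only [mul_assoc]

/-- The `a`-component of the radial system of a field `A = ∂V/∂z`. -/
noncomputable def modeA (A : ℂ → ℂ) (m : ℕ) (s : ℝ) : ℂ :=
  ((√s : ℝ) : ℂ) ^ (m + 2) * mode A (-((m + 2 : ℕ) : ℤ)) s

/-- The `b`-component of the radial system of a field `B = ∂V/∂z̄`. -/
noncomputable def modeB (B : ℂ → ℂ) (m : ℕ) (s : ℝ) : ℂ :=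
  (((√s : ℝ) : ℂ) ^ m)⁻¹ * mode B (-(m : ℤ)) s

/-- The `v`-component of the radial system of a potential `V`. -/
noncomputable def modeV (V : ℂ → ℂ) (m : ℕ) (s : ℝ) : ℂ :=
  ((√s : ℝ) : ℂ) ^ (m + 1) * mode V (-((m + 1 : ℕ) : ℤ)) s

/-- The source functional of the radial system. -/
noncomputable def sourceFunctional (f : ℂ → ℂ) (m : ℕ) (h : ℝ → ℂ) : ℂ :=
  -(1 / (2 * (π : ℂ))) * ∫ z, f z * (h (Complex.normSq z) * z ^ (m + 1))

lemma sqrt_ne_zero_complex {s : ℝ} (hs : 0 < s) : ((√s : ℝ) : ℂ) ≠ 0 := by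
  exact_mod_cast (Real.sqrt_pos.2 hs).ne'

lemma sqrt_sq_complex {s : ℝ} (hs : 0 < s) : ((√s : ℝ) : ℂ) ^ 2 = (s : ℂ) := by
  exact_mod_cast Real.sq_sqrt hs.le

lemma pow_mul_modeB {B : ℂ → ℂ} (m : ℕ) {s : ℝ} (hs : 0 < s) :
    (s : ℂ) ^ m * modeB B m s = ((√s : ℝ) : ℂ) ^ m * mode B (-(m : ℤ)) s := by
  have h := sqrt_ne_zero_complex hs
  rw [modeB, ← mul_assoc]
  congr 1
  rw [← sqrt_sq_complex hs, ← pow_mul, mul_comm 2, pow_mul, sq, mul_assoc,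
    mul_inv_cancel₀ (pow_ne_zero _ h), mul_one]

lemma continuous_sqrt_complex : Continuous fun s : ℝ => ((√s : ℝ) : ℂ) :=
  Complex.continuous_ofReal.comp Real.continuous_sqrt

lemma continuous_modeV {V : ℂ → ℂ} (hV : Continuous V) (m : ℕ) : Continuous (modeV V m) :=
  (continuous_sqrt_complex.pow _).mul (continuous_mode hV _)

namespace IsSolution

variable {ri re εc εs δ : ℝ} {f V p q : ℂ → ℂ}

lemma radial_potential (hs : IsSolution ri re εc εs δ f V p q) (m : ℕ) {h : ℝ → ℂ}
    (hh : IsBumpOn (Ioi 0) h) :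
    ∫ s, h s * ((s : ℂ) ^ m * modeB (gradZbar p q) m s) = -∫ s, deriv h s * modeV V m s := by
  have h1 := hs.grad.integral_gradZbar hh m
  rw [hh.integral_mul_radial hs.grad.locallyIntegrable_gradZbar,
    hh.deriv.integral_mul_radial hs.grad.locInt, ← mul_neg] at h1
  have h2 := mul_left_cancel₀ (by exact_mod_cast Real.pi_pos.ne') h1
  refine Eq.trans ?_ h2
  rw [← hh.setIntegral_Ioi, ← hh.setIntegral_Ioi]
  refine setIntegral_congr_fun measurableSet_Ioi fun s hs => ?_
  simp only [pow_mul_modeB m hs]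

lemma locallyIntegrableOn_modeA (hs : IsSolution ri re εc εs δ f V p q) (m : ℕ) :
    LocallyIntegrableOn (modeA (gradZ p q) m) (Ioi 0) :=
  (locallyIntegrableOn_mode hs.grad.locallyIntegrable_gradZ _).continuousOn_mul
    (continuous_sqrt_complex.pow _).continuousOn isOpen_Ioi.isLocallyClosed

lemma locallyIntegrableOn_modeB (hs : IsSolution ri re εc εs δ f V p q) (m : ℕ) :
    LocallyIntegrableOn (modeB (gradZbar p q) m) (Ioi 0) :=
  (locallyIntegrableOn_mode hs.grad.locallyIntegrable_gradZbar _).continuousOn_mul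
    ((continuous_sqrt_complex.pow _).continuousOn.inv₀ fun _ hx =>
      pow_ne_zero _ (sqrt_ne_zero_complex hx)) isOpen_Ioi.isLocallyClosed

/-- This is `z V_z - z̄ V_z̄ = -i ∂V/∂θ` at frequency `-(m+1)`. As the gradient is only weak, both
sides are tested against bumps, where everything reduces to integrals of `modeV`. -/
lemma radial_algebraic (hs : IsSolution ri re εc εs δ f V p q) (m : ℕ) :
    ∀ᵐ s : ℝ, s ∈ Ioi (0 : ℝ) → modeA (gradZ p q) m s =
      (s : ℂ) ^ (m + 1) * modeB (gradZbar p q) m s - (m + 1) * modeV V m s := by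
  have hb' : LocallyIntegrableOn (fun s : ℝ => (s : ℂ) ^ (m + 1) * modeB (gradZbar p q) m s)
      (Ioi 0) := (hs.locallyIntegrableOn_modeB m).continuousOn_mul (by fun_prop)
    isOpen_Ioi.isLocallyClosed
  have hv : LocallyIntegrableOn (modeV V m) (Ioi 0) :=
    (continuous_modeV hs.continuous m).continuousOn.locallyIntegrableOn measurableSet_Ioi
  have hv' : LocallyIntegrableOn (fun s => (m + 1 : ℂ) * modeV V m s) (Ioi 0) :=
    (continuous_const.mul (continuous_modeV hs.continuous m)).continuousOn.locallyIntegrableOn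
      measurableSet_Ioi
  have key := ae_eq_zero_of_integral_mul_eq_zero
    (u := fun s : ℝ => modeA (gradZ p q) m s - ((s : ℂ) ^ (m + 1) * modeB (gradZbar p q) m s -
      (m + 1) * modeV V m s)) isOpen_Ioi ((hs.locallyIntegrableOn_modeA m).sub (hb'.sub hv')) ?_
  · filter_upwards [key] with s h1 h2
    exact sub_eq_zero.1 (h1 h2)
  intro h h1 h2 h3
  have hh : IsBumpOn (Ioi 0) h := ⟨h1, h2, h3⟩
  have hsh := hh.id_mul isOpen_Ioi
  -- The test function `s h` raises the weight of `modeB` from `s^m` to `s^(m+1)`.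
  have e1 := hs.radial_potential m hsh
  have e2 := hs.grad.integral_gradZ hh (m + 1)
  have e3 := (hh.euler isOpen_Ioi (m + 1 + 1)).integral_mul_radial hs.grad.locInt (m + 1)
  rw [hh.integral_mul_radial hs.grad.locallyIntegrable_gradZ] at e2
  push_cast at e2
  rw [e3, ← mul_neg] at e2
  have e4 := mul_left_cancel₀ (by exact_mod_cast Real.pi_pos.ne') e2
  have ia := hh.integrable_mul (hs.locallyIntegrableOn_modeA m)
  have ib := hh.integrable_mul hb'
  have iv := hh.integrable_mul hv
  have ide := hh.deriv.integrable_mul hv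
  have isd := (hh.deriv.id_mul isOpen_Ioi).integrable_mul hv
  have hd : ∀ s : ℝ, deriv (fun s : ℝ => (s : ℂ) * h s) s = h s + s * deriv h s := fun s => by
    have h1 : HasDerivAt (fun s : ℝ => (s : ℂ)) 1 s := Complex.ofRealCLM.hasDerivAt
    refine (h1.mul (hh.differentiable s).hasDerivAt).deriv.trans ?_
    simp
  have e5 : ∫ s, h s * modeA (gradZ p q) m s =
      -((∫ s : ℝ, s * deriv h s * modeV V m s) + (m + 2) * ∫ s, h s * modeV V m s) := by
    rw [← integral_const_mul, ← integral_add isd (iv.const_mul _)]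
    refine Eq.trans ?_ (e4.trans ?_)
    · simp only [modeA]
      push_cast
      rfl
    · congr 2
      ext s
      simp only [modeV]
      push_cast
      ring
  have e6 : ∫ s : ℝ, h s * ((s : ℂ) ^ (m + 1) * modeB (gradZbar p q) m s) =
      -((∫ s, h s * modeV V m s) + ∫ s : ℝ, s * deriv h s * modeV V m s) := by
    rw [← integral_add iv isd]
    refine Eq.trans ?_ (e1.trans ?_)
    · congr 1
      ext s
      ring
    · congr 2
      ext s
      rw [hd]
      ring
  have e7 : ∫ s : ℝ, h s * (modeA (gradZ p q) m s - ((s : ℂ) ^ (m + 1) *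
      modeB (gradZbar p q) m s - (m + 1) * modeV V m s)) =
      (∫ s, h s * modeA (gradZ p q) m s) -
        ((∫ s : ℝ, h s * ((s : ℂ) ^ (m + 1) * modeB (gradZbar p q) m s)) -
          (m + 1) * ∫ s, h s * modeV V m s) := by
    rw [← integral_const_mul, ← integral_sub ib (iv.const_mul _)]
    refine Eq.trans ?_ (integral_sub ia (ib.sub (iv.const_mul _)))
    congr 1
    ext s
    ring
  rw [e7, e5, e6]
  ring

/-- `integral_flux` in polar coordinates. The constant `-1/(2π)` of `sourceFunctional` collects its
factor `2` and the `π` of the polar measure. -/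
lemma radial_flux (hri : 0 < ri) (hre : ri < re) (hs : IsSolution ri re εc εs δ f V p q) (m : ℕ)
    {h : ℝ → ℂ} (hh : IsBumpOn (Ioi 0) h) :
    ∫ s : ℝ, radialPermittivity ri re εc εs δ s * (deriv h s * modeA (gradZ p q) m s +
      (s * deriv h s + (m + 1) * h s) * ((s : ℂ) ^ m * modeB (gradZbar p q) m s)) =
      sourceFunctional f m h := by
  have h1 := hs.integral_flux hri hre isOpen_Ioi hh m
  have heu := hh.euler isOpen_Ioi ((m : ℂ) + 1)
  have i1 := integrable_mul_permittivity_radial hs.grad.locallyIntegrable_gradZ ri re εc εs δ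
    hh.deriv (m + 2)
  have i2 := integrable_mul_permittivity_radial hs.grad.locallyIntegrable_gradZbar ri re εc εs δ
    heu m
  have e1 := CALR.integral_mul_radial (k := fun s => radialPermittivity ri re εc εs δ s *
    deriv h s) (m + 2) i1
  have e2 := CALR.integral_mul_radial (k := fun s => radialPermittivity ri re εc εs δ s *
    (s * deriv h s + (m + 1) * h s)) m i2
  have hbound : ∀ᵐ s : ℝ, ‖radialPermittivity ri re εc εs δ s‖ ≤
      ‖(εc : ℂ)‖ + ‖(εs : ℂ) + Complex.I * (δ : ℂ)‖ + 1 :=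
    ae_of_all _ fun s => norm_radialPermittivity_le ..
  have hmeas := (measurable_radialPermittivity ri re εc εs δ).aestronglyMeasurable (μ := volume)
  have j1 := (hh.deriv.integrable_mul (hs.locallyIntegrableOn_modeA m)).bdd_mul hmeas hbound
  have hb' : LocallyIntegrableOn (fun s : ℝ => (s : ℂ) ^ m * modeB (gradZbar p q) m s)
      (Ioi 0) := (hs.locallyIntegrableOn_modeB m).continuousOn_mul (by fun_prop)
    isOpen_Ioi.isLocallyClosed
  have j2 := (heu.integrable_mul hb').bdd_mul hmeas hbound
  have hset : ∀ {u : ℝ → ℂ}, (∀ s ∉ Ioi (0 : ℝ), u s = 0) → ∫ s, u s = ∫ s in Ioi (0 : ℝ), u s :=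
    fun hu => (setIntegral_eq_integral_of_forall_compl_eq_zero hu).symm
  have c1 : ∫ s in Ioi (0 : ℝ), radialPermittivity ri re εc εs δ s * deriv h s *
      ((√s : ℝ) : ℂ) ^ (m + 2) * mode (gradZ p q) (-((m + 2 : ℕ) : ℤ)) s =
      ∫ s, radialPermittivity ri re εc εs δ s * (deriv h s * modeA (gradZ p q) m s) := by
    rw [hset fun s hs => by rw [hh.deriv.eq_zero hs]; ring]
    refine setIntegral_congr_fun measurableSet_Ioi fun s _ => ?_
    simp only [modeA]
    ring
  have c2 : ∫ s in Ioi (0 : ℝ), radialPermittivity ri re εc εs δ s *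
      (s * deriv h s + (m + 1) * h s) * ((√s : ℝ) : ℂ) ^ m * mode (gradZbar p q) (-(m : ℤ)) s =
      ∫ s : ℝ, radialPermittivity ri re εc εs δ s * ((s * deriv h s + (m + 1) * h s) *
        ((s : ℂ) ^ m * modeB (gradZbar p q) m s)) := by
    rw [hset fun s hs => by rw [hh.deriv.eq_zero hs, hh.eq_zero hs]; ring]
    refine setIntegral_congr_fun measurableSet_Ioi fun s hs => ?_
    simp only [pow_mul_modeB m hs]
    ring
  rw [e1, e2, c1, c2] at h1
  simp only [mul_add (radialPermittivity ri re εc εs δ _)]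
  have hpi : (π : ℂ) ≠ 0 := by exact_mod_cast Real.pi_pos.ne'
  rw [integral_add j1 j2, sourceFunctional]
  refine mul_left_cancel₀ (mul_ne_zero two_ne_zero hpi) ?_
  rw [← mul_assoc, mul_neg, mul_one_div_cancel (mul_ne_zero two_ne_zero hpi), neg_one_mul, ← h1]
  ring

lemma norm_modeV_le {C : ℝ} (hC : ∀ z, ‖V z‖ ≤ C) (m : ℕ) (s : ℝ) :
    ‖modeV V m s‖ ≤ √s ^ (m + 1) * C := by
  rw [modeV, norm_mul, norm_pow, Complex.norm_real, Real.norm_of_nonneg (Real.sqrt_nonneg s)]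
  exact mul_le_mul_of_nonneg_left (norm_mode_le _ _ fun t => hC _) (by positivity)

theorem radialSystem (hri : 0 < ri) (hre : ri < re) (hs : IsSolution ri re εc εs δ f V p q)
    (m : ℕ) : RadialSystem m (radialPermittivity ri re εc εs δ) (sourceFunctional f m)
      (modeA (gradZ p q) m) (modeB (gradZbar p q) m) (modeV V m) where
  a_int := hs.locallyIntegrableOn_modeA m
  b_int := hs.locallyIntegrableOn_modeB m
  v_cont := (continuous_modeV hs.continuous m).continuousOn
  algebraic := hs.radial_algebraic m
  potential _ hh := hs.radial_potential m hh
  flux _ hh := hs.radial_flux hri hre m hh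
  v_zero := by
    have h := (continuous_modeV hs.continuous m).tendsto 0
    have h0 : modeV V m 0 = 0 := by simp [modeV]
    rw [h0] at h
    exact h.mono_left nhdsWithin_le_nhds
  v_infty := by
    obtain ⟨C, hC⟩ := exists_bound_of_tendsto_cocompact hs.continuous hs.decay
    -- A bounded `V` gives `v = O(s^((m+1)/2))`, already smaller than `s^(m+1)`.
    have hlim : Tendsto (fun s : ℝ => (√s ^ (m + 1))⁻¹ * C) atTop (𝓝 (0 * C)) :=
      (((tendsto_pow_atTop (Nat.succ_ne_zero m)).comp
        Real.tendsto_sqrt_atTop).inv_tendsto_atTop).mul_const C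
    rw [zero_mul] at hlim
    refine squeeze_zero_norm' ?_ hlim
    filter_upwards [Ioi_mem_atTop (0 : ℝ)] with s hs0
    have hs1 : 0 < √s := Real.sqrt_pos.2 hs0
    rw [norm_div, norm_pow, Complex.norm_real, Real.norm_of_nonneg (le_of_lt hs0),
      div_le_iff₀ (pow_pos hs0 _)]
    refine (norm_modeV_le hC m s).trans (le_of_eq ?_)
    have h2 : s ^ (m + 1) = √s ^ (m + 1) * √s ^ (m + 1) := by
      rw [← mul_pow, Real.mul_self_sqrt (le_of_lt hs0)]
    rw [h2]
    field_simp

end IsSolution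

/-! ### Reflection in the real axis -/

lemma measurePreserving_conj : MeasurePreserving (fun z : ℂ => conj z) volume volume :=
  Complex.conjLIE.measurePreserving

lemma measurableEmbedding_conj : MeasurableEmbedding (fun z : ℂ => conj z) :=
  Complex.conjLIE.toHomeomorph.measurableEmbedding

lemma integral_comp_conj (g : ℂ → ℂ) : ∫ z, g (conj z) = ∫ z, g z :=
  measurePreserving_conj.integral_comp measurableEmbedding_conj g

lemma IsTestFunction.comp_conj {φ : ℂ → ℂ} (hφ : IsTestFunction φ) :
    IsTestFunction fun z => φ (conj z) :=
  ⟨hφ.smooth.comp Complex.conjCLE.contDiff,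
    hφ.compact.comp_homeomorph Complex.conjLIE.toHomeomorph⟩

lemma fderiv_comp_conj {φ : ℂ → ℂ} (hφ : IsTestFunction φ) (z w : ℂ) :
    fderiv ℝ (fun z => φ (conj z)) z w = fderiv ℝ φ (conj z) (conj w) := by
  have h1 : HasFDerivAt φ (fderiv ℝ φ (conj z)) (Complex.conjCLE z) :=
    ((hφ.smooth.differentiable (by simp)) _).hasFDerivAt
  have h2 := h1.comp z (Complex.conjCLE : ℂ ≃L[ℝ] ℂ).hasFDerivAt
  have h3 : HasFDerivAt (fun z => φ (conj z)) _ z := h2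
  rw [h3.fderiv]
  rfl

lemma memLp_comp_conj {p : ℂ → ℂ}
    (hp : ∀ K : Set ℂ, IsCompact K → MemLp p 2 (volume.restrict K)) (K : Set ℂ)
    (hK : IsCompact K) : MemLp (fun z => p (conj z)) 2 (volume.restrict K) := by
  have hc : Continuous fun z : ℂ => conj z := Complex.continuous_conj
  have hK' : IsCompact ((fun z : ℂ => conj z) '' K) := hK.image hc
  have h1 := measurePreserving_conj.restrict_preimage_emb measurableEmbedding_conj
    ((fun z : ℂ => conj z) '' K)
  have h2 : (fun z : ℂ => conj z) ⁻¹' ((fun z : ℂ => conj z) '' K) = K :=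
    preimage_image_eq _ measurableEmbedding_conj.injective
  rw [h2] at h1
  exact (hp _ hK').comp_measurePreserving h1

lemma HasWeakGradient.comp_conj {V p q : ℂ → ℂ} (h : HasWeakGradient V p q) :
    HasWeakGradient (fun z => V (conj z)) (fun z => p (conj z)) (fun z => -q (conj z)) where
  locInt := by
    rw [locallyIntegrable_iff]
    intro K hK
    have hK' : IsCompact ((fun z : ℂ => conj z) '' K) := hK.image Complex.continuous_conj
    have h1 := measurePreserving_conj.restrict_preimage_emb measurableEmbedding_conj
      ((fun z : ℂ => conj z) '' K)
    rw [preimage_image_eq _ measurableEmbedding_conj.injective] at h1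
    exact h1.integrable_comp_of_integrable (h.locInt.integrableOn_isCompact hK')
  memLp_fst := memLp_comp_conj h.memLp_fst
  memLp_snd K hK := (memLp_comp_conj h.memLp_snd K hK).neg
  weak_fst φ hφ := by
    have h1 := h.weak_fst _ hφ.comp_conj
    rw [← integral_comp_conj fun x => V x * _, ← integral_comp_conj fun x => p x * _] at h1
    simpa only [fderiv_comp_conj hφ, Complex.conj_conj, map_one] using h1
  weak_snd φ hφ := by
    have h1 := h.weak_snd _ hφ.comp_conj
    rw [← integral_comp_conj fun x => V x * _, ← integral_comp_conj fun x => q x * _] at h1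
    simp only [fderiv_comp_conj hφ, Complex.conj_conj, Complex.conj_I, map_neg, mul_neg,
      integral_neg] at h1
    simp only [neg_mul, integral_neg, neg_neg]
    rw [← neg_eq_iff_eq_neg.2 h1.symm, neg_neg]

/-- Reflection preserves the radial permittivity and exchanges frequencies `k` and `-k`, so only
negative frequencies of `V` need a separate analysis. -/
lemma IsSolution.comp_conj {ri re εc εs δ : ℝ} {f V p q : ℂ → ℂ}
    (h : IsSolution ri re εc εs δ f V p q) :
    IsSolution ri re εc εs δ (fun z => f (conj z)) (fun z => V (conj z)) (fun z => p (conj z))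
      (fun z => -q (conj z)) where
  continuous := h.continuous.comp Complex.continuous_conj
  grad := h.grad.comp_conj
  weak_eq φ hφ := by
    have h1 := h.weak_eq _ hφ.comp_conj
    rw [← integral_comp_conj fun x => permittivity ri re εc εs δ x * _,
      ← integral_comp_conj fun x => f x * _] at h1
    simp only [fderiv_comp_conj hφ, Complex.conj_conj, Complex.conj_I, map_neg, mul_neg,
      map_one] at h1
    rw [← h1]
    congr 1
    ext z
    simp only [permittivity, RCLike.norm_conj]
    ring
  decay := h.decay.comp Complex.conjLIE.toHomeomorph.isClosedEmbedding.tendsto_cocompact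

lemma gradZ_comp_conj (p q : ℂ → ℂ) :
    gradZ (fun z => p (conj z)) (fun z => -q (conj z)) = fun z => gradZbar p q (conj z) := by
  ext z
  simp [gradZ, gradZbar]

lemma gradZbar_comp_conj (p q : ℂ → ℂ) :
    gradZbar (fun z => p (conj z)) (fun z => -q (conj z)) = fun z => gradZ p q (conj z) := by
  ext z
  simp only [gradZ, gradZbar]
  ring

lemma mode_comp_conj (G : ℂ → ℂ) (k : ℤ) (s : ℝ) :
    mode (fun z => G (conj z)) k s = mode G (-k) s := by
  rw [mode_eq, mode_eq, ← integral_neg_eq_self]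
  congr 1
  ext t
  congr 1
  · simp [fourier_apply]
  · congr 1
    simp only [polarMap, toCircle_neg, map_mul, Complex.conj_ofReal, Circle.coe_inv_eq_conj,
      Complex.conj_conj]

/-! ### The rotation invariant mode -/

namespace IsSolution

variable {ri re εc εs δ : ℝ} {f V p q : ℂ → ℂ}

lemma integral_radial_zero (hs : IsSolution ri re εc εs δ f V p q) {h : ℝ → ℂ}
    (hh : IsBumpOn (Ioi 0) h) :
    ∫ s, h s * (((√s : ℝ) : ℂ) * mode (gradZ p q) (-1) s) =
      -∫ s : ℝ, (s * deriv h s + h s) * mode V 0 s := by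
  have e2 := hs.grad.integral_gradZ hh 0
  have e3 := (hh.euler isOpen_Ioi 1).integral_mul_radial hs.grad.locInt 0
  rw [hh.integral_mul_radial hs.grad.locallyIntegrable_gradZ] at e2
  simp only [Nat.cast_zero, zero_add, one_mul] at e2 e3
  rw [e3, ← mul_neg] at e2
  have e4 := mul_left_cancel₀ (by exact_mod_cast Real.pi_pos.ne') e2
  simpa using e4

lemma locallyIntegrableOn_sqrt_mul_mode {G : ℂ → ℂ} (hG : LocallyIntegrable G) (k : ℤ) :
    LocallyIntegrableOn (fun s : ℝ => ((√s : ℝ) : ℂ) * mode G k s) (Ioi 0) :=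
  (locallyIntegrableOn_mode hG _).continuousOn_mul
    continuous_sqrt_complex.continuousOn isOpen_Ioi.isLocallyClosed

/-- The two sides are, up to `√s`, the circular means of `z̄ V_z̄` and `z V_z`. Their difference is
an angular derivative, of mean zero; here it follows from the invariance of the mean of `V` under
reflection. -/
lemma mode_gradZbar_one (hs : IsSolution ri re εc εs δ f V p q) :
    ∀ᵐ s : ℝ, s ∈ Ioi (0 : ℝ) → mode (gradZbar p q) 1 s = mode (gradZ p q) (-1) s := by
  have hA := locallyIntegrableOn_sqrt_mul_mode hs.grad.locallyIntegrable_gradZ (-1)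
  have hB := locallyIntegrableOn_sqrt_mul_mode hs.grad.locallyIntegrable_gradZbar 1
  have key := ae_eq_zero_of_integral_mul_eq_zero (u := fun s : ℝ =>
    ((√s : ℝ) : ℂ) * mode (gradZbar p q) 1 s - ((√s : ℝ) : ℂ) * mode (gradZ p q) (-1) s)
    isOpen_Ioi (hB.sub hA) fun h h1 h2 h3 => by
      have hh : IsBumpOn (Ioi 0) h := ⟨h1, h2, h3⟩
      have e1 := hs.integral_radial_zero hh
      have e2 := hs.comp_conj.integral_radial_zero hh
      simp only [gradZ_comp_conj, mode_comp_conj, neg_neg, neg_zero] at e2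
      simp only [mul_sub]
      rw [integral_sub (hh.integrable_mul hB) (hh.integrable_mul hA), e1, e2, sub_self]
  filter_upwards [key] with s h1 h2
  have := h1 h2
  rw [← mul_sub] at this
  exact sub_eq_zero.1 ((mul_eq_zero.1 this).resolve_left (sqrt_ne_zero_complex h2))

/-- Gauss's law in weak form, tested with `h(|z|²)`. The bump `h` need not vanish at the origin, so
no constant of integration is lost. -/
lemma integral_flux_zero (hri : 0 < ri) (hre : ri < re) (hs : IsSolution ri re εc εs δ f V p q)
    {U : Set ℝ} {h : ℝ → ℂ} (hh : IsBumpOn U h) :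
    4 * π * ∫ s in Ioi (0 : ℝ), deriv h s * (radialPermittivity ri re εc εs δ s *
      (((√s : ℝ) : ℂ) * mode (gradZ p q) (-1) s)) = -∫ z, f z * h (Complex.normSq z) := by
  have i1 := integrable_mul_permittivity_radial hs.grad.locallyIntegrable_gradZ ri re εc εs δ
    hh.deriv 1
  have i2 := integrable_mul_permittivity_radial hs.comp_conj.grad.locallyIntegrable_gradZ
    ri re εc εs δ hh.deriv 1
  have i2' := measurePreserving_conj.integrable_comp_of_integrable i2
  simp only [Function.comp_def, gradZ_comp_conj, Complex.conj_conj, Complex.normSq_conj] at i2'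
  have e1 := CALR.integral_mul_radial (k := fun s => radialPermittivity ri re εc εs δ s *
    deriv h s) 1 i1
  have e2 := CALR.integral_mul_radial (k := fun s => radialPermittivity ri re εc εs δ s *
    deriv h s) 1 i2
  rw [← integral_comp_conj] at e2
  simp only [gradZ_comp_conj, mode_comp_conj, Complex.conj_conj, Complex.normSq_conj] at e2
  have h1 := hs.weak_eq _ (hh.isTestFunction 0)
  have h2 : ∫ z, permittivity ri re εc εs δ z *
      (p z * fderiv ℝ (fun z => h (Complex.normSq z) * z ^ 0) z 1 +
        q z * fderiv ℝ (fun z => h (Complex.normSq z) * z ^ 0) z Complex.I) =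
      2 * ((∫ z, gradZ p q z * (radialPermittivity ri re εc εs δ (Complex.normSq z) *
        deriv h (Complex.normSq z) * z ^ 1)) + ∫ z, gradZbar p q z *
        (radialPermittivity ri re εc εs δ (Complex.normSq z) *
          deriv h (Complex.normSq z) * (conj z) ^ 1)) := by
    rw [← integral_add i1 i2', ← integral_const_mul]
    congr 1
    ext z
    rw [permittivity_eq hri hre, hh.fderiv_radial, hh.fderiv_radial]
    simp only [Complex.one_re, Complex.one_im, Complex.I_re, Complex.I_im, gradZ, gradZbar]
    have hz := Complex.re_add_im z
    have hzc : conj z = z.re - z.im * Complex.I := by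
      apply Complex.ext <;> simp
    have hI := Complex.I_mul_I
    rw [hzc, pow_one, pow_one]
    generalize hN : Complex.normSq z = N
    generalize hE : radialPermittivity ri re εc εs δ N = E
    push_cast
    linear_combination E * deriv h N * (p z - Complex.I * q z) * hz +
      (2 * E * deriv h N * q z * z.im) * hI
  have c2 : ∫ s in Ioi (0 : ℝ), radialPermittivity ri re εc εs δ s * deriv h s *
      ((√s : ℝ) : ℂ) ^ 1 * mode (gradZbar p q) (- -((1 : ℕ) : ℤ)) s =
      ∫ s in Ioi (0 : ℝ), radialPermittivity ri re εc εs δ s * deriv h s *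
      ((√s : ℝ) : ℂ) ^ 1 * mode (gradZ p q) (-((1 : ℕ) : ℤ)) s := by
    refine setIntegral_congr_ae measurableSet_Ioi ?_
    filter_upwards [hs.mode_gradZbar_one] with s h1 h2
    rw [neg_neg]
    simp only [Nat.cast_one, h1 h2]
  rw [h2, e1, e2, c2] at h1
  simp only [pow_zero, mul_one] at h1
  rw [← h1]
  have c3 : ∫ s in Ioi (0 : ℝ), deriv h s * (radialPermittivity ri re εc εs δ s *
      (((√s : ℝ) : ℂ) * mode (gradZ p q) (-1) s)) =
      ∫ s in Ioi (0 : ℝ), radialPermittivity ri re εc εs δ s * deriv h s *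
      ((√s : ℝ) : ℂ) ^ 1 * mode (gradZ p q) (-((1 : ℕ) : ℤ)) s := by
    congr 1
    ext s
    simp only [Nat.cast_one]
    ring
  rw [c3]
  ring

end IsSolution

/-- The mean of `k` is compensated on the negative half line, which the variable `s = |z|²` never
sees. Hence every bump `k`, of any mean, can serve as `h'` in `integral_flux_zero`. -/
lemma exists_bump_primitive {β : ℝ} (hβ : 0 < β) {k : ℝ → ℂ} (hk : IsBumpOn (Ioo 0 β) k) :
    ∃ h, IsBumpOn (Iio β) h ∧ ∀ s, 0 < s → deriv h s = k s := by
  obtain ⟨κ, h1, h2, h3, h4⟩ := exists_smooth_integral_eq_one (U := Iio (0 : ℝ)) isOpen_Iio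
    nonempty_Iio
  have hκ : IsBumpOn (Iio 0) κ := ⟨h1, h2, h3⟩
  have hsum : IsBumpOn (Iio β) fun s => k s + (-∫ s, k s) * κ s :=
    (hk.mono Ioo_subset_Iio_self).add ((hκ.mono (Iio_subset_Iio hβ.le)).const_mul isOpen_Iio _)
  have hki : Integrable k := hk.continuous.integrable_of_hasCompactSupport hk.compact
  have hκi : Integrable κ := hκ.continuous.integrable_of_hasCompactSupport hκ.compact
  obtain ⟨h, a1, a2, a3, a4⟩ := exists_primitive_of_integral_eq_zero ordConnected_Iio hsum.smooth
    hsum.compact hsum.supp (by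
      rw [integral_add hki (hκi.const_mul _), integral_const_mul, h4]; ring)
  refine ⟨h, ⟨a1, a2, a3⟩, fun s hs => ?_⟩
  simp only [a4, hκ.eq_zero (notMem_Iio.2 hs.le), mul_zero, add_zero]

lemma locallyIntegrableOn_radialPermittivity_mul (ri re εc εs δ : ℝ) {u : ℝ → ℂ}
    (hu : LocallyIntegrableOn u (Ioi 0)) :
    LocallyIntegrableOn (fun s => radialPermittivity ri re εc εs δ s * u s) (Ioi 0) := by
  intro x hx
  obtain ⟨t, ht, hti⟩ := hu x hx
  exact ⟨t, ht, Integrable.bdd_mul hti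
    (measurable_radialPermittivity ri re εc εs δ).aestronglyMeasurable
    (ae_of_all _ fun s => norm_radialPermittivity_le ri re εc εs δ s)⟩

lemma radialPermittivity_core {ri re : ℝ} (εc εs δ : ℝ) :
    ∀ s ∈ Ioo 0 (ri ^ 2), radialPermittivity ri re εc εs δ s = εc := fun s hs => by
  rw [radialPermittivity, if_pos hs.2]

lemma radialPermittivity_shell {ri re : ℝ} (εc εs δ : ℝ) :
    ∀ s ∈ Ioo (ri ^ 2) (re ^ 2), radialPermittivity ri re εc εs δ s = εs + Complex.I * δ :=
  fun s hs => by rw [radialPermittivity, if_neg (not_lt.2 hs.1.le), if_pos hs.2]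

lemma radialPermittivity_exterior {ri re : ℝ} (hri : 0 < ri) (hre : ri < re) (εc εs δ : ℝ) :
    ∀ s ∈ Ioi (re ^ 2), radialPermittivity ri re εc εs δ s = 1 := fun s hs => by
  have h : ri ^ 2 < re ^ 2 := pow_lt_pow_left₀ hre hri.le two_ne_zero
  rw [radialPermittivity, if_neg (not_lt.2 (h.trans hs).le), if_neg (not_lt.2 (le_of_lt hs))]

lemma shell_ne_zero (εs : ℝ) {δ : ℝ} (hδ : 0 < δ) : (εs : ℂ) + Complex.I * δ ≠ 0 := by
  intro h
  have := congrArg Complex.im h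
  simp at this
  exact hδ.ne' this

lemma radialPermittivity_ne_zero (ri re : ℝ) {εc : ℝ} (hεc : 0 < εc) (εs : ℝ) {δ : ℝ}
    (hδ : 0 < δ) (s : ℝ) : radialPermittivity ri re εc εs δ s ≠ 0 := by
  unfold radialPermittivity
  split_ifs
  · exact_mod_cast hεc.ne'
  · exact shell_ne_zero εs hδ
  · exact one_ne_zero

namespace IsSolution

variable {ri re εc εs δ δ' : ℝ} {f V p q V' p' q' : ℂ → ℂ}

lemma mode_gradZ_neg_one_eq_zero (hri : 0 < ri) (hre : ri < re) (hεc : 0 < εc) (hδ : 0 < δ)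
    (hs : IsSolution ri re εc εs δ f V p q) (hf : ∀ z, Complex.normSq z < re ^ 2 → f z = 0) :
    ∀ᵐ s : ℝ, s ∈ Ioo 0 (re ^ 2) → mode (gradZ p q) (-1) s = 0 := by
  have hre2 : 0 < re ^ 2 := pow_pos (hri.trans hre) 2
  have hA := locallyIntegrableOn_radialPermittivity_mul ri re εc εs δ
    (locallyIntegrableOn_sqrt_mul_mode hs.grad.locallyIntegrable_gradZ (-1))
  have key := ae_eq_zero_of_integral_mul_eq_zero isOpen_Ioo
    (hA.mono_set (Ioo_subset_Ioi_self : Ioo 0 (re ^ 2) ⊆ Ioi 0)) fun k h1 h2 h3 => by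
      have hk : IsBumpOn (Ioo 0 (re ^ 2)) k := ⟨h1, h2, h3⟩
      obtain ⟨h, hh, hd⟩ := exists_bump_primitive hre2 hk
      have e := hs.integral_flux_zero hri hre hh
      have hz : ∀ z, f z * h (Complex.normSq z) = 0 := fun z => by
        by_cases hz : Complex.normSq z < re ^ 2
        · rw [hf z hz, zero_mul]
        · rw [hh.eq_zero hz, mul_zero]
      simp only [hz, integral_zero, neg_zero] at e
      have hpi : (4 * π : ℂ) ≠ 0 := by exact_mod_cast (mul_pos four_pos Real.pi_pos).ne'
      rw [← (hk.mono Ioo_subset_Ioi_self).setIntegral_Ioi]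
      refine Eq.trans ?_ ((mul_eq_zero.1 e).resolve_left hpi)
      refine setIntegral_congr_fun measurableSet_Ioi fun s hs => ?_
      simp only [hd s hs]
  filter_upwards [key] with s h1 h2
  have := h1 h2
  exact ((mul_eq_zero.1 ((mul_eq_zero.1 this).resolve_left
    (radialPermittivity_ne_zero ri re hεc εs hδ s))).resolve_left (sqrt_ne_zero_complex h2.1))

/-- By Gauss's law `ε` times the radial flux depends on the source only, and `ε = 1` outside
whatever the loss. -/
lemma mode_gradZ_neg_one_exterior (hri : 0 < ri) (hre : ri < re)
    (hs : IsSolution ri re εc εs δ f V p q) (hs' : IsSolution ri re εc εs δ' f V' p' q') :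
    ∀ᵐ s : ℝ, s ∈ Ioi (re ^ 2) → mode (gradZ p q) (-1) s = mode (gradZ p' q') (-1) s := by
  have hA := locallyIntegrableOn_radialPermittivity_mul ri re εc εs δ
    (locallyIntegrableOn_sqrt_mul_mode hs.grad.locallyIntegrable_gradZ (-1))
  have hA' := locallyIntegrableOn_radialPermittivity_mul ri re εc εs δ'
    (locallyIntegrableOn_sqrt_mul_mode hs'.grad.locallyIntegrable_gradZ (-1))
  have key := ae_eq_zero_of_integral_mul_eq_zero isOpen_Ioi (hA.sub hA') fun k h1 h2 h3 => by
      have hk : IsBumpOn (Ioi 0) k := ⟨h1, h2, h3⟩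
      obtain ⟨T, hT, hkT⟩ := hk.exists_vanish
      have hk' : IsBumpOn (Ioo 0 (T + 1)) k := ⟨h1, h2, fun s hs => ⟨h3 hs, by
        have : tsupport k ⊆ Iic T := closure_minimal (fun s hs => by
          by_contra hn
          exact hs (hkT s (not_le.1 hn).le)) isClosed_Iic
        exact (this hs).trans_lt (lt_add_one T)⟩⟩
      obtain ⟨h, hh, hd⟩ := exists_bump_primitive (by linarith) hk'
      have e := hs.integral_flux_zero hri hre hh
      have e' := hs'.integral_flux_zero hri hre hh
      rw [← e'] at e
      have hpi : (4 * π : ℂ) ≠ 0 := by exact_mod_cast (mul_pos four_pos Real.pi_pos).ne'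
      have e2 := mul_left_cancel₀ hpi e
      have hcongr : ∀ u : ℝ → ℂ, ∫ s in Ioi (0 : ℝ), deriv h s * u s = ∫ s, k s * u s := by
        intro u
        rw [← hk.setIntegral_Ioi]
        refine setIntegral_congr_fun measurableSet_Ioi fun s hs => ?_
        simp only [hd s hs]
      rw [hcongr, hcongr] at e2
      simp only [Pi.sub_apply, mul_sub]
      rw [integral_sub (hk.integrable_mul hA) (hk.integrable_mul hA'), e2, sub_self]
  filter_upwards [key] with s h1 h2
  have hs0 : 0 < s := (by positivity : (0 : ℝ) ≤ re ^ 2).trans_lt h2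
  have := h1 hs0
  simp only [Pi.sub_apply, radialPermittivity_exterior hri hre _ _ _ s h2, one_mul, ← mul_sub] at this
  exact sub_eq_zero.1 ((mul_eq_zero.1 this).resolve_left (sqrt_ne_zero_complex hs0))

lemma tendsto_mode (hs : IsSolution ri re εc εs δ f V p q) (k : ℤ) :
    Tendsto (mode V k) atTop (𝓝 0) := by
  rw [Metric.tendsto_atTop]
  intro η hη
  have h1 : ∀ᶠ z in cocompact ℂ, ‖V z‖ ≤ η / 2 := by
    have := hs.decay.norm.eventually_le_const (u := η / 2) (by simpa using half_pos hη)
    exact this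
  rw [← Metric.cobounded_eq_cocompact, ← comap_norm_atTop] at h1
  obtain ⟨r, hr⟩ := (Filter.eventually_atTop.1 (Filter.eventually_comap.1 h1))
  refine ⟨(max r 0) ^ 2, fun s hs => ?_⟩
  rw [dist_zero_right]
  refine (norm_mode_le k s (C := η / 2) fun t => hr (√s) ?_ _ (norm_polarMap s t)).trans_lt
    (half_lt_self hη)
  exact (le_max_left r 0).trans (Real.le_sqrt_of_sq_le hs)

lemma mode_zero_exterior (hri : 0 < ri) (hre : ri < re)
    (hs : IsSolution ri re εc εs δ f V p q) (hs' : IsSolution ri re εc εs δ' f V' p' q') :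
    ∀ s ∈ Ioi (re ^ 2), mode V 0 s = mode V' 0 s := by
  have hre2 : 0 < re ^ 2 := pow_pos (hri.trans hre) 2
  have hsub : Ioi (re ^ 2) ⊆ Ioi 0 := Ioi_subset_Ioi hre2.le
  have cV := continuous_mode hs.continuous 0
  have cV' := continuous_mode hs'.continuous 0
  have lV : LocallyIntegrableOn (mode V 0) (Ioi (re ^ 2)) :=
    cV.continuousOn.locallyIntegrableOn measurableSet_Ioi
  have lV' : LocallyIntegrableOn (mode V' 0) (Ioi (re ^ 2)) :=
    cV'.continuousOn.locallyIntegrableOn measurableSet_Ioi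
  obtain ⟨c, hc⟩ := ae_eq_const_of_integral_deriv_mul_eq_zero
    (u := fun s => mode V 0 s - mode V' 0 s) isOpen_Ioi ordConnected_Ioi
    nonempty_Ioi (lV.sub lV') fun g h1 h2 h3 => by
      have hg : IsBumpOn (Ioi (re ^ 2)) g := ⟨h1, h2, h3⟩
      -- With `h = g/s` one has `s h' + h = g'`, so the relation for the mean of `V` becomes one for
      -- its derivative.
      have hh := hg.mul_contDiffOn isOpen_Ioi ((contDiffOn_inv_pow 1).mono hsub)
      have e := hs.integral_radial_zero (hh.mono hsub)
      have e' := hs'.integral_radial_zero (hh.mono hsub)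
      have hd : ∀ s : ℝ, s * deriv (fun s : ℝ => g s * ((s : ℂ) ^ 1)⁻¹) s +
          g s * ((s : ℂ) ^ 1)⁻¹ = deriv g s := by
        intro s
        by_cases hs : s ∈ Ioi (re ^ 2)
        · have hs0 : (s : ℂ) ≠ 0 := by exact_mod_cast (ne_of_gt (hsub hs))
          have h1 : HasDerivAt (fun s : ℝ => (s : ℂ) ^ 1) 1 s := by
            have : HasDerivAt (fun s : ℝ => (s : ℂ)) 1 s := Complex.ofRealCLM.hasDerivAt
            simpa using this
          have := ((hg.differentiable s).hasDerivAt.mul (h1.inv (pow_ne_zero _ hs0))).deriv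
          have h2 : deriv (fun s : ℝ => g s * ((s : ℂ) ^ 1)⁻¹) s = _ := this
          rw [h2]
          simp only [Pi.inv_apply]
          field_simp
          ring
        · rw [hh.deriv.eq_zero hs, hg.deriv.eq_zero hs, hg.eq_zero hs]
          ring
      simp only [hd] at e e'
      have e3 : ∫ s : ℝ, g s * ((s : ℂ) ^ 1)⁻¹ * (((√s : ℝ) : ℂ) * mode (gradZ p q) (-1) s) =
          ∫ s : ℝ, g s * ((s : ℂ) ^ 1)⁻¹ * (((√s : ℝ) : ℂ) * mode (gradZ p' q') (-1) s) := by
        refine integral_congr_ae ?_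
        filter_upwards [hs.mode_gradZ_neg_one_exterior hri hre hs'] with s h1
        by_cases hs : s ∈ Ioi (re ^ 2)
        · rw [h1 hs]
        · rw [hg.eq_zero hs]; ring
      rw [e, e', neg_inj] at e3
      simp only [mul_sub]
      rw [integral_sub (hg.deriv.integrable_mul lV) (hg.deriv.integrable_mul lV'), e3, sub_self]
  have heq := eqOn_of_ae_eq isOpen_Ioi (cV.sub cV').continuousOn continuousOn_const hc
  have hlim : Tendsto (fun s => mode V 0 s - mode V' 0 s) atTop (𝓝 c) :=
    tendsto_const_nhds.congr' (by
      filter_upwards [Ioi_mem_atTop (re ^ 2)] with s hs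
      exact (heq hs).symm)
  have hc0 : c = 0 := by
    have := tendsto_nhds_unique hlim ((hs.tendsto_mode 0).sub (hs'.tendsto_mode 0))
    simpa using this
  intro s hs
  have := heq hs
  rw [hc0] at this
  exact sub_eq_zero.1 this

end IsSolution

/-! ### Coefficients in the layers -/

/-- The coefficient, up to the factor `m + 1`, of `z̄ ^ (m + 1)` in the expansion at the origin of
the Newtonian potential of `f`. -/
noncomputable def moment (f : ℂ → ℂ) (m : ℕ) : ℂ :=
  -(1 / (4 * (π : ℂ))) * ∫ z, f z * ((conj z) ^ (m + 1))⁻¹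

/-- The dispersion factor of the three layer problem. -/
noncomputable def dispersion (c e : ℂ) (τ : ℝ) : ℂ := (1 + e) * (e + c) + (1 - e) * (e - c) * τ

lemma sourceFunctional_eq_zero {f : ℂ → ℂ} {I U : Set ℝ} (hf : ∀ z, f z ≠ 0 → Complex.normSq z ∈ I)
    (hU : Disjoint I U) (m : ℕ) {h : ℝ → ℂ} (hh : IsBumpOn U h) : sourceFunctional f m h = 0 := by
  have : ∀ z, f z * (h (Complex.normSq z) * z ^ (m + 1)) = 0 := fun z => by
    by_cases hz : f z = 0
    · rw [hz, zero_mul]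
    · rw [hh.eq_zero (disjoint_left.1 hU (hf z hz)), zero_mul, mul_zero]
  simp only [sourceFunctional, this, integral_zero, mul_zero]

/-- On the support of `f` the cutoff is `1`, and `|z|^(-2(m+1)) z^(m+1) = z̄^(-(m+1))`. -/
lemma sourceFunctional_cutoff {f : ℂ → ℂ} {R T : ℝ} (hR : 0 < R)
    (hf : ∀ z, f z ≠ 0 → Complex.normSq z ∈ Icc R T) (m : ℕ) {g : ℝ → ℂ}
    (hg : ∀ s ∈ Icc R T, g s = 1) :
    sourceFunctional f m (fun s => g s * ((s : ℂ) ^ (m + 1))⁻¹) = 2 * moment f m := by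
  have : ∀ z, f z * (g (Complex.normSq z) * ((Complex.normSq z : ℂ) ^ (m + 1))⁻¹ * z ^ (m + 1)) =
      f z * ((conj z) ^ (m + 1))⁻¹ := fun z => by
    by_cases hz : f z = 0
    · rw [hz, zero_mul, zero_mul]
    · have h1 := hf z hz
      have hz0 : z ≠ 0 := by
        rintro rfl
        simp only [map_zero] at h1
        exact absurd h1.1 (not_le.2 hR)
      have hzc : conj z ≠ 0 := by simpa using hz0
      rw [hg _ h1, ← Complex.mul_conj, mul_pow]
      field_simp
  simp only [sourceFunctional, moment, this]
  ring

lemma dispersion_relations {c e as bs β X Y : ℂ} {τ : ℝ} (hY : Y ≠ 0) (hec : e + c ≠ 0)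
    (hτ : X = τ * Y) (h1 : (e + c) * as = -((e - c) * X * bs))
    (h2 : 2 * Y * β = (1 + e) * Y * bs + (e - 1) * as) :
    dispersion c e τ * bs = 2 * β * (e + c) ∧
      dispersion c e τ * as = -(2 * β * X * (e - c)) := by
  have hb : dispersion c e τ * bs = 2 * β * (e + c) := by
    refine mul_left_cancel₀ hY ?_
    unfold dispersion
    linear_combination (-(e + c)) * h2 - (e - 1) * h1 - (1 - e) * (e - c) * bs * hτ
  refine ⟨hb, mul_left_cancel₀ hec ?_⟩
  linear_combination dispersion c e τ * h1 - (e - c) * X * hb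

lemma shell_add_ne_zero (εc εs : ℝ) {δ : ℝ} (hδ : 0 < δ) :
    (εs : ℂ) + Complex.I * δ + (εc : ℂ) ≠ 0 := by
  intro h
  have := congrArg Complex.im h
  simp at this
  exact hδ.ne' this

/-- The coefficients of the mode of index `m + 1` in the shell and outside. -/
structure LayerCoeffs (ri re εc εs δ R : ℝ) (f V p q : ℂ → ℂ) (m : ℕ) (as bs ae : ℂ) : Prop where
  shell : ConstOn m (modeA (gradZ p q) m) (modeB (gradZbar p q) m) (modeV V m)
    (Ioo (ri ^ 2) (re ^ 2)) as bs
  exterior : ConstOn m (modeA (gradZ p q) m) (modeB (gradZbar p q) m) (modeV V m)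
    (Ioo (re ^ 2) R) ae (moment f m)
  bs_eq : dispersion εc (εs + Complex.I * δ) ((ri / re) ^ (2 * (m + 1))) * bs =
    2 * moment f m * (εs + Complex.I * δ + εc)
  as_eq : dispersion εc (εs + Complex.I * δ) ((ri / re) ^ (2 * (m + 1))) * as =
    -(2 * moment f m * ((ri ^ (2 * (m + 1)) : ℝ) : ℂ) * (εs + Complex.I * δ - εc))
  ae_eq : ae = ((re ^ (2 * (m + 1)) : ℝ) : ℂ) * moment f m - ((re ^ (2 * (m + 1)) : ℝ) : ℂ) * bs + as

theorem IsSolution.exists_layerCoeffs {ri re εc εs δ R T : ℝ} {f V p q : ℂ → ℂ} (hri : 0 < ri)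
    (hre : ri < re) (hεc : 0 < εc) (hδ : 0 < δ) (hR : re ^ 2 < R) (hT : R < T)
    (hf : ∀ z, f z ≠ 0 → Complex.normSq z ∈ Icc R T)
    (hs : IsSolution ri re εc εs δ f V p q) (m : ℕ) :
    ∃ as bs ae, LayerCoeffs ri re εc εs δ R f V p q m as bs ae := by
  have hre0 := hri.trans hre
  have hσ : ri ^ 2 < re ^ 2 := pow_lt_pow_left₀ hre hri.le two_ne_zero
  obtain ⟨as, bs, ae, h1, h2, h3, h4, h5⟩ := (hs.radialSystem hri hre m).three_layers
    (pow_pos hri 2) hσ hR hT (by exact_mod_cast hεc.ne') (shell_ne_zero εs hδ)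
    (radialPermittivity_core εc εs δ) (radialPermittivity_shell εc εs δ)
    (radialPermittivity_exterior hri hre εc εs δ)
    (fun h hh => sourceFunctional_eq_zero hf
      (disjoint_left.2 fun s hs hs' => absurd hs.1 (not_le.2 hs'.2)) m hh)
    (fun h hh => sourceFunctional_eq_zero hf
      (disjoint_left.2 fun s hs hs' => absurd hs.2 (not_le.2 hs')) m hh)
    (fun g _ hg1 => sourceFunctional_cutoff ((pow_pos hre0 2).trans hR) hf m hg1)
  have eX : ((ri ^ 2 : ℝ) : ℂ) ^ (m + 1) = ((ri ^ (2 * (m + 1)) : ℝ) : ℂ) := by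
    rw [pow_mul]; push_cast; rfl
  have eY : ((re ^ 2 : ℝ) : ℂ) ^ (m + 1) = ((re ^ (2 * (m + 1)) : ℝ) : ℂ) := by
    rw [pow_mul]; push_cast; rfl
  rw [eX] at h3
  rw [eY] at h4 h5
  have hY : (re ^ (2 * (m + 1)) : ℝ) ≠ 0 := (pow_pos hre0 _).ne'
  have hτ : ((ri ^ (2 * (m + 1)) : ℝ) : ℂ) =
      (((ri / re) ^ (2 * (m + 1)) : ℝ) : ℂ) * ((re ^ (2 * (m + 1)) : ℝ) : ℂ) := by
    rw [← Complex.ofReal_mul, div_pow, div_mul_cancel₀ _ hY]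
  obtain ⟨h6, h7⟩ := dispersion_relations (by exact_mod_cast hY) (shell_add_ne_zero εc εs hδ) hτ h3 h4
  exact ⟨as, bs, ae, h1, h2, h6, h7, h5⟩

/-! ### The dissipated energy as a sum over modes -/

/-- The energy dissipated by a mode of index `m + 1` with coefficients `as`, `bs` in the shell. -/
noncomputable def modeEnergy (ri re δ : ℝ) (m : ℕ) (as bs : ℂ) : ℝ :=
  2 * π * δ / (m + 1) * ((re ^ (2 * (m + 1)) - ri ^ (2 * (m + 1))) *
    (‖bs‖ ^ 2 + ‖as‖ ^ 2 / (ri ^ (2 * (m + 1)) * re ^ (2 * (m + 1)))))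

lemma enorm_sq_eq_ofReal (w : ℂ) : ‖w‖ₑ ^ 2 = ENNReal.ofReal (‖w‖ ^ 2) := by
  rw [ENNReal.ofReal_pow (norm_nonneg _), ofReal_norm]

lemma setLIntegral_ofReal_eq_of_hasDerivAt {α β : ℝ} (hαβ : α ≤ β) {u v : ℝ → ℝ}
    (hv : ∀ s ∈ Icc α β, HasDerivAt v (u s) s) (hu : ContinuousOn u (Icc α β))
    (h0 : ∀ s ∈ Icc α β, 0 ≤ u s) :
    ∫⁻ s in Ioo α β, ENNReal.ofReal (u s) = ENNReal.ofReal (v β - v α) := by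
  have hint : IntegrableOn u (Icc α β) := hu.integrableOn_Icc
  rw [← ofReal_integral_eq_lintegral_ofReal (hint.mono_set Ioo_subset_Icc_self)]
  · congr 1
    rw [← integral_Ioc_eq_integral_Ioo, ← intervalIntegral.integral_of_le hαβ]
    refine intervalIntegral.integral_eq_sub_of_hasDerivAt (fun s hs => hv s ?_) ?_
    · rwa [uIcc_of_le hαβ] at hs
    · exact (uIcc_of_le hαβ ▸ hu).intervalIntegrable
  · rw [EventuallyLE, ae_restrict_iff' measurableSet_Ioo]
    exact ae_of_all _ fun s hs => h0 s (Ioo_subset_Icc_self hs)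

lemma lintegral_modeB {B : ℂ → ℂ} {α β : ℝ} (hα : 0 < α) (hαβ : α ≤ β) (m : ℕ) {c : ℂ}
    (h : ∀ᵐ s, s ∈ Ioo α β → modeB B m s = c) :
    ∫⁻ s in Ico α β, ‖mode B (-(m : ℤ)) s‖ₑ ^ 2 =
      ENNReal.ofReal (‖c‖ ^ 2 * ((β ^ (m + 1) - α ^ (m + 1)) / (m + 1))) := by
  rw [setLIntegral_congr Ioo_ae_eq_Ico.symm]
  have h1 : ∫⁻ s in Ioo α β, ‖mode B (-(m : ℤ)) s‖ₑ ^ 2 =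
      ∫⁻ s in Ioo α β, ENNReal.ofReal (‖c‖ ^ 2 * s ^ m) := by
    refine setLIntegral_congr_fun_ae measurableSet_Ioo ?_
    filter_upwards [h] with s hs hs'
    have hs0 : 0 < s := hα.trans hs'.1
    have e := hs hs'
    have h2 := sqrt_ne_zero_complex hs0
    have e2 : mode B (-(m : ℤ)) s = ((√s : ℝ) : ℂ) ^ m * c := by
      rw [← e, modeB, mul_inv_cancel_left₀ (pow_ne_zero _ h2)]
    rw [e2, enorm_sq_eq_ofReal, norm_mul, norm_pow, Complex.norm_real,
      Real.norm_of_nonneg (Real.sqrt_nonneg s), mul_pow, ← pow_mul, mul_comm m, pow_mul,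
      Real.sq_sqrt hs0.le, mul_comm]
  rw [h1, setLIntegral_ofReal_eq_of_hasDerivAt hαβ
    (v := fun s => ‖c‖ ^ 2 * (s ^ (m + 1) / (m + 1)))]
  · congr 1
    ring
  · intro s _
    have := ((hasDerivAt_pow (m + 1) s).div_const ((m : ℝ) + 1)).const_mul (‖c‖ ^ 2)
    refine this.congr_deriv ?_
    have : (m : ℝ) + 1 ≠ 0 := by positivity
    push_cast
    field_simp
  · fun_prop
  · intro s hs
    have : 0 < s := hα.trans_le hs.1
    positivity

lemma lintegral_modeA {A : ℂ → ℂ} {α β : ℝ} (hα : 0 < α) (hαβ : α ≤ β) (m : ℕ) {c : ℂ}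
    (h : ∀ᵐ s, s ∈ Ioo α β → modeA A m s = c) :
    ∫⁻ s in Ico α β, ‖mode A (-((m + 2 : ℕ) : ℤ)) s‖ₑ ^ 2 =
      ENNReal.ofReal (‖c‖ ^ 2 * (((α ^ (m + 1))⁻¹ - (β ^ (m + 1))⁻¹) / (m + 1))) := by
  rw [setLIntegral_congr Ioo_ae_eq_Ico.symm]
  have h1 : ∫⁻ s in Ioo α β, ‖mode A (-((m + 2 : ℕ) : ℤ)) s‖ₑ ^ 2 =
      ∫⁻ s in Ioo α β, ENNReal.ofReal (‖c‖ ^ 2 * (s ^ (m + 2))⁻¹) := by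
    refine setLIntegral_congr_fun_ae measurableSet_Ioo ?_
    filter_upwards [h] with s hs hs'
    have hs0 : 0 < s := hα.trans hs'.1
    have e := hs hs'
    have h2 := sqrt_ne_zero_complex hs0
    have e2 : mode A (-((m + 2 : ℕ) : ℤ)) s = (((√s : ℝ) : ℂ) ^ (m + 2))⁻¹ * c := by
      rw [← e, modeA, inv_mul_cancel_left₀ (pow_ne_zero _ h2)]
    rw [e2, enorm_sq_eq_ofReal, norm_mul, norm_inv, norm_pow, Complex.norm_real,
      Real.norm_of_nonneg (Real.sqrt_nonneg s), mul_pow, inv_pow, ← pow_mul, mul_comm (m + 2),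
      pow_mul, Real.sq_sqrt hs0.le, mul_comm]
  rw [h1, setLIntegral_ofReal_eq_of_hasDerivAt hαβ
    (v := fun s => ‖c‖ ^ 2 * (-(s ^ (m + 1))⁻¹ / (m + 1)))]
  · congr 1
    ring
  · intro s hs
    have hs0 : s ≠ 0 := (hα.trans_le hs.1).ne'
    have h1 : HasDerivAt (fun s : ℝ => (s ^ (m + 1))⁻¹) _ s :=
      (hasDerivAt_pow (m + 1) s).inv (pow_ne_zero _ hs0)
    have := (h1.neg.div_const ((m : ℝ) + 1)).const_mul (‖c‖ ^ 2)
    refine this.congr_deriv ?_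
    have : (m : ℝ) + 1 ≠ 0 := by positivity
    push_cast
    field_simp
    ring
  · refine continuousOn_const.mul (ContinuousOn.inv₀ (by fun_prop) fun s hs => ?_)
    exact pow_ne_zero _ (hα.trans_le hs.1).ne'
  · intro s hs
    have : 0 < s := hα.trans_le hs.1
    positivity

lemma norm_sq_add_norm_sq (p q : ℂ → ℂ) (z : ℂ) :
    ‖p z‖ ^ 2 + ‖q z‖ ^ 2 = 2 * (‖gradZ p q z‖ ^ 2 + ‖gradZbar p q z‖ ^ 2) := by
  have h := parallelogram_law_with_norm ℝ (p z) (Complex.I * q z)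
  simp only [norm_mul, Complex.norm_I, one_mul] at h
  simp only [gradZ, gradZbar, norm_div, Complex.norm_ofNat]
  ring_nf at h ⊢
  linarith

lemma shell_eq {ri re : ℝ} (hri : 0 < ri) (hre : ri < re) :
    {x : ℂ | ri ≤ ‖x‖ ∧ ‖x‖ < re} = {z : ℂ | Complex.normSq z ∈ Ico (ri ^ 2) (re ^ 2)} := by
  ext z
  simp only [mem_ofPred_eq, mem_Ico, Complex.normSq_eq_norm_sq]
  rw [pow_le_pow_iff_left₀ hri.le (norm_nonneg z) two_ne_zero,
    pow_lt_pow_iff_left₀ (norm_nonneg z) (hri.trans hre).le two_ne_zero]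

/-- The exceptional index `-1` is where the rotation invariant part of `V` shows up in `∂V/∂z`. -/
lemma tsum_int_eq (u : ℤ → ℝ≥0∞) (h1 : u (-1) = 0) :
    ∑' k : ℤ, u k = (∑' m : ℕ, u m) + ∑' m : ℕ, u (-((m + 2 : ℕ) : ℤ)) := by
  rw [tsum_of_nat_of_neg_add_one ENNReal.summable ENNReal.summable]
  congr 1
  rw [tsum_eq_zero_add' (f := fun n : ℕ => u (-((n : ℤ) + 1))) ENNReal.summable]
  simp only [Nat.cast_zero, zero_add, h1]
  congr 1

/-- Frequency `-(m+1)` of `V` feeds the modes `-(m+2)` of `∂V/∂z` and `-m` of `∂V/∂z̄`; frequency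
`m+1` feeds `m` and `m+2`. Parseval for both derivatives is regrouped accordingly, the frequency
zero of `V` contributing nothing. -/
theorem IsSolution.ofReal_energy {ri re εc εs δ : ℝ} {f V p q : ℂ → ℂ} (hri : 0 < ri)
    (hre : ri < re) (hεc : 0 < εc) (hδ : 0 < δ)
    (hf : ∀ z, Complex.normSq z < re ^ 2 → f z = 0)
    (hs : IsSolution ri re εc εs δ f V p q) {as bs as' bs' : ℕ → ℂ}
    (h : ∀ m, ConstOn m (modeA (gradZ p q) m) (modeB (gradZbar p q) m) (modeV V m)
      (Ioo (ri ^ 2) (re ^ 2)) (as m) (bs m))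
    (h' : ∀ m, ConstOn m (modeA (fun z => gradZbar p q (conj z)) m)
      (modeB (fun z => gradZ p q (conj z)) m) (modeV (fun z => V (conj z)) m)
      (Ioo (ri ^ 2) (re ^ 2)) (as' m) (bs' m)) :
    ENNReal.ofReal (energy ri re δ p q) =
      ∑' m, (ENNReal.ofReal (modeEnergy ri re δ m (as m) (bs m)) +
        ENNReal.ofReal (modeEnergy ri re δ m (as' m) (bs' m))) := by
  have hσ₁ : 0 < ri ^ 2 := pow_pos hri 2
  have hσ : ri ^ 2 < re ^ 2 := pow_lt_pow_left₀ hre hri.le two_ne_zero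
  have hIco : Ico (ri ^ 2) (re ^ 2) ⊆ Ioi 0 := fun s hs => hσ₁.trans_le hs.1
  have hball : {z : ℂ | Complex.normSq z ∈ Ico (ri ^ 2) (re ^ 2)} ⊆ Metric.closedBall 0 re := by
    intro z hz
    rw [← shell_eq hri hre] at hz
    rw [Metric.mem_closedBall, dist_zero_right]
    exact hz.2.le
  have mA := (hs.grad.memLp_gradZ (isCompact_closedBall (0 : ℂ) re)).mono_measure
    (Measure.restrict_mono hball le_rfl)
  have mB := (hs.grad.memLp_gradZbar (isCompact_closedBall (0 : ℂ) re)).mono_measure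
    (Measure.restrict_mono hball le_rfl)
  have iA := (memLp_two_iff_integrable_sq_norm mA.1).1 mA
  have iB := (memLp_two_iff_integrable_sq_norm mB.1).1 mB
  have e1 : ENNReal.ofReal (energy ri re δ p q) = ENNReal.ofReal (2 * δ) *
      ((∫⁻ z in {z : ℂ | Complex.normSq z ∈ Ico (ri ^ 2) (re ^ 2)}, ‖gradZ p q z‖ₑ ^ 2) +
        ∫⁻ z in {z : ℂ | Complex.normSq z ∈ Ico (ri ^ 2) (re ^ 2)}, ‖gradZbar p q z‖ₑ ^ 2) := by
    have e0 : energy ri re δ p q = 2 * δ *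
        ∫ z in {z : ℂ | Complex.normSq z ∈ Ico (ri ^ 2) (re ^ 2)},
          (‖gradZ p q z‖ ^ 2 + ‖gradZbar p q z‖ ^ 2) := by
      rw [energy, shell_eq hri hre, ← integral_const_mul]
      congr 1
      ext z
      rw [norm_sq_add_norm_sq]
      ring
    have hAB : Integrable (fun z => ‖gradZ p q z‖ ^ 2 + ‖gradZbar p q z‖ ^ 2)
      (volume.restrict {z : ℂ | Complex.normSq z ∈ Ico (ri ^ 2) (re ^ 2)}) := iA.add iB
    rw [e0, ENNReal.ofReal_mul (by positivity), ofReal_integral_eq_lintegral_ofReal hAB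
      (ae_of_all _ fun z => by positivity), ← lintegral_add_left' (mA.1.enorm.pow_const 2)]
    congr 1
    refine lintegral_congr fun z => ?_
    rw [enorm_sq_eq_ofReal, enorm_sq_eq_ofReal, ENNReal.ofReal_add (by positivity) (by positivity)]
  have zA : ∫⁻ s in Ico (ri ^ 2) (re ^ 2), ‖mode (gradZ p q) (-1) s‖ₑ ^ 2 = 0 := by
    rw [setLIntegral_congr Ioo_ae_eq_Ico.symm]
    refine (setLIntegral_congr_fun_ae (g := 0) measurableSet_Ioo ?_).trans (by simp)
    filter_upwards [hs.mode_gradZ_neg_one_eq_zero hri hre hεc hδ hf] with s h1 h2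
    rw [h1 ⟨hσ₁.trans h2.1, h2.2⟩]
    simp
  have zB : ∫⁻ s in Ico (ri ^ 2) (re ^ 2), ‖mode (gradZbar p q) (- -1) s‖ₑ ^ 2 = 0 := by
    rw [← zA]
    refine setLIntegral_congr_fun_ae measurableSet_Ico ?_
    filter_upwards [hs.mode_gradZbar_one] with s h1 h2
    rw [neg_neg, h1 (hIco h2)]
  have fA : ∑' k : ℤ, ∫⁻ s in Ico (ri ^ 2) (re ^ 2), ‖mode (gradZ p q) k s‖ₑ ^ 2 =
      (∑' m : ℕ, ENNReal.ofReal (‖bs' m‖ ^ 2 *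
        (((re ^ 2) ^ (m + 1) - (ri ^ 2) ^ (m + 1)) / (m + 1)))) +
      ∑' m : ℕ, ENNReal.ofReal (‖as m‖ ^ 2 *
        ((((ri ^ 2) ^ (m + 1))⁻¹ - ((re ^ 2) ^ (m + 1))⁻¹) / (m + 1))) := by
    rw [tsum_int_eq _ zA]
    congr 2
    · ext m
      rw [← lintegral_modeB hσ₁ hσ.le m (h' m).b_eq]
      simp only [mode_comp_conj, neg_neg]
    · ext m
      rw [← lintegral_modeA hσ₁ hσ.le m (h m).a_eq]
  have fB : ∑' k : ℤ, ∫⁻ s in Ico (ri ^ 2) (re ^ 2), ‖mode (gradZbar p q) k s‖ₑ ^ 2 =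
      (∑' m : ℕ, ENNReal.ofReal (‖bs m‖ ^ 2 *
        (((re ^ 2) ^ (m + 1) - (ri ^ 2) ^ (m + 1)) / (m + 1)))) +
      ∑' m : ℕ, ENNReal.ofReal (‖as' m‖ ^ 2 *
        ((((ri ^ 2) ^ (m + 1))⁻¹ - ((re ^ 2) ^ (m + 1))⁻¹) / (m + 1))) := by
    -- For `∂V/∂z̄` the exceptional index is `+1`, so the sum is reflected first.
    rw [← (Equiv.neg ℤ).tsum_eq, tsum_int_eq _ zB]
    congr 2
    · ext m
      rw [← lintegral_modeB hσ₁ hσ.le m (h m).b_eq]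
      rfl
    · ext m
      rw [← lintegral_modeA hσ₁ hσ.le m (h' m).a_eq]
      simp only [mode_comp_conj, Equiv.neg_apply]
  have hmode : ∀ (m : ℕ) (a b : ℂ), ENNReal.ofReal (modeEnergy ri re δ m a b) =
      ENNReal.ofReal (2 * δ) * (ENNReal.ofReal π *
        (ENNReal.ofReal (‖b‖ ^ 2 * (((re ^ 2) ^ (m + 1) - (ri ^ 2) ^ (m + 1)) / (m + 1))) +
        ENNReal.ofReal (‖a‖ ^ 2 *
          ((((ri ^ 2) ^ (m + 1))⁻¹ - ((re ^ 2) ^ (m + 1))⁻¹) / (m + 1))))) := by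
    intro m a b
    have hX : 0 < (ri ^ 2) ^ (m + 1) := pow_pos hσ₁ _
    have hXY : (ri ^ 2) ^ (m + 1) < (re ^ 2) ^ (m + 1) :=
      pow_lt_pow_left₀ hσ hσ₁.le (Nat.succ_ne_zero m)
    have hY := hX.trans hXY
    have hinv : ((re ^ 2) ^ (m + 1))⁻¹ ≤ ((ri ^ 2) ^ (m + 1))⁻¹ := inv_anti₀ hX hXY.le
    rw [← ENNReal.ofReal_add, ← ENNReal.ofReal_mul Real.pi_pos.le,
      ← ENNReal.ofReal_mul (by positivity)]
    · congr 1
      unfold modeEnergy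
      rw [pow_mul, pow_mul]
      generalize (ri ^ 2) ^ (m + 1) = X at *
      generalize (re ^ 2) ^ (m + 1) = Y at *
      have hm : (m : ℝ) + 1 ≠ 0 := by positivity
      field_simp
    · exact mul_nonneg (by positivity) (div_nonneg (by linarith) (by positivity))
    · exact mul_nonneg (by positivity) (div_nonneg (by linarith) (by positivity))
  simp only [hmode]
  rw [e1, lintegral_annulus_eq_tsum_mode measurableSet_Ico hIco mA,
    lintegral_annulus_eq_tsum_mode measurableSet_Ico hIco mB, fA, fB]
  simp only [← mul_add]
  rw [ENNReal.tsum_mul_left, ENNReal.tsum_mul_left, ENNReal.tsum_add, ENNReal.tsum_add,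
    ENNReal.tsum_add]
  congr 2
  ring

/-! ### Estimates of the dispersion factor -/

/-- The real part controls `δ² + τ`. The missing term `δ` comes from the imaginary part when `τ` is
small, and from `δ ≤ τ/τ₀ + δ²` otherwise. -/
lemma exists_norm_lower_bound {κ c₀ : ℝ} (hκ : 0 < κ) (hc₀ : c₀ ≠ 0) (c₁ : ℝ) :
    ∃ c > 0, ∀ (δ τ : ℝ) (D : ℂ), 0 < δ → 0 < τ → κ * (δ ^ 2 + τ) ≤ |D.re| →
      D.im = δ * (c₀ + τ * c₁) → c * (δ + δ ^ 2 + τ) ≤ ‖D‖ := by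
  have hc : 0 < |c₀| := abs_pos.2 hc₀
  have hc1 : 0 ≤ |c₁| := abs_nonneg c₁
  -- Below this threshold `|τ c₁| ≤ |c₀|/2`, so the imaginary part cannot cancel.
  set τ₀ : ℝ := |c₀| / (2 * (|c₁| + 1)) with hτ₀
  have hτ₀pos : 0 < τ₀ := by positivity
  have hpos1 : 0 < min κ (|c₀| / 2) / 2 := by positivity
  have hpos2 : 0 < κ / (2 + 1 / τ₀) := by positivity
  refine ⟨min (min κ (|c₀| / 2) / 2) (κ / (2 + 1 / τ₀)), lt_min hpos1 hpos2,
    fun δ τ D hδ hτ hre him => ?_⟩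
  have hD1 : κ * (δ ^ 2 + τ) ≤ ‖D‖ := hre.trans (Complex.abs_re_le_norm D)
  have hsum : 0 < δ + δ ^ 2 + τ := by positivity
  rcases le_or_gt τ τ₀ with hle | hgt
  · have h1 : |c₀| / 2 ≤ |c₀ + τ * c₁| := by
      have h2 : τ * |c₁| ≤ |c₀| / 2 := by
        calc τ * |c₁| ≤ τ₀ * (|c₁| + 1) := by
              exact mul_le_mul hle (by linarith) hc1 hτ₀pos.le
          _ = |c₀| / 2 := by rw [hτ₀]; field_simp
      have h3 : |c₀| ≤ |c₀ + τ * c₁| + |τ * c₁| := by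
        have := abs_add_le (c₀ + τ * c₁) (-(τ * c₁))
        rw [abs_neg] at this
        simpa using this
      rw [abs_mul, abs_of_pos hτ] at h3
      linarith
    have h4 : δ * (|c₀| / 2) ≤ ‖D‖ := by
      refine le_trans ?_ (Complex.abs_im_le_norm D)
      rw [him, abs_mul, abs_of_pos hδ]
      exact mul_le_mul_of_nonneg_left h1 hδ.le
    have h5 : min κ (|c₀| / 2) * δ ≤ ‖D‖ := by
      refine le_trans ?_ h4
      rw [mul_comm]
      exact mul_le_mul_of_nonneg_left (min_le_right _ _) hδ.le
    have h6 : min κ (|c₀| / 2) * (δ ^ 2 + τ) ≤ ‖D‖ :=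
      (mul_le_mul_of_nonneg_right (min_le_left _ _) (by positivity)).trans hD1
    calc _ ≤ min κ (|c₀| / 2) / 2 * (δ + δ ^ 2 + τ) :=
          mul_le_mul_of_nonneg_right (min_le_left _ _) hsum.le
      _ ≤ ‖D‖ := by linarith
  · have h1 : δ ≤ τ / τ₀ + δ ^ 2 := by
      have : 1 ≤ τ / τ₀ := (one_le_div hτ₀pos).2 hgt.le
      nlinarith [sq_nonneg (δ - 1)]
    have h2 : δ + δ ^ 2 + τ ≤ (2 + 1 / τ₀) * (δ ^ 2 + τ) := by
      have : 0 ≤ 1 / τ₀ * δ ^ 2 := by positivity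
      have e : τ / τ₀ = 1 / τ₀ * τ := by ring
      rw [e] at h1
      nlinarith
    calc _ ≤ κ / (2 + 1 / τ₀) * (δ + δ ^ 2 + τ) :=
          mul_le_mul_of_nonneg_right (min_le_right _ _) hsum.le
      _ ≤ κ / (2 + 1 / τ₀) * ((2 + 1 / τ₀) * (δ ^ 2 + τ)) :=
          mul_le_mul_of_nonneg_left h2 hpos2.le
      _ = κ * (δ ^ 2 + τ) := by field_simp
      _ ≤ ‖D‖ := hD1

lemma abs_re_lower_bound {τ₁ μ δ τ : ℝ} (hτ : 0 < τ) (hττ : τ ≤ τ₁) :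
    min (1 - τ₁) μ * (δ ^ 2 + τ) ≤ |-(δ ^ 2 * (1 - τ) + μ * τ)| := by
  have h0 : 0 ≤ δ ^ 2 := sq_nonneg δ
  rw [abs_neg]
  refine le_trans ?_ (le_abs_self _)
  have h1 : min (1 - τ₁) μ * δ ^ 2 ≤ δ ^ 2 * (1 - τ) := by
    rw [mul_comm]
    exact mul_le_mul_of_nonneg_left ((min_le_left _ _).trans (by linarith)) h0
  have h2 : min (1 - τ₁) μ * τ ≤ μ * τ := mul_le_mul_of_nonneg_right (min_le_right _ _) hτ.le
  linarith

/-- The leading imaginary coefficient is `1 - εc`; at `εc = 1` both interfaces would resonate and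
the term linear in `δ` would be lost. -/
lemma exists_dispersion_core {εc τ₁ : ℝ} (hεc : 0 < εc) (h1 : εc ≠ 1) (hτ₁ : τ₁ < 1) :
    ∃ c > 0, ∀ δ τ : ℝ, 0 < δ → 0 < τ → τ ≤ τ₁ →
      c * (δ + δ ^ 2 + τ) ≤ ‖dispersion εc ((-εc : ℝ) + Complex.I * δ) τ‖ := by
  obtain ⟨c, hc, H⟩ := exists_norm_lower_bound (κ := min (1 - τ₁) (2 * εc * (1 + εc)))
    (c₀ := 1 - εc) (lt_min (by linarith) (by positivity)) (sub_ne_zero.2 h1.symm) (1 + 3 * εc)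
  refine ⟨c, hc, fun δ τ hδ hτ hττ => H δ τ _ hδ hτ ?_ ?_⟩
  · have e : (dispersion εc ((-εc : ℝ) + Complex.I * δ) τ).re =
        -(δ ^ 2 * (1 - τ) + 2 * εc * (1 + εc) * τ) := by
      simp [dispersion]
      ring
    rw [e]
    exact abs_re_lower_bound hτ hττ
  · simp [dispersion]
    ring

lemma exists_dispersion_background {εc τ₁ : ℝ} (hεc : 0 < εc) (h1 : εc ≠ 1) (hτ₁ : τ₁ < 1) :
    ∃ c > 0, ∀ δ τ : ℝ, 0 < δ → 0 < τ → τ ≤ τ₁ →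
      c * (δ + δ ^ 2 + τ) ≤ ‖dispersion εc ((-1 : ℝ) + Complex.I * δ) τ‖ := by
  obtain ⟨c, hc, H⟩ := exists_norm_lower_bound (κ := min (1 - τ₁) (2 * (1 + εc)))
    (c₀ := εc - 1) (lt_min (by linarith) (by positivity)) (sub_ne_zero.2 h1) (3 + εc)
  refine ⟨c, hc, fun δ τ hδ hτ hττ => H δ τ _ hδ hτ ?_ ?_⟩
  · have e : (dispersion εc ((-1 : ℝ) + Complex.I * δ) τ).re =
        -(δ ^ 2 * (1 - τ) + 2 * (1 + εc) * τ) := by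
      simp [dispersion]
      ring
    rw [e]
    exact abs_re_lower_bound hτ hττ
  · simp [dispersion]
    ring

lemma norm_sq_shell_add (εs x δ : ℝ) :
    ‖(εs : ℂ) + Complex.I * δ + (x : ℂ)‖ ^ 2 = (εs + x) ^ 2 + δ ^ 2 := by
  rw [← Complex.normSq_eq_norm_sq, Complex.normSq_apply]
  simp
  ring

lemma norm_sq_shell_sub (εs x δ : ℝ) :
    ‖(εs : ℂ) + Complex.I * δ - (x : ℂ)‖ ^ 2 = (εs - x) ^ 2 + δ ^ 2 := by
  rw [← Complex.normSq_eq_norm_sq, Complex.normSq_apply]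
  simp
  ring

/-- Here `e + c = iδ`, so the first term is only `δ³`; the second is of order `δτ + τδ³`. All are
dominated by cross terms of the square, with no loss in `τ`. -/
lemma core_resonance_bound {εc δ τ : ℝ} (hδ : 0 < δ) (hτ : 0 < τ) (hτ1 : τ ≤ 1) :
    δ * (‖((-εc : ℝ) : ℂ) + Complex.I * δ + (εc : ℂ)‖ ^ 2 +
      τ * ‖((-εc : ℝ) : ℂ) + Complex.I * δ - (εc : ℂ)‖ ^ 2) ≤
      (4 * εc ^ 2 + 2) * (δ + δ ^ 2 + τ) ^ 2 := by
  rw [norm_sq_shell_add, norm_sq_shell_sub]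
  have e1 : δ * δ ^ 2 ≤ (δ + δ ^ 2 + τ) ^ 2 := by
    nlinarith [mul_pos hδ hτ, mul_pos hτ (pow_pos hδ 2), pow_pos hδ 2, pow_pos hτ 2, pow_pos hδ 3, pow_pos hδ 4]
  have e2 : δ * τ ≤ (δ + δ ^ 2 + τ) ^ 2 := by
    nlinarith [mul_pos hδ hτ, mul_pos hτ (pow_pos hδ 2), pow_pos hδ 2, pow_pos hτ 2, pow_pos hδ 3, pow_pos hδ 4]
  have e3 : τ * (δ * δ ^ 2) ≤ δ * δ ^ 2 := by
    have : 0 ≤ δ * δ ^ 2 := by positivity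
    nlinarith
  have e4 : 4 * εc ^ 2 * (δ * τ) ≤ 4 * εc ^ 2 * (δ + δ ^ 2 + τ) ^ 2 :=
    mul_le_mul_of_nonneg_left e2 (by positivity)
  nlinarith

/-- Now `e + c` stays away from zero, and the term of order `δ` is dominated only after
multiplication by `τ`. This loss is the origin of the critical radius. -/
lemma background_resonance_bound {εc δ τ : ℝ} (hδ : 0 < δ) (hτ : 0 < τ) (hτ1 : τ ≤ 1) :
    δ * (‖((-1 : ℝ) : ℂ) + Complex.I * δ + (εc : ℂ)‖ ^ 2 +
      τ * ‖((-1 : ℝ) : ℂ) + Complex.I * δ - (εc : ℂ)‖ ^ 2) * τ ≤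
      ((εc - 1) ^ 2 + (εc + 1) ^ 2 + 2) * (δ + δ ^ 2 + τ) ^ 2 := by
  rw [norm_sq_shell_add, norm_sq_shell_sub]
  have e1 : δ * δ ^ 2 ≤ (δ + δ ^ 2 + τ) ^ 2 := by
    nlinarith [mul_pos hδ hτ, mul_pos hτ (pow_pos hδ 2), pow_pos hδ 2, pow_pos hτ 2, pow_pos hδ 3, pow_pos hδ 4]
  have e2 : δ * τ ≤ (δ + δ ^ 2 + τ) ^ 2 := by
    nlinarith [mul_pos hδ hτ, mul_pos hτ (pow_pos hδ 2), pow_pos hδ 2, pow_pos hτ 2, pow_pos hδ 3, pow_pos hδ 4]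
  have p3 : 0 < δ * δ ^ 2 := by positivity
  have e3 : τ * (δ * δ ^ 2) ≤ δ * δ ^ 2 := by nlinarith
  have e4 : τ * (τ * (δ * δ ^ 2)) ≤ τ * (δ * δ ^ 2) := by
    have : 0 < τ * (δ * δ ^ 2) := by positivity
    nlinarith
  have e5 : τ * (δ * τ) ≤ δ * τ := by
    have : 0 < δ * τ := by positivity
    nlinarith
  have q1 : (εc - 1) ^ 2 * (δ * τ) ≤ (εc - 1) ^ 2 * (δ + δ ^ 2 + τ) ^ 2 :=
    mul_le_mul_of_nonneg_left e2 (by positivity)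
  have q2 : (εc + 1) ^ 2 * (τ * (δ * τ)) ≤ (εc + 1) ^ 2 * (δ + δ ^ 2 + τ) ^ 2 :=
    mul_le_mul_of_nonneg_left (e5.trans e2) (by positivity)
  nlinarith

lemma norm_dispersion_background_le {εc δ τ : ℝ} (hεc : 0 < εc) (hδ : 0 < δ) (hδ1 : δ ≤ 1)
    (hτ : 0 < τ) : ‖dispersion εc ((-1 : ℝ) + Complex.I * δ) τ‖ ≤ (3 * εc + 6) * (δ + τ) := by
  have hδn : ‖Complex.I * (δ : ℂ)‖ = δ := by
    rw [norm_mul, Complex.norm_I, one_mul, Complex.norm_real, Real.norm_of_nonneg hδ.le]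
  have hεn : ‖(εc : ℂ)‖ = εc := by rw [Complex.norm_real, Real.norm_of_nonneg hεc.le]
  have e : dispersion εc ((-1 : ℝ) + Complex.I * δ) τ =
      Complex.I * δ * (Complex.I * δ + εc - 1) + (2 - Complex.I * δ) * (Complex.I * δ - εc - 1) * τ := by
    simp only [dispersion]
    push_cast
    ring
  have h1 : ‖Complex.I * (δ : ℂ) + εc - 1‖ ≤ δ + εc + 1 := by
    refine (norm_sub_le _ _).trans ?_
    rw [norm_one]
    have := norm_add_le (Complex.I * (δ : ℂ)) εc
    rw [hδn, hεn] at this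
    linarith
  have h2 : ‖(2 : ℂ) - Complex.I * δ‖ ≤ 2 + δ := by
    refine (norm_sub_le _ _).trans ?_
    rw [hδn, Complex.norm_ofNat]
  have h3 : ‖Complex.I * (δ : ℂ) - εc - 1‖ ≤ δ + εc + 1 := by
    refine (norm_sub_le _ _).trans ?_
    rw [norm_one]
    have := norm_sub_le (Complex.I * (δ : ℂ)) εc
    rw [hδn, hεn] at this
    linarith
  rw [e]
  refine (norm_add_le _ _).trans ?_
  rw [norm_mul, hδn, norm_mul, norm_mul, Complex.norm_real, Real.norm_of_nonneg hτ.le]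
  have h4 : ‖(2 : ℂ) - Complex.I * δ‖ * ‖Complex.I * (δ : ℂ) - εc - 1‖ ≤ 3 * (εc + 2) :=
    mul_le_mul (h2.trans (by linarith)) (h3.trans (by linarith)) (norm_nonneg _) (by norm_num)
  have h5 : δ * ‖Complex.I * (δ : ℂ) + εc - 1‖ ≤ δ * (3 * εc + 6) :=
    mul_le_mul_of_nonneg_left (h1.trans (by linarith)) hδ.le
  have h6 := mul_le_mul_of_nonneg_right h4 hτ.le
  nlinarith

/-! ### Estimates of the coefficients -/

namespace LayerCoeffs

variable {ri re εc εs δ R : ℝ} {f V p q : ℂ → ℂ} {m : ℕ} {as bs ae : ℂ}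

lemma modeEnergy_le (hri : 0 < ri) (hre : ri < re) (hδ : 0 < δ)
    (h : LayerCoeffs ri re εc εs δ R f V p q m as bs ae) {K : ℝ}
    (hD : 0 < ‖dispersion εc (εs + Complex.I * δ) ((ri / re) ^ (2 * (m + 1)))‖)
    (hK : δ * (‖(εs : ℂ) + Complex.I * δ + (εc : ℂ)‖ ^ 2 +
      (ri / re) ^ (2 * (m + 1)) * ‖(εs : ℂ) + Complex.I * δ - (εc : ℂ)‖ ^ 2) ≤
      K * ‖dispersion εc (εs + Complex.I * δ) ((ri / re) ^ (2 * (m + 1)))‖ ^ 2) :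
    modeEnergy ri re δ m as bs ≤ 8 * π * K * (re ^ (2 * (m + 1)) * ‖moment f m‖ ^ 2) := by
  have hre0 := hri.trans hre
  have hb := congrArg norm h.bs_eq
  have ha := congrArg norm h.as_eq
  rw [norm_neg] at ha
  simp only [norm_mul, Complex.norm_ofNat, Complex.norm_real] at ha hb
  have hX : 0 < ri ^ (2 * (m + 1)) := pow_pos hri _
  have hY : 0 < re ^ (2 * (m + 1)) := pow_pos hre0 _
  rw [Real.norm_of_nonneg hX.le] at ha
  rw [div_pow] at hD hK ha hb
  unfold modeEnergy
  generalize ‖dispersion εc (εs + Complex.I * δ) (ri ^ (2 * (m + 1)) / re ^ (2 * (m + 1)))‖ = D at *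
  generalize ri ^ (2 * (m + 1)) = X at *
  generalize re ^ (2 * (m + 1)) = Y at *
  generalize ‖(εs : ℂ) + Complex.I * δ + (εc : ℂ)‖ = P at *
  generalize ‖(εs : ℂ) + Complex.I * δ - (εc : ℂ)‖ = Q at *
  generalize ‖moment f m‖ = β at *
  have hb' : ‖bs‖ ^ 2 = 4 * β ^ 2 * P ^ 2 / D ^ 2 := by
    rw [eq_div_iff (pow_pos hD 2).ne', ← mul_pow, mul_comm, hb]
    ring
  have ha' : ‖as‖ ^ 2 = 4 * β ^ 2 * X ^ 2 * Q ^ 2 / D ^ 2 := by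
    rw [eq_div_iff (pow_pos hD 2).ne', ← mul_pow, mul_comm, ha]
    ring
  have hS : ‖bs‖ ^ 2 + ‖as‖ ^ 2 / (X * Y) = 4 * β ^ 2 * (P ^ 2 + X / Y * Q ^ 2) / D ^ 2 := by
    rw [hb', ha']
    field_simp
  have hS0 : 0 ≤ ‖bs‖ ^ 2 + ‖as‖ ^ 2 / (X * Y) := by positivity
  have h1 : 2 * π * δ / (m + 1) * ((Y - X) * (‖bs‖ ^ 2 + ‖as‖ ^ 2 / (X * Y))) ≤
      2 * π * δ * (Y * (‖bs‖ ^ 2 + ‖as‖ ^ 2 / (X * Y))) := by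
    have hp : 0 ≤ 2 * π * δ := by positivity
    have h3 : 2 * π * δ / (m + 1) ≤ 2 * π * δ := div_le_self hp (by linarith [(Nat.cast_nonneg m : (0:ℝ) ≤ m)])
    refine le_trans (mul_le_mul_of_nonneg_left (mul_le_mul_of_nonneg_right
      (by linarith : Y - X ≤ Y) hS0) (by positivity)) ?_
    exact mul_le_mul_of_nonneg_right h3 (by positivity)
  refine h1.trans ?_
  rw [hS]
  have e : 2 * π * δ * (Y * (4 * β ^ 2 * (P ^ 2 + X / Y * Q ^ 2) / D ^ 2)) =
      8 * π * (Y * β ^ 2) * (δ * (P ^ 2 + X / Y * Q ^ 2) / D ^ 2) := by ring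
  rw [e]
  have h2 : δ * (P ^ 2 + X / Y * Q ^ 2) / D ^ 2 ≤ K := (div_le_iff₀ (pow_pos hD 2)).2 hK
  calc _ ≤ 8 * π * (Y * β ^ 2) * K := mul_le_mul_of_nonneg_left h2 (by positivity)
    _ = _ := by ring

/-- Only the `bs` part of the energy is kept. In it `|e + c|²` is bounded below by `(εs + εc)²`, and
`1 - τ` by its value for the lowest mode. -/
lemma modeEnergy_ge (hri : 0 < ri) (hre : ri < re) (hδ : 0 < δ)
    (h : LayerCoeffs ri re εc εs δ R f V p q m as bs ae) {C : ℝ} (hC : 0 < C)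
    (hD : ‖dispersion εc (εs + Complex.I * δ) ((ri / re) ^ (2 * (m + 1)))‖ ≤
      C * (δ + (ri / re) ^ (2 * (m + 1)))) :
    8 * π * (1 - (ri / re) ^ 2) * (εs + εc) ^ 2 / C ^ 2 *
      (δ / (δ + (ri / re) ^ (2 * (m + 1))) ^ 2 *
        (re ^ (2 * (m + 1)) * ‖moment f m‖ ^ 2 / (m + 1))) ≤ modeEnergy ri re δ m as bs := by
  have hre0 := hri.trans hre
  have hb := congrArg norm h.bs_eq
  simp only [norm_mul, Complex.norm_ofNat] at hb
  have hX : 0 < ri ^ (2 * (m + 1)) := pow_pos hri _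
  have hY : 0 < re ^ (2 * (m + 1)) := pow_pos hre0 _
  have hP := norm_sq_shell_add εs εc δ
  have hτ : 0 < (ri / re) ^ (2 * (m + 1)) := by positivity
  have hτ1 : (ri / re) ^ (2 * (m + 1)) ≤ (ri / re) ^ 2 :=
    pow_le_pow_of_le_one (by positivity) ((div_le_one hre0).2 hre.le) (by omega)
  have hρ : (ri / re) ^ 2 < 1 := pow_lt_one₀ (by positivity) ((div_lt_one hre0).2 hre) two_ne_zero
  have hYX : re ^ (2 * (m + 1)) - ri ^ (2 * (m + 1)) =
      re ^ (2 * (m + 1)) * (1 - (ri / re) ^ (2 * (m + 1))) := by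
    rw [div_pow]; field_simp
  have hDn := norm_nonneg (dispersion εc (εs + Complex.I * δ) ((ri / re) ^ (2 * (m + 1))))
  unfold modeEnergy
  rw [hYX]
  generalize ‖dispersion εc (εs + Complex.I * δ) ((ri / re) ^ (2 * (m + 1)))‖ = D at *
  generalize (ri / re) ^ (2 * (m + 1)) = τ at *
  generalize re ^ (2 * (m + 1)) = Y at *
  generalize ri ^ (2 * (m + 1)) = X at *
  generalize ‖(εs : ℂ) + Complex.I * δ + (εc : ℂ)‖ = P at *
  generalize ‖moment f m‖ = β at *
  generalize (ri / re) ^ 2 = ρ at *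
  have hb' : 4 * β ^ 2 * (εs + εc) ^ 2 ≤ (C * (δ + τ)) ^ 2 * ‖bs‖ ^ 2 := by
    have h1 : (D * ‖bs‖) ^ 2 = 4 * β ^ 2 * P ^ 2 := by rw [hb]; ring
    have hD0 : (D * ‖bs‖) ^ 2 ≤ (C * (δ + τ)) ^ 2 * ‖bs‖ ^ 2 := by
      rw [mul_pow]
      exact mul_le_mul_of_nonneg_right (pow_le_pow_left₀ hDn hD 2) (by positivity)
    rw [h1, hP] at hD0
    nlinarith [sq_nonneg β, sq_nonneg δ, mul_nonneg (sq_nonneg β) (sq_nonneg δ)]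
  have hb'' : 4 * β ^ 2 * (εs + εc) ^ 2 / (C * (δ + τ)) ^ 2 ≤ ‖bs‖ ^ 2 := by
    rw [div_le_iff₀ (by positivity)]
    linarith
  calc _ = 2 * π * δ / (m + 1) * (Y * (1 - ρ) *
        (4 * β ^ 2 * (εs + εc) ^ 2 / (C * (δ + τ)) ^ 2)) := by
        field_simp
        ring
    _ ≤ 2 * π * δ / (m + 1) * (Y * (1 - τ) * (‖bs‖ ^ 2 + ‖as‖ ^ 2 / (X * Y))) := by
        refine mul_le_mul_of_nonneg_left ?_ (by positivity)
        refine mul_le_mul ?_ ?_ (by positivity) (mul_nonneg hY.le (by linarith))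
        · exact mul_le_mul_of_nonneg_left (by linarith) hY.le
        · have : 0 ≤ ‖as‖ ^ 2 / (X * Y) := by positivity
          linarith

/-- The shell amplitude `bs` may be amplified by `1/τ` at resonance, while in `as` the factor `X = τ
re^(2(m+1))` compensates. The amplification `1/τ` of `ae` determines the radius `re³/ri²`. -/
lemma norm_ae_le (hri : 0 < ri) (hre : ri < re)
    (h : LayerCoeffs ri re εc εs δ R f V p q m as bs ae) {K : ℝ} (hK0 : 0 < K)
    (hD : 0 < ‖dispersion εc (εs + Complex.I * δ) ((ri / re) ^ (2 * (m + 1)))‖)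
    (hP : (ri / re) ^ (2 * (m + 1)) * ‖(εs : ℂ) + Complex.I * δ + (εc : ℂ)‖ ≤
      K * ‖dispersion εc (εs + Complex.I * δ) ((ri / re) ^ (2 * (m + 1)))‖)
    (hQ : (ri / re) ^ (2 * (m + 1)) * ‖(εs : ℂ) + Complex.I * δ - (εc : ℂ)‖ ≤
      K * ‖dispersion εc (εs + Complex.I * δ) ((ri / re) ^ (2 * (m + 1)))‖) :
    ‖ae‖ ≤ (1 + 4 * K) * (re ^ (2 * (m + 1)) * ‖moment f m‖ / (ri / re) ^ (2 * (m + 1))) := by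
  have hre0 := hri.trans hre
  have hb := congrArg norm h.bs_eq
  have ha := congrArg norm h.as_eq
  rw [norm_neg] at ha
  simp only [norm_mul, Complex.norm_ofNat, Complex.norm_real] at ha hb
  have hX : 0 < ri ^ (2 * (m + 1)) := pow_pos hri _
  have hY : 0 < re ^ (2 * (m + 1)) := pow_pos hre0 _
  rw [Real.norm_of_nonneg hX.le] at ha
  have hτ : 0 < (ri / re) ^ (2 * (m + 1)) := by positivity
  have hτ1 : (ri / re) ^ (2 * (m + 1)) ≤ 1 :=
    pow_le_one₀ (by positivity) ((div_le_one hre0).2 hre.le)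
  have hXY : ri ^ (2 * (m + 1)) = (ri / re) ^ (2 * (m + 1)) * re ^ (2 * (m + 1)) := by
    rw [div_pow]; field_simp
  have htri : ‖ae‖ ≤ re ^ (2 * (m + 1)) * ‖moment f m‖ + re ^ (2 * (m + 1)) * ‖bs‖ + ‖as‖ := by
    rw [h.ae_eq]
    refine (norm_add_le _ _).trans (add_le_add ((norm_sub_le _ _).trans (le_of_eq ?_)) le_rfl)
    rw [norm_mul, norm_mul, Complex.norm_real, Real.norm_of_nonneg hY.le]
  have hβ := norm_nonneg (moment f m)
  rw [hXY] at ha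
  generalize ‖dispersion εc (εs + Complex.I * δ) ((ri / re) ^ (2 * (m + 1)))‖ = D at *
  generalize (ri / re) ^ (2 * (m + 1)) = τ at *
  generalize re ^ (2 * (m + 1)) = Y at *
  generalize ‖(εs : ℂ) + Complex.I * δ + (εc : ℂ)‖ = P at *
  generalize ‖(εs : ℂ) + Complex.I * δ - (εc : ℂ)‖ = Q at *
  generalize ‖moment f m‖ = β at *
  have h1 : ‖bs‖ ≤ 2 * β * K / τ := by
    rw [le_div_iff₀ hτ]
    refine le_of_mul_le_mul_left ?_ hD
    calc D * (‖bs‖ * τ) = 2 * β * (τ * P) := by rw [← mul_assoc, hb]; ring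
      _ ≤ 2 * β * (K * D) := mul_le_mul_of_nonneg_left hP (by positivity)
      _ = _ := by ring
  have h2 : ‖as‖ ≤ 2 * β * Y * K := by
    refine le_of_mul_le_mul_left ?_ hD
    calc D * ‖as‖ = 2 * β * Y * (τ * Q) := by rw [ha]; ring
      _ ≤ 2 * β * Y * (K * D) := mul_le_mul_of_nonneg_left hQ (by positivity)
      _ = _ := by ring
  have h3 : 2 * β * Y * K ≤ 2 * β * Y * K / τ := le_div_self (by positivity) hτ hτ1
  have h4 : Y * β ≤ Y * β / τ := le_div_self (by positivity) hτ hτ1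
  have h5 : Y * ‖bs‖ ≤ Y * (2 * β * K / τ) := mul_le_mul_of_nonneg_left h1 hY.le
  calc ‖ae‖ ≤ Y * β / τ + Y * (2 * β * K / τ) + 2 * β * Y * K / τ := by linarith
    _ = _ := by ring

end LayerCoeffs

/-! ### The source -/

lemma exists_radius_of_isCompact {K : Set ℂ} (hK : IsCompact K) {c : ℝ}
    (h : K ⊆ {x : ℂ | c < ‖x‖}) : ∃ r, c < r ∧ ∀ z ∈ K, r ≤ ‖z‖ := by
  rcases K.eq_empty_or_nonempty with rfl | hne
  · exact ⟨c + 1, lt_add_one c, fun z hz => absurd hz (notMem_empty z)⟩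
  · obtain ⟨z, hz, hmin⟩ := hK.exists_isMinOn hne continuous_norm.continuousOn
    exact ⟨‖z‖, h hz, fun w hw => hmin hw⟩

namespace IsSource

variable {re : ℝ} {f : ℂ → ℂ}

lemma integrable (hf : IsSource re f) : Integrable f := by
  have h1 : MemLp f 2 (volume.restrict (tsupport f)) := hf.memLp.restrict _
  have : IsFiniteMeasure (volume.restrict (tsupport f)) :=
    ⟨by simpa using hf.compact.isCompact.measure_lt_top⟩
  have h2 : IntegrableOn f (tsupport f) := h1.integrable (by norm_num)
  exact (integrableOn_iff_integrable_of_support_subset (subset_tsupport f)).1 h2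

lemma exists_radii (hf : IsSource re f) {c : ℝ} (hc : tsupport f ⊆ {x : ℂ | c < ‖x‖}) :
    ∃ r T, c < r ∧ r < T ∧ ∀ z, f z ≠ 0 → r ≤ ‖z‖ ∧ ‖z‖ ≤ T := by
  obtain ⟨r, hr, hr'⟩ := exists_radius_of_isCompact hf.compact.isCompact hc
  obtain ⟨T, hT⟩ := hf.compact.isCompact.isBounded.exists_norm_le
  exact ⟨r, max T (r + 1), hr, (lt_add_one r).trans_le (le_max_right _ _), fun z hz =>
    ⟨hr' z (subset_tsupport f hz), (hT z (subset_tsupport f hz)).trans (le_max_left _ _)⟩⟩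

end IsSource

lemma norm_moment_le {f : ℂ → ℂ} {r : ℝ} (hf : Integrable f) (hr : 0 < r)
    (h : ∀ z, f z ≠ 0 → r ≤ ‖z‖) (m : ℕ) :
    ‖moment f m‖ ≤ (∫ z, ‖f z‖) * (r ^ (m + 1))⁻¹ := by
  have h1 : ‖∫ z, f z * ((conj z) ^ (m + 1))⁻¹‖ ≤ ∫ z, ‖f z‖ * (r ^ (m + 1))⁻¹ := by
    refine norm_integral_le_of_norm_le (hf.norm.mul_const _) (ae_of_all _ fun z => ?_)
    rw [norm_mul, norm_inv, norm_pow, RCLike.norm_conj]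
    by_cases hz : f z = 0
    · simp [hz]
    · exact mul_le_mul_of_nonneg_left (inv_anti₀ (pow_pos hr _)
        (pow_le_pow_left₀ hr.le (h z hz) _)) (norm_nonneg _)
  rw [integral_mul_const] at h1
  rw [moment, norm_mul]
  refine (mul_le_of_le_one_left (norm_nonneg _) ?_).trans h1
  rw [norm_neg, norm_div, norm_one, norm_mul, Complex.norm_ofNat, Complex.norm_real,
    Real.norm_of_nonneg Real.pi_pos.le, div_le_one (by positivity)]
  nlinarith [Real.pi_gt_three]

/-! ### Uniform bounds -/

/-- `f` is integrable and supported in the annulus `r ≤ |z| ≤ T`. -/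
structure IsSupportedIn (r T : ℝ) (f : ℂ → ℂ) : Prop where
  integrable : Integrable f
  supp : ∀ z, f z ≠ 0 → r ≤ ‖z‖ ∧ ‖z‖ ≤ T

namespace IsSupportedIn

variable {r T : ℝ} {f : ℂ → ℂ}

lemma comp_conj (h : IsSupportedIn r T f) : IsSupportedIn r T fun z => f (conj z) :=
  ⟨measurePreserving_conj.integrable_comp_of_integrable h.integrable, fun z hz => by
    simpa using h.supp (conj z) hz⟩

lemma normSq_mem (h : IsSupportedIn r T f) (hr : 0 < r) :
    ∀ z, f z ≠ 0 → Complex.normSq z ∈ Icc (r ^ 2) (T ^ 2) := fun z hz => by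
  rw [Complex.normSq_eq_norm_sq]
  exact ⟨pow_le_pow_left₀ hr.le (h.supp z hz).1 2,
    pow_le_pow_left₀ (norm_nonneg z) (h.supp z hz).2 2⟩

lemma eq_zero (h : IsSupportedIn r T f) {re : ℝ} (hre : 0 < re) (hr : re < r) :
    ∀ z, Complex.normSq z < re ^ 2 → f z = 0 := fun z hz => by
  by_contra hn
  have h1 := (h.normSq_mem (hre.trans hr) z hn).1
  have h2 := pow_lt_pow_left₀ hr hre.le two_ne_zero
  linarith

lemma norm_moment_le (h : IsSupportedIn r T f) (hr : 0 < r) (m : ℕ) :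
    ‖moment f m‖ ≤ (∫ z, ‖f z‖) * (r ^ (m + 1))⁻¹ :=
  CALR.norm_moment_le h.integrable hr (fun z hz => (h.supp z hz).1) m

end IsSupportedIn

namespace IsSolution

variable {ri re εc εs δ r T : ℝ} {f V p q V' p' q' : ℂ → ℂ}

lemma exists_layerCoeffs_family (hri : 0 < ri) (hre : ri < re) (hεc : 0 < εc) (hδ : 0 < δ)
    (hr : re < r) (hT : r < T) (hf : IsSupportedIn r T f)
    (hs : IsSolution ri re εc εs δ f V p q) :
    ∃ as bs ae : ℕ → ℂ, ∀ m, LayerCoeffs ri re εc εs δ (r ^ 2) f V p q m (as m) (bs m) (ae m) := by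
  have hre0 := hri.trans hre
  have h := hs.exists_layerCoeffs hri hre hεc hδ (pow_lt_pow_left₀ hr hre0.le two_ne_zero)
    (pow_lt_pow_left₀ hT (hre0.trans hr).le two_ne_zero) (hf.normSq_mem (hre0.trans hr))
  choose as bs ae h using h
  exact ⟨as, bs, ae, h⟩

lemma ofReal_energy_of_layerCoeffs (hri : 0 < ri) (hre : ri < re) (hεc : 0 < εc) (hδ : 0 < δ)
    (hr : re < r) (hf : IsSupportedIn r T f) (hs : IsSolution ri re εc εs δ f V p q)
    {as bs ae as' bs' ae' : ℕ → ℂ}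
    (h : ∀ m, LayerCoeffs ri re εc εs δ (r ^ 2) f V p q m (as m) (bs m) (ae m))
    (h' : ∀ m, LayerCoeffs ri re εc εs δ (r ^ 2) (fun z => f (conj z)) (fun z => V (conj z))
      (fun z => p (conj z)) (fun z => -q (conj z)) m (as' m) (bs' m) (ae' m)) :
    ENNReal.ofReal (energy ri re δ p q) =
      ∑' m, (ENNReal.ofReal (modeEnergy ri re δ m (as m) (bs m)) +
        ENNReal.ofReal (modeEnergy ri re δ m (as' m) (bs' m))) := by
  refine hs.ofReal_energy hri hre hεc hδ (hf.eq_zero (hri.trans hre) hr) (fun m => (h m).shell)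
    fun m => ?_
  have := (h' m).shell
  rwa [gradZ_comp_conj, gradZbar_comp_conj] at this

lemma energy_nonneg (hδ : 0 < δ) : 0 ≤ energy ri re δ p q :=
  integral_nonneg fun z => by positivity

lemma energy_le {C θ : ℝ} (hri : 0 < ri) (hre : ri < re) (hεc : 0 < εc) (hδ : 0 < δ)
    (hr : re < r) (hT : r < T) (hf : IsSupportedIn r T f)
    (hs : IsSolution ri re εc εs δ f V p q) (hC : 0 ≤ C) (hθ0 : 0 ≤ θ) (hθ : θ < 1)
    (h : ∀ m as bs ae, LayerCoeffs ri re εc εs δ (r ^ 2) f V p q m as bs ae →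
      modeEnergy ri re δ m as bs ≤ C * θ ^ m)
    (h' : ∀ m as bs ae, LayerCoeffs ri re εc εs δ (r ^ 2) (fun z => f (conj z))
      (fun z => V (conj z)) (fun z => p (conj z)) (fun z => -q (conj z)) m as bs ae →
      modeEnergy ri re δ m as bs ≤ C * θ ^ m) :
    energy ri re δ p q ≤ 2 * C * (1 - θ)⁻¹ := by
  obtain ⟨as, bs, ae, hL⟩ := hs.exists_layerCoeffs_family hri hre hεc hδ hr hT hf
  obtain ⟨as', bs', ae', hL'⟩ := hs.comp_conj.exists_layerCoeffs_family hri hre hεc hδ hr hT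
    hf.comp_conj
  have e := hs.ofReal_energy_of_layerCoeffs hri hre hεc hδ hr hf hL hL'
  have h1 : ENNReal.ofReal (energy ri re δ p q) ≤ ENNReal.ofReal (2 * C * (1 - θ)⁻¹) := by
    rw [e]
    have hgeo := (hasSum_geometric_of_lt_one hθ0 hθ).mul_left (2 * C)
    rw [← hgeo.tsum_eq, ENNReal.ofReal_tsum_of_nonneg (fun m => by positivity) hgeo.summable]
    refine ENNReal.tsum_le_tsum fun m => ?_
    calc _ ≤ ENNReal.ofReal (C * θ ^ m) + ENNReal.ofReal (C * θ ^ m) :=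
          add_le_add (ENNReal.ofReal_le_ofReal (h m _ _ _ (hL m)))
            (ENNReal.ofReal_le_ofReal (h' m _ _ _ (hL' m)))
      _ = _ := by
          rw [← ENNReal.ofReal_add (by positivity) (by positivity)]
          congr 1
          ring
  exact (ENNReal.ofReal_le_ofReal_iff (mul_nonneg (by positivity)
    (inv_nonneg.2 (by linarith)))).1 h1

lemma exists_modeEnergy_le (hri : 0 < ri) (hre : ri < re) (hεc : 0 < εc) (hδ : 0 < δ)
    (hr : re < r) (hT : r < T) (hf : IsSupportedIn r T f)
    (hs : IsSolution ri re εc εs δ f V p q) (m : ℕ) :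
    (∃ as bs ae, LayerCoeffs ri re εc εs δ (r ^ 2) f V p q m as bs ae ∧
      modeEnergy ri re δ m as bs ≤ energy ri re δ p q) ∧
    ∃ as bs ae, LayerCoeffs ri re εc εs δ (r ^ 2) (fun z => f (conj z))
      (fun z => V (conj z)) (fun z => p (conj z)) (fun z => -q (conj z)) m as bs ae ∧
      modeEnergy ri re δ m as bs ≤ energy ri re δ p q := by
  obtain ⟨as, bs, ae, hL⟩ := hs.exists_layerCoeffs_family hri hre hεc hδ hr hT hf
  obtain ⟨as', bs', ae', hL'⟩ := hs.comp_conj.exists_layerCoeffs_family hri hre hεc hδ hr hT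
    hf.comp_conj
  have e := hs.ofReal_energy_of_layerCoeffs hri hre hεc hδ hr hf hL hL'
  have h1 := ENNReal.le_tsum (f := fun m => ENNReal.ofReal (modeEnergy ri re δ m (as m) (bs m)) +
    ENNReal.ofReal (modeEnergy ri re δ m (as' m) (bs' m))) m
  rw [← e] at h1
  exact ⟨⟨_, _, _, hL m, (ENNReal.ofReal_le_ofReal_iff (energy_nonneg hδ)).1
      (le_self_add.trans h1)⟩,
    ⟨_, _, _, hL' m, (ENNReal.ofReal_le_ofReal_iff (energy_nonneg hδ)).1
      (le_add_self.trans h1)⟩⟩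

end IsSolution

lemma weighted_moment_le {re r T κ : ℝ} {f : ℂ → ℂ} (hre : 0 < re) (hr : re < r) (hκ : 0 < κ)
    (hf : IsSupportedIn r T f) (m : ℕ) :
    re ^ (2 * (m + 1)) * ‖moment f m‖ ^ 2 / κ ^ (2 * (m + 1)) ≤
      (∫ z, ‖f z‖) ^ 2 * ((re / (r * κ)) ^ 2) ^ (m + 1) := by
  have hr0 := hre.trans hr
  have h1 : ‖moment f m‖ ^ 2 ≤ ((∫ z, ‖f z‖) * (r ^ (m + 1))⁻¹) ^ 2 :=
    pow_le_pow_left₀ (norm_nonneg _) (hf.norm_moment_le hr0 m) 2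
  rw [div_le_iff₀ (by positivity)]
  calc _ ≤ re ^ (2 * (m + 1)) * ((∫ z, ‖f z‖) * (r ^ (m + 1))⁻¹) ^ 2 :=
        mul_le_mul_of_nonneg_left h1 (by positivity)
    _ = _ := by
        have e : re / (r * κ) * κ = re * r⁻¹ := by field_simp
        rw [mul_comm 2, pow_mul, pow_mul, ← pow_mul (re / (r * κ)), mul_comm 2,
          pow_mul (re / (r * κ)), mul_pow, mul_assoc, ← mul_pow (_ ^ (m + 1)),
          ← mul_pow (re / (r * κ)), e, mul_pow re, inv_pow]
        ring

/-- The parameter `κ` measures the resonant loss: `1` for the core, `ri/re` for the background. The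
modes sum geometrically with ratio `(re/(rκ))²`, and for `κ = ri/re` the condition `re < rκ` says `r
> re²/ri`. -/
theorem exists_energy_bound {ri re εc εs r T κ c K : ℝ} {f : ℂ → ℂ} (hri : 0 < ri) (hre : ri < re)
    (hεc : 0 < εc) (hr : re < r) (hT : r < T) (hf : IsSupportedIn r T f) (hκ : 0 < κ)
    (hrκ : re < r * κ) (hc : 0 < c) (hK : 0 ≤ K)
    (hD : ∀ δ τ : ℝ, 0 < δ → 0 < τ → τ ≤ (ri / re) ^ 2 →
      c * (δ + δ ^ 2 + τ) ≤ ‖dispersion εc (εs + Complex.I * δ) τ‖)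
    (hN : ∀ (δ : ℝ) (m : ℕ), 0 < δ → δ * (‖(εs : ℂ) + Complex.I * δ + (εc : ℂ)‖ ^ 2 +
      (ri / re) ^ (2 * (m + 1)) * ‖(εs : ℂ) + Complex.I * δ - (εc : ℂ)‖ ^ 2) *
        κ ^ (2 * (m + 1)) ≤ K * (δ + δ ^ 2 + (ri / re) ^ (2 * (m + 1))) ^ 2) :
    ∃ C : ℝ, ∀ (δ : ℝ) (V p q : ℂ → ℂ), 0 < δ → IsSolution ri re εc εs δ f V p q →
      energy ri re δ p q ≤ C := by
  have hre0 := hri.trans hre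
  have hr0 := hre0.trans hr
  have hθ : (re / (r * κ)) ^ 2 < 1 := pow_lt_one₀ (by positivity)
    ((div_lt_one (by positivity)).2 hrκ) two_ne_zero
  have hθ0 : 0 ≤ (re / (r * κ)) ^ 2 := by positivity
  set M : ℝ := max ((∫ z, ‖f z‖) ^ 2) ((∫ z, ‖f (conj z)‖) ^ 2) with hM
  have hM0 : 0 ≤ M := (sq_nonneg _).trans (le_max_left _ _)
  set C : ℝ := 8 * π * (K / c ^ 2) * M with hC
  have hC0 : 0 ≤ C := by positivity
  refine ⟨2 * C * (1 - (re / (r * κ)) ^ 2)⁻¹, fun δ V p q hδ hs => ?_⟩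
  have key : ∀ (g W u w : ℂ → ℂ), IsSupportedIn r T g → (∫ z, ‖g z‖) ^ 2 ≤ M → ∀ m as bs ae,
      LayerCoeffs ri re εc εs δ (r ^ 2) g W u w m as bs ae →
      modeEnergy ri re δ m as bs ≤ C * ((re / (r * κ)) ^ 2) ^ m := by
    intro g W u w hg hgM m as bs ae hL
    have hτ : 0 < (ri / re) ^ (2 * (m + 1)) := by positivity
    have hτ1 : (ri / re) ^ (2 * (m + 1)) ≤ (ri / re) ^ 2 :=
      pow_le_pow_of_le_one (by positivity) ((div_le_one hre0).2 hre.le) (by omega)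
    have hDm := hD δ _ hδ hτ hτ1
    have hpos : 0 < δ + δ ^ 2 + (ri / re) ^ (2 * (m + 1)) := by positivity
    have hκ' : 0 < κ ^ (2 * (m + 1)) := by positivity
    have h1 := hL.modeEnergy_le hri hre hδ (K := K / c ^ 2 / κ ^ (2 * (m + 1)))
      ((mul_pos hc hpos).trans_le hDm) (by
        have h2 := hN δ m hδ
        have h3 : (c * (δ + δ ^ 2 + (ri / re) ^ (2 * (m + 1)))) ^ 2 ≤
            ‖dispersion εc (εs + Complex.I * δ) ((ri / re) ^ (2 * (m + 1)))‖ ^ 2 :=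
          pow_le_pow_left₀ (by positivity) hDm 2
        rw [← le_div_iff₀ hκ'] at h2
        refine h2.trans ?_
        calc _ = K / c ^ 2 / κ ^ (2 * (m + 1)) *
              (c * (δ + δ ^ 2 + (ri / re) ^ (2 * (m + 1)))) ^ 2 := by
              field_simp
          _ ≤ _ := mul_le_mul_of_nonneg_left h3 (by positivity))
    refine h1.trans ?_
    have h4 := weighted_moment_le hre0 hr hκ hg m
    have h5 : ((re / (r * κ)) ^ 2) ^ (m + 1) ≤ ((re / (r * κ)) ^ 2) ^ m :=
      pow_le_pow_of_le_one hθ0 hθ.le (Nat.le_succ m)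
    calc _ = 8 * π * (K / c ^ 2) *
          (re ^ (2 * (m + 1)) * ‖moment g m‖ ^ 2 / κ ^ (2 * (m + 1))) := by ring
      _ ≤ 8 * π * (K / c ^ 2) * (M * ((re / (r * κ)) ^ 2) ^ m) := by
          refine mul_le_mul_of_nonneg_left (h4.trans ?_) (by positivity)
          exact mul_le_mul hgM h5 (by positivity) hM0
      _ = _ := by rw [hC]; ring
  exact hs.energy_le hri hre hεc hδ hr hT hf hC0 hθ0 hθ
    (key f V p q hf (le_max_left _ _)) (key _ _ _ _ hf.comp_conj (le_max_right _ _))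

/-! ### The exterior region -/

lemma exists_polarMap_eq (x : ℂ) : ∃ t, polarMap (‖x‖ ^ 2, t) = x := by
  refine ⟨(Complex.arg x : AddCircle (2 * π)), ?_⟩
  simp only [polarMap, toCircle_apply_mk, Real.sqrt_sq (norm_nonneg x)]
  rw [div_self Real.two_pi_pos.ne', one_mul, Circle.coe_exp, Complex.norm_mul_exp_arg_mul_I]

lemma summable_geometric_natAbs {θ : ℝ} (hθ0 : 0 ≤ θ) (hθ : θ < 1) :
    Summable fun k : ℤ => θ ^ k.natAbs := by
  refine Summable.of_nat_of_neg ?_ ?_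
  · simpa using summable_geometric_of_lt_one hθ0 hθ
  · simpa using summable_geometric_of_lt_one hθ0 hθ

/-- An absolutely summable Fourier series of a continuous function converges pointwise to it, so the
mode bounds may be summed on the circle through `x`. -/
lemma norm_le_of_norm_mode_le {W : ℂ → ℂ} (hW : Continuous W) {B θ : ℝ} (hθ0 : 0 ≤ θ)
    (hθ : θ < 1) (x : ℂ) (h : ∀ k : ℤ, ‖mode W k (‖x‖ ^ 2)‖ ≤ B * θ ^ k.natAbs) :
    ‖W x‖ ≤ ∑' k : ℤ, B * θ ^ k.natAbs := by
  obtain ⟨t, ht⟩ := exists_polarMap_eq x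
  let g : C(AddCircle (2 * π), ℂ) := ⟨fun t => W (polarMap (‖x‖ ^ 2, t)),
    hW.comp (continuous_polarMap.comp (by fun_prop))⟩
  have hsum := (summable_geometric_natAbs hθ0 hθ).mul_left B
  have hg : Summable (fourierCoeff g) := Summable.of_norm_bounded hsum h
  have h1 := has_pointwise_sum_fourier_series_of_summable hg t
  have h2 : g t = W x := by simp [g, ht]
  rw [h2] at h1
  rw [← h1.tsum_eq]
  refine tsum_of_norm_bounded hsum.hasSum fun k => ?_
  rw [norm_smul, fourier_apply, Circle.norm_coe, mul_one]
  exact h k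

lemma mode_sub {V V' : ℂ → ℂ} (hV : Continuous V) (hV' : Continuous V') (k : ℤ) (s : ℝ) :
    mode (fun z => V z - V' z) k s = mode V k s - mode V' k s := by
  have hi : ∀ {U : ℂ → ℂ}, Continuous U → Integrable (fun t : AddCircle (2 * π) =>
      fourier (-k) t * U (polarMap (s, t))) haarAddCircle := fun hU =>
    ((fourier (-k)).continuous.mul (hU.comp (continuous_polarMap.comp (by fun_prop)))).integrable_of_hasCompactSupport
      (HasCompactSupport.of_compactSpace _)
  rw [mode_eq, mode_eq, mode_eq, ← integral_sub (hi hV) (hi hV')]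
  simp only [mul_sub]

lemma LayerCoeffs.norm_mode_sub_le {ri re εc εs δ δ' r : ℝ} {f V p q V' p' q' : ℂ → ℂ}
    (hri : 0 < ri) (hre : ri < re) (hr : re < r) (hs : IsSolution ri re εc εs δ f V p q)
    (hs' : IsSolution ri re εc εs δ' f V' p' q') {m : ℕ} {as bs ae as' bs' ae' : ℂ}
    (h : LayerCoeffs ri re εc εs δ (r ^ 2) f V p q m as bs ae)
    (h' : LayerCoeffs ri re εc εs δ' (r ^ 2) f V' p' q' m as' bs' ae') {s : ℝ}
    (hs0 : re ^ 2 < s) :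
    ‖mode V (-((m + 1 : ℕ) : ℤ)) s - mode V' (-((m + 1 : ℕ) : ℤ)) s‖ ≤
      (‖ae‖ + ‖ae'‖) / √s ^ (m + 1) := by
  have hre0 := hri.trans hre
  have e := (hs.radialSystem hri hre m).exterior_sub (hs'.radialSystem hri hre m)
    (pow_pos hre0 2) (pow_lt_pow_left₀ hr hre0.le two_ne_zero)
    (radialPermittivity_exterior hri hre εc εs δ) (radialPermittivity_exterior hri hre εc εs δ')
    h.exterior h'.exterior s hs0
  have hspos : 0 < √s := Real.sqrt_pos.2 ((pow_pos hre0 2).trans hs0)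
  rw [modeV, modeV, ← mul_sub] at e
  have e2 := congrArg norm e
  rw [norm_neg, norm_mul, norm_mul, norm_pow, Complex.norm_real,
    Real.norm_of_nonneg hspos.le] at e2
  have hm : 1 ≤ ‖(m : ℂ) + 1‖ := by
    have : ((m : ℂ) + 1) = ((m + 1 : ℕ) : ℂ) := by push_cast; rfl
    rw [this, Complex.norm_natCast]
    exact_mod_cast Nat.succ_le_succ (Nat.zero_le m)
  rw [le_div_iff₀ (pow_pos hspos _)]
  have h1 : ‖ae - ae'‖ ≤ ‖ae‖ + ‖ae'‖ := norm_sub_le _ _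
  rw [← e2] at h1
  refine le_trans ?_ h1
  rw [mul_comm]
  exact le_mul_of_one_le_left (by positivity) hm

/-- Two losses are compared because the difference is source-free outside `re`, so only the `ae`
matter, even where `x` meets the support of `f`. They grow at most like `(re⁴/(r ri²))^(m+1)`, and
`|x| > re³/ri²` leaves `(re/r)^(m+1)`. -/
theorem exists_exterior_bound {ri re εc εs r T c K : ℝ} {f : ℂ → ℂ} (hri : 0 < ri) (hre : ri < re)
    (hεc : 0 < εc) (hr : re < r) (hT : r < T) (hf : IsSupportedIn r T f) (hc : 0 < c) (hK : 0 < K)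
    (hD : ∀ δ τ : ℝ, 0 < δ → 0 < τ → τ ≤ (ri / re) ^ 2 →
      c * (δ + δ ^ 2 + τ) ≤ ‖dispersion εc (εs + Complex.I * δ) τ‖)
    (hP : ∀ δ τ : ℝ, 0 < δ → 0 < τ → τ ≤ 1 →
      τ * ‖(εs : ℂ) + Complex.I * δ + (εc : ℂ)‖ ≤ K * (δ + δ ^ 2 + τ))
    (hQ : ∀ δ τ : ℝ, 0 < δ → 0 < τ → τ ≤ 1 →
      τ * ‖(εs : ℂ) + Complex.I * δ - (εc : ℂ)‖ ≤ K * (δ + δ ^ 2 + τ)) :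
    ∃ C : ℝ, ∀ (δ δ' : ℝ) (V p q V' p' q' : ℂ → ℂ), 0 < δ → 0 < δ' →
      IsSolution ri re εc εs δ f V p q → IsSolution ri re εc εs δ' f V' p' q' →
      ∀ x : ℂ, re ^ 3 / ri ^ 2 < ‖x‖ → ‖V x - V' x‖ ≤ C := by
  have hre0 := hri.trans hre
  have hr0 := hre0.trans hr
  have hθ : re / r < 1 := (div_lt_one hr0).2 hr
  have hθ0 : 0 ≤ re / r := by positivity
  set M : ℝ := max (∫ z, ‖f z‖) (∫ z, ‖f (conj z)‖) with hM
  have hM0 : 0 ≤ M := (integral_nonneg fun z => norm_nonneg _).trans (le_max_left _ _)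
  set B : ℝ := 2 * (1 + 4 * (K / c)) * M with hB
  have hB0 : 0 ≤ B := by positivity
  refine ⟨∑' k : ℤ, B * (re / r) ^ k.natAbs, fun δ δ' V p q V' p' q' hδ hδ' hs hs' x hx => ?_⟩
  have hx0 : 0 < re ^ 3 / ri ^ 2 := by positivity
  have hxre : re < ‖x‖ := by
    refine lt_of_le_of_lt ?_ hx
    rw [le_div_iff₀ (by positivity)]
    have : ri ^ 2 ≤ re ^ 2 := pow_le_pow_left₀ hri.le hre.le 2
    nlinarith
  have hx2 : re ^ 2 < ‖x‖ ^ 2 := pow_lt_pow_left₀ hxre hre0.le two_ne_zero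
  have hae : ∀ (η : ℝ) (g W u w : ℂ → ℂ), 0 < η → IsSupportedIn r T g → (∫ z, ‖g z‖) ≤ M →
      ∀ m as bs ae, LayerCoeffs ri re εc εs η (r ^ 2) g W u w m as bs ae →
      ‖ae‖ / ‖x‖ ^ (m + 1) ≤ (1 + 4 * (K / c)) * M * (re / r) ^ (m + 1) := by
    intro η g W u w hη hg hgM m as bs ae hL
    have hτ : 0 < (ri / re) ^ (2 * (m + 1)) := by positivity
    have hτ1 : (ri / re) ^ (2 * (m + 1)) ≤ (ri / re) ^ 2 :=
      pow_le_pow_of_le_one (by positivity) ((div_le_one hre0).2 hre.le) (by omega)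
    have hτ2 : (ri / re) ^ (2 * (m + 1)) ≤ 1 :=
      pow_le_one₀ (by positivity) ((div_le_one hre0).2 hre.le)
    have hDm := hD η _ hη hτ hτ1
    have hpos : 0 < η + η ^ 2 + (ri / re) ^ (2 * (m + 1)) := by positivity
    have hKD : K * (η + η ^ 2 + (ri / re) ^ (2 * (m + 1))) ≤ K / c *
        ‖dispersion εc (εs + Complex.I * η) ((ri / re) ^ (2 * (m + 1)))‖ := by
      calc _ = K / c * (c * (η + η ^ 2 + (ri / re) ^ (2 * (m + 1)))) := by field_simp
        _ ≤ _ := mul_le_mul_of_nonneg_left hDm (by positivity)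
    have h1 := hL.norm_ae_le hri hre (div_pos hK hc) ((mul_pos hc hpos).trans_le hDm)
      ((hP η _ hη hτ hτ2).trans hKD) ((hQ η _ hη hτ hτ2).trans hKD)
    have h2 := hg.norm_moment_le hr0 m
    have h3 : ‖moment g m‖ ≤ M * (r ^ (m + 1))⁻¹ :=
      h2.trans (mul_le_mul_of_nonneg_right hgM (by positivity))
    have h4 : (re ^ 3 / ri ^ 2) ^ (m + 1) ≤ ‖x‖ ^ (m + 1) := pow_le_pow_left₀ hx0.le hx.le _
    calc ‖ae‖ / ‖x‖ ^ (m + 1) ≤ ‖ae‖ / (re ^ 3 / ri ^ 2) ^ (m + 1) :=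
          div_le_div_of_nonneg_left (norm_nonneg _) (by positivity) h4
      _ ≤ ((1 + 4 * (K / c)) * (re ^ (2 * (m + 1)) * (M * (r ^ (m + 1))⁻¹) /
          (ri / re) ^ (2 * (m + 1)))) / (re ^ 3 / ri ^ 2) ^ (m + 1) := by
          refine div_le_div_of_nonneg_right (h1.trans ?_) (by positivity)
          refine mul_le_mul_of_nonneg_left ?_ (by positivity)
          exact div_le_div_of_nonneg_right (mul_le_mul_of_nonneg_left h3 (by positivity)) hτ.le
      _ = _ := by
          rw [pow_mul, pow_mul]
          simp only [div_pow, ← pow_mul]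
          field_simp
          ring
  have hmode : ∀ (g W u w W' u' w' : ℂ → ℂ), IsSupportedIn r T g → (∫ z, ‖g z‖) ≤ M →
      IsSolution ri re εc εs δ g W u w → IsSolution ri re εc εs δ' g W' u' w' → ∀ m : ℕ,
      ‖mode W (-((m + 1 : ℕ) : ℤ)) (‖x‖ ^ 2) - mode W' (-((m + 1 : ℕ) : ℤ)) (‖x‖ ^ 2)‖ ≤
        B * (re / r) ^ (m + 1) := by
    intro g W u w W' u' w' hg hgM h h' m
    obtain ⟨as, bs, ae, hL⟩ := h.exists_layerCoeffs_family hri hre hεc hδ hr hT hg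
    obtain ⟨as', bs', ae', hL'⟩ := h'.exists_layerCoeffs_family hri hre hεc hδ' hr hT hg
    have e := LayerCoeffs.norm_mode_sub_le hri hre hr h h' (hL m) (hL' m) hx2
    rw [Real.sqrt_sq (norm_nonneg x), add_div] at e
    have e1 := hae δ g W u w hδ hg hgM m _ _ _ (hL m)
    have e2 := hae δ' g W' u' w' hδ' hg hgM m _ _ _ (hL' m)
    rw [hB]
    linarith
  refine norm_le_of_norm_mode_le (W := fun z => V z - V' z) (hs.continuous.sub hs'.continuous)
    hθ0 hθ x fun k => ?_
  rw [mode_sub hs.continuous hs'.continuous]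
  rcases lt_trichotomy k 0 with hk | rfl | hk
  · obtain ⟨m, hm⟩ : ∃ m : ℕ, k = -((m + 1 : ℕ) : ℤ) := ⟨k.natAbs - 1, by omega⟩
    have := hmode f V p q V' p' q' hf (le_max_left _ _) hs hs' m
    have hn : k.natAbs = m + 1 := by omega
    rw [hn, hm]
    exact this
  · rw [hs.mode_zero_exterior hri hre hs' _ hx2, sub_self, norm_zero]
    positivity
  · obtain ⟨m, hm⟩ : ∃ m : ℕ, k = ((m + 1 : ℕ) : ℤ) := ⟨k.natAbs - 1, by omega⟩
    have := hmode _ _ _ _ _ _ _ hf.comp_conj (le_max_right _ _) hs.comp_conj hs'.comp_conj m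
    rw [mode_comp_conj, mode_comp_conj, neg_neg, ← hm] at this
    have hn : k.natAbs = m + 1 := by omega
    rw [hn]
    exact this

/-! ### The Newtonian potential -/

/-- The Taylor series of `Re log(1 - x/y)`, written as half the sum of a series and its conjugate.
-/
lemma hasSum_log_norm_sub {x y : ℂ} (h : ‖x‖ < ‖y‖) :
    HasSum (fun m : ℕ => -(1 / 2 : ℂ) * ((y ^ (m + 1))⁻¹ * (x ^ (m + 1) / (m + 1)) +
        ((conj y) ^ (m + 1))⁻¹ * ((conj x) ^ (m + 1) / (m + 1))))
      ((Real.log ‖x - y‖ - Real.log ‖y‖ : ℝ) : ℂ) := by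
  have hy : 0 < ‖y‖ := (norm_nonneg x).trans_lt h
  have hy0 : y ≠ 0 := norm_pos_iff.1 hy
  have hz : ‖x / y‖ < 1 := by
    rw [norm_div]
    exact (div_lt_one hy).2 h
  have h1 := Complex.hasSum_taylorSeries_neg_log' hz
  have h2 := Complex.hasSum_conj'.2 h1
  have hxy : 1 - x / y ≠ 0 := by
    intro h0
    rw [sub_eq_zero] at h0
    rw [← h0, norm_one] at hz
    exact lt_irrefl _ hz
  have e : ((Real.log ‖x - y‖ - Real.log ‖y‖ : ℝ) : ℂ) = -(1 / 2 : ℂ) *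
      (-Complex.log (1 - x / y) + conj (-Complex.log (1 - x / y))) := by
    rw [Complex.add_conj, Complex.neg_re, Complex.log_re]
    have : x - y = -(y * (1 - x / y)) := by field_simp; ring
    rw [this, norm_neg, norm_mul, Real.log_mul hy.ne' (norm_ne_zero_iff.2 hxy)]
    push_cast
    ring
  rw [e]
  refine ((h1.add h2).mul_left _).congr_fun fun m => ?_
  simp only [map_div₀, map_pow, map_add, map_one, map_natCast, div_pow]
  ring

lemma moment_comp_conj (f : ℂ → ℂ) (m : ℕ) :
    moment (fun z => f (conj z)) m = -(1 / (4 * (π : ℂ))) * ∫ z, f z * (z ^ (m + 1))⁻¹ := by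
  rw [moment, ← integral_comp_conj fun z => f z * (z ^ (m + 1))⁻¹]

namespace IsSupportedIn

variable {r T : ℝ} {f : ℂ → ℂ}

lemma integrable_mul_of_bound (h : IsSupportedIn r T f) {g : ℂ → ℂ} (hg : Measurable g) {C : ℝ}
    (hC : ∀ z, f z ≠ 0 → ‖g z‖ ≤ C) : Integrable fun z => f z * g z := by
  refine (h.integrable.norm.mul_const C).mono' (h.integrable.1.mul hg.aestronglyMeasurable)
    (ae_of_all _ fun z => ?_)
  rw [norm_mul]
  by_cases hz : f z = 0
  · simp [hz]
  · exact mul_le_mul_of_nonneg_left (hC z hz) (norm_nonneg _)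

lemma norm_inv_pow_le (h : IsSupportedIn r T f) (hr : 0 < r) (m : ℕ) {z : ℂ} (hz : f z ≠ 0) :
    ‖(z ^ (m + 1))⁻¹‖ ≤ (r ^ (m + 1))⁻¹ := by
  rw [norm_inv, norm_pow]
  exact inv_anti₀ (pow_pos hr _) (pow_le_pow_left₀ hr.le (h.supp z hz).1 _)

lemma integrable_log (h : IsSupportedIn r T f) {x : ℂ} (hx : ‖x‖ < r) :
    Integrable fun y => ((1 / (2 * π) * Real.log ‖x - y‖ : ℝ) : ℂ) * f y := by
  have := h.integrable_mul_of_bound (g := fun y => ((1 / (2 * π) * Real.log ‖x - y‖ : ℝ) : ℂ))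
    (C := 1 / (2 * π) * max |Real.log (r - ‖x‖)| |Real.log (‖x‖ + T)|)
    (Complex.measurable_ofReal.comp ((Real.measurable_log.comp
      (measurable_const.sub measurable_id).norm).const_mul _)) fun y hy => by
    have hy1 := h.supp y hy
    have h1 : r - ‖x‖ ≤ ‖x - y‖ := by
      have := norm_sub_norm_le y x
      rw [norm_sub_rev] at this
      linarith [hy1.1]
    have h2 : ‖x - y‖ ≤ ‖x‖ + T := (norm_sub_le _ _).trans (by linarith [hy1.2])
    have h0 : 0 < r - ‖x‖ := by linarith
    rw [Complex.norm_real, norm_mul, Real.norm_of_nonneg (by positivity)]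
    exact mul_le_mul_of_nonneg_left (abs_le_max_abs_abs (Real.log_le_log h0 h1)
      (Real.log_le_log (h0.trans_le h1) h2)) (by positivity)
  simpa only [mul_comm] using this

/-- The expansion of the Newtonian potential in a disk away from the source. -/
theorem hasSum_newtonianPotential (h : IsSupportedIn r T f) {x : ℂ} (hx : ‖x‖ < r) :
    HasSum (fun m : ℕ => moment (fun z => f (conj z)) m * (x ^ (m + 1) / (m + 1)) +
        moment f m * ((conj x) ^ (m + 1) / (m + 1)))
      (newtonianPotential f x - newtonianPotential f 0) := by
  have hr : 0 < r := (norm_nonneg x).trans_lt hx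
  set F : ℕ → ℂ → ℂ := fun m y =>
    -(1 / (4 * (π : ℂ))) * (f y * (y ^ (m + 1))⁻¹) * (x ^ (m + 1) / (m + 1)) +
      -(1 / (4 * (π : ℂ))) * (f y * ((conj y) ^ (m + 1))⁻¹) * ((conj x) ^ (m + 1) / (m + 1)) with hF
  have hI1 : ∀ m, Integrable fun y => f y * (y ^ (m + 1))⁻¹ := fun m =>
    h.integrable_mul_of_bound (measurable_id.pow_const _).inv fun z hz => h.norm_inv_pow_le hr m hz
  have hI2 : ∀ m, Integrable fun y => f y * ((conj y) ^ (m + 1))⁻¹ := fun m =>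
    h.integrable_mul_of_bound (C := (r ^ (m + 1))⁻¹)
      (Complex.continuous_conj.measurable.pow_const _).inv fun z hz => by
        have := h.norm_inv_pow_le hr m hz
        rwa [norm_inv, norm_pow, RCLike.norm_conj, ← norm_pow, ← norm_inv]
  have hFint : ∀ m, Integrable (F m) := fun m =>
    (((hI1 m).const_mul _).mul_const _).add (((hI2 m).const_mul _).mul_const _)
  have hq : ‖x‖ / r < 1 := (div_lt_one hr).2 hx
  have hq0 : 0 ≤ ‖x‖ / r := by positivity
  have hπ : ‖-(1 / (4 * (π : ℂ)))‖ ≤ 1 / 2 := by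
    rw [norm_neg, norm_div, norm_one, norm_mul, Complex.norm_real, Real.norm_of_nonneg Real.pi_pos.le,
      Complex.norm_ofNat]
    exact one_div_le_one_div_of_le two_pos (by nlinarith [Real.pi_gt_three])
  have hterm : ∀ (m : ℕ) (w y : ℂ), ‖w‖ = ‖x‖ → r ≤ ‖y‖ → ‖-(1 / (4 * (π : ℂ))) *
      (f y * (y ^ (m + 1))⁻¹) * (w ^ (m + 1) / (m + 1))‖ ≤
        1 / 2 * (‖f y‖ * (‖x‖ / r) ^ (m + 1)) := by
    intro m w y hw hy
    have e1 : ‖(w ^ (m + 1) / ((m : ℂ) + 1))‖ ≤ ‖x‖ ^ (m + 1) := by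
      rw [norm_div, norm_pow, hw]
      have : ‖(m : ℂ) + 1‖ = (m : ℝ) + 1 := by
        have : ((m : ℂ) + 1) = ((m + 1 : ℕ) : ℂ) := by push_cast; rfl
        rw [this, Complex.norm_natCast]
        push_cast
        rfl
      rw [this]
      exact div_le_self (by positivity) (by linarith [(Nat.cast_nonneg m : (0 : ℝ) ≤ m)])
    have e2 : ‖(y ^ (m + 1))⁻¹‖ ≤ (r ^ (m + 1))⁻¹ := by
      rw [norm_inv, norm_pow]
      exact inv_anti₀ (pow_pos hr _) (pow_le_pow_left₀ hr.le hy _)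
    rw [norm_mul, norm_mul, norm_mul, div_pow]
    calc _ ≤ 1 / 2 * (‖f y‖ * (r ^ (m + 1))⁻¹) * ‖x‖ ^ (m + 1) := by gcongr
      _ = _ := by ring
  have hFle : ∀ m y, ‖F m y‖ ≤ ‖f y‖ * (‖x‖ / r) ^ (m + 1) := by
    intro m y
    by_cases hy : f y = 0
    · simp [hF, hy]
    · have hyr := (h.supp y hy).1
      have e1 := hterm m x y rfl hyr
      have e2 := hterm m (conj x) y (RCLike.norm_conj x) hyr
      refine (norm_add_le _ _).trans ?_
      have e3 : ‖-(1 / (4 * (π : ℂ))) * (f y * ((conj y) ^ (m + 1))⁻¹) *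
          ((conj x) ^ (m + 1) / (m + 1))‖ = ‖-(1 / (4 * (π : ℂ))) * (f y * (y ^ (m + 1))⁻¹) *
          ((conj x) ^ (m + 1) / (m + 1))‖ := by
        simp only [norm_mul, norm_inv, norm_pow, RCLike.norm_conj]
      rw [e3]
      linarith
  have hsum : Summable fun m => ∫ y, ‖F m y‖ := by
    refine Summable.of_nonneg_of_le (fun m => integral_nonneg fun y => norm_nonneg _)
      (fun m => ?_) (((summable_nat_add_iff 1).2 (summable_geometric_of_lt_one hq0 hq)).mul_left
        (∫ y, ‖f y‖))
    rw [← integral_mul_const]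
    exact integral_mono (hFint m).norm (h.integrable.norm.mul_const _) (hFle m)
  have key := hasSum_integral_of_summable_integral_norm hFint hsum
  -- Subtracting the value at the origin removes the term `log |y|` from the kernel.
  have hlim : ∫ y, ∑' m, F m y = newtonianPotential f x - newtonianPotential f 0 := by
    rw [newtonianPotential, newtonianPotential, ← integral_sub (h.integrable_log hx)
      (h.integrable_log (by simpa using hr))]
    refine integral_congr_ae (ae_of_all _ fun y => ?_)
    by_cases hy : f y = 0
    · simp [hF, hy]
    · have hs := (hasSum_log_norm_sub (hx.trans_le (h.supp y hy).1)).mul_left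
        (f y * (1 / (2 * (π : ℂ))))
      have e : ∀ m : ℕ, F m y = f y * (1 / (2 * (π : ℂ))) * (-(1 / 2 : ℂ) *
          ((y ^ (m + 1))⁻¹ * (x ^ (m + 1) / (m + 1)) +
            ((conj y) ^ (m + 1))⁻¹ * ((conj x) ^ (m + 1) / (m + 1)))) := fun m => by
        simp only [hF]
        have : (π : ℂ) ≠ 0 := by exact_mod_cast Real.pi_ne_zero
        rw [show (1 / (4 * (π : ℂ))) = 1 / (2 * (π : ℂ)) * (1 / 2) by field_simp; norm_num]
        ring
      simp only [e]
      rw [hs.tsum_eq]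
      simp only [zero_sub, norm_neg]
      push_cast
      ring
  rw [hlim] at key
  refine key.congr_fun fun m => ?_
  rw [moment_comp_conj, moment, integral_add (((hI1 m).const_mul _).mul_const _)
    (((hI2 m).const_mul _).mul_const _), integral_mul_const, integral_mul_const, integral_const_mul,
    integral_const_mul]

end IsSupportedIn

lemma norm_natCast_add_one (m : ℕ) : ‖(m : ℂ) + 1‖ = (m : ℝ) + 1 := by
  have : ((m : ℂ) + 1) = ((m + 1 : ℕ) : ℂ) := by push_cast; rfl
  rw [this, Complex.norm_natCast]
  push_cast
  rfl

/-! ### Harmonic extension of the potential -/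

/-- The primitive, vanishing at the origin, of `∑ a m * z ^ m`. -/
noncomputable def primitiveSeries (a : ℕ → ℂ) (z : ℂ) : ℂ :=
  ∑' m : ℕ, a m * (z ^ (m + 1) / (m + 1))

lemma norm_primitive_term_le {a : ℕ → ℂ} {C R : ℝ} (hR : 0 < R)
    (ha : ∀ m : ℕ, ‖a m‖ ≤ C * ((m + 1) * (R ^ (m + 1))⁻¹)) (m : ℕ) (z : ℂ) :
    ‖a m * (z ^ (m + 1) / (m + 1))‖ ≤ C * (‖z‖ / R) ^ (m + 1) := by
  rw [norm_mul, norm_div, norm_pow, norm_natCast_add_one]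
  calc _ ≤ C * ((m + 1) * (R ^ (m + 1))⁻¹) * (‖z‖ ^ (m + 1) / (m + 1)) :=
        mul_le_mul_of_nonneg_right (ha m) (by positivity)
    _ = _ := by
        rw [div_pow]
        field_simp

lemma summable_primitive_bound (C : ℝ) {q : ℝ} (hq0 : 0 ≤ q) (hq : q < 1) :
    Summable fun m : ℕ => C * q ^ (m + 1) :=
  ((summable_nat_add_iff 1).2 (summable_geometric_of_lt_one hq0 hq)).mul_left C

lemma summable_primitive_term {a : ℕ → ℂ} {C R : ℝ} (hR : 0 < R)
    (ha : ∀ m : ℕ, ‖a m‖ ≤ C * ((m + 1) * (R ^ (m + 1))⁻¹)) {z : ℂ} (hz : ‖z‖ < R) :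
    Summable fun m : ℕ => a m * (z ^ (m + 1) / (m + 1)) :=
  (summable_primitive_bound C (by positivity) ((div_lt_one hR).2 hz)).of_norm_bounded
    fun m => norm_primitive_term_le hR ha m z

/-- The factor `m + 1` in the coefficient bound is cancelled by the primitive, leaving a geometric
series. -/
lemma analyticAt_primitiveSeries {a : ℕ → ℂ} {C R : ℝ} (hR : 0 < R) (hC : 0 ≤ C)
    (ha : ∀ m : ℕ, ‖a m‖ ≤ C * ((m + 1) * (R ^ (m + 1))⁻¹)) {z : ℂ} (hz : ‖z‖ < R) :
    AnalyticAt ℂ (primitiveSeries a) z := by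
  obtain ⟨R', h1, h2⟩ := exists_between hz
  have hR' : 0 < R' := (norm_nonneg z).trans_lt h1
  have hd : DifferentiableOn ℂ (primitiveSeries a) (Metric.ball 0 R') := by
    refine Complex.differentiableOn_tsum_of_summable_norm
      (summable_primitive_bound C (by positivity) ((div_lt_one hR).2 h2))
      (fun m => Differentiable.differentiableOn (by fun_prop)) Metric.isOpen_ball fun m w hw => ?_
    rw [mem_ball_zero_iff] at hw
    refine (norm_primitive_term_le hR ha m w).trans ?_
    gcongr
  exact hd.analyticAt (Metric.isOpen_ball.mem_nhds (by simpa using h1))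

/-- The extension is a holomorphic function plus the conjugate of one, given by the same power
series as the potential, now convergent up to radius `R`. -/
theorem extendsHarmonically_of_isBigO {re r T R : ℝ} {f : ℂ → ℂ} (hr : re < r) (hR : 0 < R)
    (hrR : re ≤ R) (h : IsSupportedIn r T f)
    (h1 : moment f =O[atTop] fun m : ℕ => ((m : ℝ) + 1) * (R ^ (m + 1))⁻¹)
    (h2 : moment (fun z => f (conj z)) =O[atTop] fun m : ℕ => ((m : ℝ) + 1) * (R ^ (m + 1))⁻¹) :
    ExtendsHarmonically re R f := by
  have hpos : ∀ m : ℕ, 0 < ((m : ℝ) + 1) * (R ^ (m + 1))⁻¹ := fun m => by positivity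
  obtain ⟨C, hC, hb⟩ := Asymptotics.bound_of_isBigO_nat_atTop h1
  obtain ⟨C', hC', hb'⟩ := Asymptotics.bound_of_isBigO_nat_atTop h2
  have hb1 : ∀ m : ℕ, ‖moment f m‖ ≤ C * ((m + 1) * (R ^ (m + 1))⁻¹) := fun m => by
    have := hb (hpos m).ne'
    rwa [Real.norm_of_nonneg (hpos m).le] at this
  have hb2 : ∀ m : ℕ, ‖moment (fun z => f (conj z)) m‖ ≤ C' * ((m + 1) * (R ^ (m + 1))⁻¹) :=
    fun m => by
      have := hb' (hpos m).ne'
      rwa [Real.norm_of_nonneg (hpos m).le] at this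
  have hb3 : ∀ m : ℕ, ‖conj (moment f m)‖ ≤ C * ((m + 1) * (R ^ (m + 1))⁻¹) := fun m => by
    rw [RCLike.norm_conj]
    exact hb1 m
  have hconj : ∀ z, conj (primitiveSeries (fun m => conj (moment f m)) z) =
      primitiveSeries (moment f) (conj z) := fun z => by
    rw [primitiveSeries, Complex.conj_tsum]
    simp [primitiveSeries]
  refine ⟨(fun z => newtonianPotential f 0 + primitiveSeries (moment fun z => f (conj z)) z) +
    conj (primitiveSeries fun m => conj (moment f m)), fun z hz => ?_, fun z hz => ?_⟩
  · rw [mem_ball_zero_iff] at hz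
    exact InnerProductSpace.HarmonicAt.add
      (analyticAt_const.add (analyticAt_primitiveSeries hR hC'.le hb2 hz)).harmonicAt
      (analyticAt_primitiveSeries hR hC.le hb3 hz).harmonicAt_conj
  · rw [mem_ball_zero_iff] at hz
    have hzR := hz.trans_le hrR
    have key := h.hasSum_newtonianPotential (hz.trans hr)
    have s1 := (summable_primitive_term hR hb2 hzR).hasSum
    have s2 := (summable_primitive_term hR hb1 (z := conj z) (by simpa using hzR)).hasSum
    have e := key.unique (s1.add s2)
    have e2 := hconj z
    change newtonianPotential f 0 + primitiveSeries (moment fun z => f (conj z)) z +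
      conj (primitiveSeries (fun m => conj (moment f m)) z) = _
    rw [e2]
    change _ = primitiveSeries _ z + primitiveSeries _ (conj z) at e
    linear_combination -e

/-! ### Flux coefficients -/

lemma integral_exp_int_mul (k : ℤ) (hk : k ≠ 0) :
    ∫ θ in (0 : ℝ)..(2 * π), Complex.exp (Complex.I * k * θ) = 0 := by
  have hc : Complex.I * k ≠ 0 := mul_ne_zero Complex.I_ne_zero (by exact_mod_cast hk)
  rw [integral_exp_mul_complex hc]
  have : Complex.I * k * ((2 * π : ℝ) : ℂ) = k * (2 * π * Complex.I) := by push_cast; ring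
  rw [this, Complex.exp_int_mul_two_pi_mul_I]
  simp

/-- The `m`-th angular term of the radial derivative of the potential, at radius `1`. -/
noncomputable def angularTerm (f : ℂ → ℂ) (m : ℕ) (θ : ℝ) : ℂ :=
  moment (fun z => f (conj z)) m * Complex.exp (Complex.I * ((m + 1 : ℕ) : ℤ) * θ) +
    moment f m * Complex.exp (Complex.I * ((-((m + 1 : ℕ) : ℤ) : ℤ) : ℂ) * θ)

lemma norm_exp_I_mul_int (k : ℤ) (θ : ℝ) : ‖Complex.exp (Complex.I * k * θ)‖ = 1 := by
  have : Complex.I * k * θ = ((k * θ : ℝ) : ℂ) * Complex.I := by push_cast; ring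
  rw [this, Complex.norm_exp_ofReal_mul_I]

lemma continuous_angularTerm (f : ℂ → ℂ) (m : ℕ) : Continuous (angularTerm f m) := by
  unfold angularTerm
  fun_prop

namespace IsSupportedIn

variable {r T : ℝ} {f : ℂ → ℂ}

lemma exists_norm_angularTerm_le (h : IsSupportedIn r T f) (hr : 0 < r) :
    ∃ B, 0 ≤ B ∧ ∀ (m : ℕ) (θ : ℝ), ‖angularTerm f m θ‖ ≤ B * (r ^ m)⁻¹ := by
  refine ⟨((∫ z, ‖f (conj z)‖) + ∫ z, ‖f z‖) * r⁻¹, mul_nonneg (add_nonneg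
    (integral_nonneg fun _ => norm_nonneg _) (integral_nonneg fun _ => norm_nonneg _))
    (inv_nonneg.2 hr.le), fun m θ => ?_⟩
  have h1 := h.norm_moment_le hr m
  have h2 := h.comp_conj.norm_moment_le hr m
  refine (norm_add_le _ _).trans ?_
  rw [norm_mul, norm_mul, norm_exp_I_mul_int, norm_exp_I_mul_int, mul_one, mul_one]
  rw [pow_succ, mul_inv] at h1 h2
  linarith

/-- Termwise differentiation, justified on `(0, r')` with `s < r' < r` by the dominating series in
`r'/r`. -/
lemma hasDerivAt_radial (h : IsSupportedIn r T f) {s : ℝ} (hs0 : 0 < s) (hs : s < r) (θ : ℝ) :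
    HasDerivAt (fun t : ℝ => newtonianPotential f ((t : ℂ) * Complex.exp (Complex.I * (θ : ℂ))))
      (∑' m : ℕ, (s : ℂ) ^ m * angularTerm f m θ) s := by
  have hr := hs0.trans hs
  obtain ⟨B, hB, hle⟩ := h.exists_norm_angularTerm_le hr
  obtain ⟨r', hs', hr'⟩ := exists_between hs
  have hr'0 := hs0.trans hs'
  have hexp : ‖Complex.exp (Complex.I * (θ : ℂ))‖ = 1 := by
    rw [mul_comm, Complex.norm_exp_ofReal_mul_I]
  have hnorm : ∀ t ∈ Ioo 0 r', ‖(t : ℂ) * Complex.exp (Complex.I * (θ : ℂ))‖ < r := fun t ht => by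
    rw [norm_mul, hexp, mul_one, Complex.norm_real, Real.norm_of_nonneg ht.1.le]
    exact ht.2.trans hr'
  have hterm : ∀ t ∈ Ioo 0 r', HasSum (fun m : ℕ => (t : ℂ) ^ (m + 1) / (m + 1) * angularTerm f m θ)
      (newtonianPotential f ((t : ℂ) * Complex.exp (Complex.I * (θ : ℂ))) -
        newtonianPotential f 0) := fun t ht => by
    refine (h.hasSum_newtonianPotential (hnorm t ht)).congr_fun fun m => ?_
    rw [angularTerm]
    have e1 : Complex.exp (Complex.I * ((m + 1 : ℕ) : ℤ) * θ) =
        Complex.exp (Complex.I * (θ : ℂ)) ^ (m + 1) := by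
      rw [← Complex.exp_nat_mul]
      congr 1
      push_cast
      ring
    have e2 : Complex.exp (Complex.I * ((-((m + 1 : ℕ) : ℤ) : ℤ) : ℂ) * θ) =
        conj (Complex.exp (Complex.I * (θ : ℂ))) ^ (m + 1) := by
      rw [← Complex.exp_conj, ← Complex.exp_nat_mul]
      congr 1
      simp only [map_mul, Complex.conj_I, Complex.conj_ofReal]
      push_cast
      ring
    rw [e1, e2, map_mul, Complex.conj_ofReal]
    ring
  have hsIoo : s ∈ Ioo 0 r' := ⟨hs0, hs'⟩
  have hd := hasDerivAt_tsum_of_isPreconnected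
    (g := fun (m : ℕ) (t : ℝ) => (t : ℂ) ^ (m + 1) / (m + 1) * angularTerm f m θ)
    (g' := fun (m : ℕ) (t : ℝ) => (t : ℂ) ^ m * angularTerm f m θ)
    (u := fun m => B * (r' / r) ^ m)
    ((summable_geometric_of_lt_one (by positivity) ((div_lt_one hr).2 hr')).mul_left B)
    isOpen_Ioo isPreconnected_Ioo (fun m t _ => by
      have h1 := ((Complex.ofRealCLM.hasDerivAt (x := t)).pow (m + 1)).div_const ((m : ℂ) + 1)
      have h2 := h1.mul_const (angularTerm f m θ)
      have hm : (m : ℂ) + 1 ≠ 0 := Nat.cast_add_one_ne_zero m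
      refine h2.congr_deriv ?_
      simp only [Complex.ofRealCLM_apply, Complex.ofReal_one, mul_one, Nat.add_sub_cancel]
      push_cast
      rw [mul_div_cancel_left₀ _ hm]) (fun m t ht => by
      rw [norm_mul, norm_pow, Complex.norm_real, Real.norm_of_nonneg ht.1.le, div_pow]
      have h1 := hle m θ
      have h2 : t ^ m ≤ r' ^ m := pow_le_pow_left₀ ht.1.le ht.2.le m
      calc _ ≤ r' ^ m * (B * (r ^ m)⁻¹) := by gcongr
        _ = _ := by ring) hsIoo (hterm s hsIoo).summable hsIoo
  refine (hd.const_add (newtonianPotential f 0)).congr_of_eventuallyEq ?_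
  filter_upwards [isOpen_Ioo.mem_nhds hsIoo] with t ht
  rw [(hterm t ht).tsum_eq]
  ring

theorem hasSum_fluxCoeff (h : IsSupportedIn r T f) {s : ℝ} (hs0 : 0 < s) (hs : s < r) (n : ℤ) :
    HasSum (fun m : ℕ => 1 / (2 * (π : ℂ)) * ∫ θ in (0 : ℝ)..(2 * π),
      -((s : ℂ) ^ m * angularTerm f m θ) * Complex.exp (-(Complex.I * n * θ)))
      (fluxCoeff s f n) := by
  have hr := hs0.trans hs
  obtain ⟨B, hB, hle⟩ := h.exists_norm_angularTerm_le hr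
  have hnexp : ∀ θ : ℝ, ‖Complex.exp (-(Complex.I * n * θ))‖ = 1 := fun θ => by
    rw [Complex.exp_neg, norm_inv, norm_exp_I_mul_int, inv_one]
  set F : ℕ → ℝ → ℂ := fun m θ =>
    -((s : ℂ) ^ m * angularTerm f m θ) * Complex.exp (-(Complex.I * n * θ)) with hF
  have hFc : ∀ m, Continuous (F m) := fun m =>
    ((continuous_const.mul (continuous_angularTerm f m)).neg).mul (by fun_prop)
  have hFle : ∀ m θ, ‖F m θ‖ ≤ B * (s / r) ^ m := fun m θ => by
    rw [hF, norm_mul, hnexp, mul_one, norm_neg, norm_mul, norm_pow, Complex.norm_real,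
      Real.norm_of_nonneg hs0.le, div_pow]
    calc _ ≤ s ^ m * (B * (r ^ m)⁻¹) := mul_le_mul_of_nonneg_left (hle m θ) (by positivity)
      _ = _ := by ring
  have hgeo := (summable_geometric_of_lt_one (r := s / r) (by positivity)
    ((div_lt_one hr).2 hs)).mul_left B
  have key := intervalIntegral.hasSum_integral_of_dominated_convergence (μ := volume)
    (a := 0) (b := 2 * π) (F := F)
    (f := fun θ => ∑' m, F m θ) (fun m _ => B * (s / r) ^ m)
    (fun m => (hFc m).aestronglyMeasurable) (fun m => ae_of_all _ fun θ _ => hFle m θ)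
    (ae_of_all _ fun θ _ => hgeo) intervalIntegrable_const
    (ae_of_all _ fun θ _ => (hgeo.of_norm_bounded fun m => hFle m θ).hasSum)
  have e : fluxCoeff s f n = 1 / (2 * (π : ℂ)) * ∫ θ in (0 : ℝ)..(2 * π), ∑' m, F m θ := by
    rw [fluxCoeff]
    congr 1
    refine intervalIntegral.integral_congr fun θ _ => ?_
    simp only [hF]
    rw [(h.hasDerivAt_radial hs0 hs θ).deriv, tsum_mul_right, tsum_neg]
  rw [e]
  exact key.mul_left _

lemma integral_angularTerm_mul_exp (f : ℂ → ℂ) (m : ℕ) (n : ℤ) :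
    ∫ θ in (0 : ℝ)..(2 * π), angularTerm f m θ * Complex.exp (-(Complex.I * n * θ)) =
      2 * π * ((if n = ((m + 1 : ℕ) : ℤ) then moment (fun z => f (conj z)) m else 0) +
        if n = -((m + 1 : ℕ) : ℤ) then moment f m else 0) := by
  have hk : ∀ k : ℤ, ∫ θ in (0 : ℝ)..(2 * π), Complex.exp (Complex.I * ((k - n : ℤ) : ℂ) * θ) =
      if n = k then 2 * (π : ℂ) else 0 := fun k => by
    split_ifs with hkn
    · simp [hkn]
    · exact integral_exp_int_mul _ (sub_ne_zero.2 fun h => hkn h.symm)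
  have hi : ∀ k : ℤ, IntervalIntegrable
      (fun θ : ℝ => Complex.exp (Complex.I * (k : ℂ) * θ)) volume 0 (2 * π) := fun k =>
    Continuous.intervalIntegrable (by fun_prop) _ _
  have e : ∀ θ : ℝ, angularTerm f m θ * Complex.exp (-(Complex.I * n * θ)) =
      moment (fun z => f (conj z)) m *
          Complex.exp (Complex.I * (((((m + 1 : ℕ) : ℤ) - n : ℤ)) : ℂ) * θ) +
        moment f m * Complex.exp (Complex.I * (((-((m + 1 : ℕ) : ℤ) - n : ℤ)) : ℂ) * θ) := fun θ => by
    rw [angularTerm, add_mul, mul_assoc (moment _ m), mul_assoc (moment _ m), ← Complex.exp_add,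
      ← Complex.exp_add]
    push_cast
    ring_nf
  simp only [e]
  rw [intervalIntegral.integral_add ((hi _).const_mul _) ((hi _).const_mul _),
    intervalIntegral.integral_const_mul, intervalIntegral.integral_const_mul, hk, hk]
  split_ifs <;> ring

/-- This translates the gap property into a statement on moments: orthogonality of the exponentials
leaves a single term of the expansion. -/
lemma fluxCoeff_eq (h : IsSupportedIn r T f) {s : ℝ} (hs0 : 0 < s) (hs : s < r) (m : ℕ) :
    fluxCoeff s f (-((m + 1 : ℕ) : ℤ)) = -((s : ℂ) ^ m * moment f m) ∧
    fluxCoeff s f ((m + 1 : ℕ) : ℤ) = -((s : ℂ) ^ m * moment (fun z => f (conj z)) m) := by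
  have hπ : (π : ℂ) ≠ 0 := by exact_mod_cast Real.pi_ne_zero
  have hterm : ∀ (j : ℕ) (n : ℤ), 1 / (2 * (π : ℂ)) * ∫ θ in (0 : ℝ)..(2 * π),
      -((s : ℂ) ^ j * angularTerm f j θ) * Complex.exp (-(Complex.I * n * θ)) =
      -((s : ℂ) ^ j * ((if n = ((j + 1 : ℕ) : ℤ) then moment (fun z => f (conj z)) j else 0) +
        if n = -((j + 1 : ℕ) : ℤ) then moment f j else 0)) := fun j n => by
    have e : ∀ θ : ℝ, -((s : ℂ) ^ j * angularTerm f j θ) * Complex.exp (-(Complex.I * n * θ)) =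
        -(s : ℂ) ^ j * (angularTerm f j θ * Complex.exp (-(Complex.I * n * θ))) := fun θ => by ring
    simp only [e]
    rw [intervalIntegral.integral_const_mul, integral_angularTerm_mul_exp]
    field_simp
  have hs' : ∀ n : ℤ, n.natAbs = m + 1 → fluxCoeff s f n =
      -((s : ℂ) ^ m * ((if n = ((m + 1 : ℕ) : ℤ) then moment (fun z => f (conj z)) m else 0) +
        if n = -((m + 1 : ℕ) : ℤ) then moment f m else 0)) := fun n hn => by
    have h1 := h.hasSum_fluxCoeff hs0 hs n
    simp only [hterm] at h1
    refine h1.unique (hasSum_single m fun j hj => ?_)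
    rw [if_neg (by omega), if_neg (by omega)]
    simp
  refine ⟨?_, ?_⟩
  · rw [hs' _ (by omega), if_neg (by omega), if_pos rfl, zero_add]
  · rw [hs' _ (by omega), if_pos rfl, if_neg (by omega), add_zero]

end IsSupportedIn

/-! ### Resonance -/

lemma sq_div_lt_one {ri re : ℝ} (hri : 0 < ri) (hre : ri < re) : (ri / re) ^ 2 < 1 :=
  pow_lt_one₀ (div_nonneg hri.le (hri.trans hre).le) ((div_lt_one (hri.trans hre)).2 hre)
    two_ne_zero

lemma norm_shell_le (εc δ x : ℝ) (hδ : 0 < δ) (hx : |x| = εc) :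
    ‖((-1 : ℝ) : ℂ) + Complex.I * δ + (x : ℂ)‖ ≤ 1 + δ + εc := by
  refine (norm_add_le _ _).trans (add_le_add ((norm_add_le _ _).trans ?_) ?_)
  · rw [norm_mul, Complex.norm_I, one_mul, Complex.norm_real, Complex.norm_real, norm_neg, norm_one,
      Real.norm_of_nonneg hδ.le]
  · rw [Complex.norm_real, Real.norm_eq_abs, hx]

lemma mul_shell_le {εc δ τ : ℝ} (hεc : 0 < εc) (hδ : 0 < δ) (hτ : 0 < τ) (hτ1 : τ ≤ 1) :
    τ * (1 + δ + εc) ≤ (2 + εc) * (δ + δ ^ 2 + τ) := by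
  nlinarith [mul_pos hεc hδ, mul_pos hεc (pow_pos hδ 2), mul_le_mul_of_nonneg_right hτ1 hδ.le,
    pow_pos hδ 2]

/-- In the background resonant case, every mode of the source bounds the energy from below. -/
theorem exists_energy_ge {ri re εc r T : ℝ} {f : ℂ → ℂ} (hri : 0 < ri) (hre : ri < re)
    (hεc : 0 < εc) (h1 : εc ≠ 1) (hr : re < r) (hT : r < T) (hf : IsSupportedIn r T f) :
    ∃ c > 0, ∀ (δ : ℝ) (V p q : ℂ → ℂ), 0 < δ → δ ≤ 1 → IsSolution ri re εc (-1) δ f V p q →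
      ∀ m : ℕ, c * (δ / (δ + (ri / re) ^ (2 * (m + 1))) ^ 2 *
          (re ^ (2 * (m + 1)) * ‖moment f m‖ ^ 2 / (m + 1))) ≤ energy ri re δ p q ∧
        c * (δ / (δ + (ri / re) ^ (2 * (m + 1))) ^ 2 *
          (re ^ (2 * (m + 1)) * ‖moment (fun z => f (conj z)) m‖ ^ 2 / (m + 1))) ≤
            energy ri re δ p q := by
  have hre0 := hri.trans hre
  have hρ := sq_div_lt_one hri hre
  have hne : (-1 + εc) ^ 2 > 0 := by
    have : -1 + εc ≠ 0 := fun h => h1 (by linarith)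
    positivity
  refine ⟨8 * π * (1 - (ri / re) ^ 2) * (-1 + εc) ^ 2 / (3 * εc + 6) ^ 2, by
    have : 0 < 1 - (ri / re) ^ 2 := by linarith
    positivity, fun δ V p q hδ hδ1 hs m => ?_⟩
  have hD := norm_dispersion_background_le hεc hδ hδ1 (τ := (ri / re) ^ (2 * (m + 1)))
    (by positivity)
  have hC : 0 < 3 * εc + 6 := by positivity
  obtain ⟨⟨as, bs, ae, hL, hE⟩, as', bs', ae', hL', hE'⟩ :=
    hs.exists_modeEnergy_le hri hre hεc hδ hr hT hf m
  exact ⟨(hL.modeEnergy_ge hri hre hδ hC hD).trans hE,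
    (hL'.modeEnergy_ge hri hre hδ hC hD).trans hE'⟩

/-- At `δ = τ` the resonance factor is `1/(4τ)`, and `re^(2(m+1))/τ = (re²/ri)^(2(m+1))`. -/
lemma isBigO_of_resonant_bound {ri re c M : ℝ} (hri : 0 < ri) (hre : 0 < re) (hc : 0 < c)
    {a : ℕ → ℂ} (h : ∀ᶠ m : ℕ in atTop, c * ((ri / re) ^ (2 * (m + 1)) /
      ((ri / re) ^ (2 * (m + 1)) + (ri / re) ^ (2 * (m + 1))) ^ 2 *
        (re ^ (2 * (m + 1)) * ‖a m‖ ^ 2 / (m + 1))) ≤ M) :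
    a =O[atTop] fun m : ℕ => ((m : ℝ) + 1) * ((re ^ 2 / ri) ^ (m + 1))⁻¹ := by
  refine Asymptotics.IsBigO.of_bound (√(4 * M / c)) ?_
  filter_upwards [h] with m hm
  have hm1 : (1 : ℝ) ≤ (m : ℝ) + 1 := by linarith [(Nat.cast_nonneg m : (0 : ℝ) ≤ m)]
  have hpos : 0 < ((m : ℝ) + 1) * ((re ^ 2 / ri) ^ (m + 1))⁻¹ := by positivity
  rw [Real.norm_of_nonneg hpos.le]
  have e : c * ((ri / re) ^ (2 * (m + 1)) /
      ((ri / re) ^ (2 * (m + 1)) + (ri / re) ^ (2 * (m + 1))) ^ 2 *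
        (re ^ (2 * (m + 1)) * ‖a m‖ ^ 2 / (m + 1))) =
      c / 4 * (‖a m‖ ^ 2 * ((re ^ 2 / ri) ^ (m + 1)) ^ 2 / (m + 1)) := by
    have e1 : re ^ 2 / ri = re / (ri / re) := by field_simp
    have hτ : (ri / re) ^ (m + 1) ≠ 0 := by positivity
    rw [← two_mul ((ri / re) ^ (2 * (m + 1))), mul_comm 2 (m + 1), pow_mul, pow_mul re, e1,
      div_pow re]
    generalize (ri / re) ^ (m + 1) = t at hτ
    field_simp
    ring
  rw [e] at hm
  have h2 : ‖a m‖ ^ 2 ≤ 4 * M / c * (((m : ℝ) + 1) * ((re ^ 2 / ri) ^ (m + 1))⁻¹) ^ 2 := by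
    have hM : 0 ≤ 4 * M / c := by
      have : 0 ≤ M := le_trans (by positivity) hm
      positivity
    have h3 : ‖a m‖ ^ 2 ≤ 4 * M / c * ((m : ℝ) + 1) * (((re ^ 2 / ri) ^ (m + 1)) ^ 2)⁻¹ := by
      rw [← div_eq_mul_inv, le_div_iff₀ (by positivity)]
      rw [mul_div_assoc', div_le_iff₀ (by positivity)] at hm
      rw [div_mul_eq_mul_div, le_div_iff₀ hc]
      linarith
    -- The bound obtained has `√(m+1)`; it is weakened to `m + 1`, which the harmonic extension
    -- tolerates.
    refine h3.trans ?_
    rw [mul_pow, inv_pow, ← mul_assoc]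
    gcongr
    nlinarith
  have h3 := Real.sqrt_le_sqrt h2
  rwa [Real.sqrt_sq (norm_nonneg _), Real.sqrt_mul' _ (sq_nonneg _), Real.sqrt_sq hpos.le] at h3

/-! ### Consequences for a family of solutions indexed by the loss -/

section Background

variable {ri re εc : ℝ} {f : ℂ → ℂ} {V Vx Vy : ℝ → ℂ → ℂ}

lemma IsSource.exists_isSupportedIn (hf : IsSource re f) {c : ℝ}
    (hc : tsupport f ⊆ {x : ℂ | c < ‖x‖}) :
    ∃ r T, c < r ∧ r < T ∧ IsSupportedIn r T f := by
  obtain ⟨r, T, h1, h2, h3⟩ := hf.exists_radii hc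
  exact ⟨r, T, h1, h2, hf.integrable, h3⟩

theorem limsup_energy_eq_top (hri : 0 < ri) (hre : ri < re) (hεc : 0 < εc) (h1 : εc ≠ 1)
    (hf : IsSource re f)
    (hV : ∀ δ : ℝ, 0 < δ → IsSolution ri re εc (-1) δ f (V δ) (Vx δ) (Vy δ))
    (hne : ¬ ExtendsHarmonically re (re ^ 2 / ri) f) :
    limsup (fun δ : ℝ => ((energy ri re δ (Vx δ) (Vy δ) : ℝ) : EReal)) (𝓝[>] 0) = ⊤ := by
  have hre0 := hri.trans hre
  obtain ⟨r, T, hr, hT, hs⟩ := hf.exists_isSupportedIn hf.outside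
  by_contra hlim
  obtain ⟨M, hM, -⟩ := EReal.lt_iff_exists_real_btwn.1 (lt_top_iff_ne_top.2 hlim)
  have hev := eventually_lt_of_limsup_lt hM
  obtain ⟨c, hc, hge⟩ := exists_energy_ge hri hre hεc h1 hr hT hs
  have hρ0 : 0 < ri / re := div_pos hri hre0
  have hρ : ri / re < 1 := (div_lt_one hre0).2 hre
  -- A finite `limsup` bounds the energy along `δ = τ_m → 0`, where the mode `m` is in resonance;
  -- this makes the potential extend, a contradiction.
  have hτ : Tendsto (fun m : ℕ => (ri / re) ^ (2 * (m + 1))) atTop (𝓝[>] 0) :=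
    tendsto_nhdsWithin_iff.2 ⟨(tendsto_pow_atTop_nhds_zero_of_lt_one hρ0.le hρ).comp
      (tendsto_atTop_mono (fun m => (by omega : m ≤ 2 * (m + 1))) tendsto_id), Eventually.of_forall fun m =>
        pow_pos hρ0 _⟩
  have hbd : ∀ᶠ m : ℕ in atTop, energy ri re ((ri / re) ^ (2 * (m + 1)))
      (Vx ((ri / re) ^ (2 * (m + 1)))) (Vy ((ri / re) ^ (2 * (m + 1)))) ≤ M :=
    (hτ.eventually hev).mono fun m hm => (EReal.coe_lt_coe_iff.1 hm).le
  have hR : re ≤ re ^ 2 / ri := by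
    rw [le_div_iff₀ hri, sq]
    exact mul_le_mul_of_nonneg_left hre.le hre0.le
  refine hne (extendsHarmonically_of_isBigO hr (hre0.trans_le hR) hR hs
    (isBigO_of_resonant_bound (M := M) hri hre0 hc ?_)
    (isBigO_of_resonant_bound (M := M) hri hre0 hc ?_))
  · filter_upwards [hbd] with m hm
    exact (hge _ _ _ _ (by positivity) (pow_le_one₀ hρ0.le hρ.le) (hV _ (by positivity)) m).1.trans
      hm
  · filter_upwards [hbd] with m hm
    exact (hge _ _ _ _ (by positivity) (pow_le_one₀ hρ0.le hρ.le) (hV _ (by positivity)) m).2.trans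
      hm

theorem exists_energy_bound_background (hri : 0 < ri) (hre : ri < re) (hεc : 0 < εc) (h1 : εc ≠ 1)
    (hf : IsSource re f)
    (hV : ∀ δ : ℝ, 0 < δ → IsSolution ri re εc (-1) δ f (V δ) (Vx δ) (Vy δ))
    (hout : tsupport f ⊆ {x : ℂ | re ^ 2 / ri < ‖x‖}) :
    ∃ C : ℝ, ∀ δ : ℝ, 0 < δ → energy ri re δ (Vx δ) (Vy δ) ≤ C := by
  have hre0 := hri.trans hre
  obtain ⟨r, T, hr, hT, hs⟩ := hf.exists_isSupportedIn hout
  obtain ⟨c, hc, hD⟩ := exists_dispersion_background hεc h1 (sq_div_lt_one hri hre)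
  have hR : re ≤ re ^ 2 / ri := by
    rw [le_div_iff₀ hri, sq]
    exact mul_le_mul_of_nonneg_left hre.le hre0.le
  obtain ⟨C, hC⟩ := exists_energy_bound (κ := ri / re) (K := (εc - 1) ^ 2 + (εc + 1) ^ 2 + 2) hri hre
    hεc (hR.trans_lt hr) hT hs (div_pos hri hre0) (by
      rw [div_lt_iff₀ hri] at hr
      rw [mul_div_assoc', lt_div_iff₀ hre0]
      nlinarith) hc (by positivity) hD
    fun δ m hδ => background_resonance_bound hδ (pow_pos (div_pos hri hre0) _)
      (pow_le_one₀ (div_pos hri hre0).le ((div_lt_one hre0).2 hre).le)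
  exact ⟨C, fun δ hδ => hC δ _ _ _ hδ (hV δ hδ)⟩

theorem exists_energy_bound_core (hri : 0 < ri) (hre : ri < re) (hεc : 0 < εc) (h1 : εc ≠ 1)
    (hf : IsSource re f)
    (hV : ∀ δ : ℝ, 0 < δ → IsSolution ri re εc (-εc) δ f (V δ) (Vx δ) (Vy δ)) :
    ∃ C : ℝ, ∀ δ : ℝ, 0 < δ → energy ri re δ (Vx δ) (Vy δ) ≤ C := by
  have hre0 := hri.trans hre
  obtain ⟨r, T, hr, hT, hs⟩ := hf.exists_isSupportedIn hf.outside
  obtain ⟨c, hc, hD⟩ := exists_dispersion_core hεc h1 (sq_div_lt_one hri hre)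
  obtain ⟨C, hC⟩ := exists_energy_bound (κ := 1) (K := 4 * εc ^ 2 + 2) hri hre
    hεc hr hT hs one_pos (by rwa [mul_one]) hc (by positivity) hD
    fun δ m hδ => by
      rw [one_pow, mul_one]
      exact core_resonance_bound hδ (pow_pos (div_pos hri hre0) _)
        (pow_le_one₀ (div_pos hri hre0).le ((div_lt_one hre0).2 hre).le)
  exact ⟨C, fun δ hδ => hC δ _ _ _ hδ (hV δ hδ)⟩

/-- Comparison with the solution for `δ = 1`, which is bounded in the whole plane by continuity and
decay. -/
theorem exists_exterior_bound_background (hri : 0 < ri) (hre : ri < re) (hεc : 0 < εc)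
    (h1 : εc ≠ 1) (hf : IsSource re f)
    (hV : ∀ δ : ℝ, 0 < δ → IsSolution ri re εc (-1) δ f (V δ) (Vx δ) (Vy δ)) :
    ∃ C : ℝ, ∀ δ : ℝ, 0 < δ → ∀ x : ℂ, re ^ 3 / ri ^ 2 < ‖x‖ → ‖V δ x‖ < C := by
  obtain ⟨r, T, hr, hT, hs⟩ := hf.exists_isSupportedIn hf.outside
  obtain ⟨c, hc, hD⟩ := exists_dispersion_background hεc h1 (sq_div_lt_one hri hre)
  obtain ⟨C, hC⟩ := exists_exterior_bound (K := 2 + εc) hri hre hεc hr hT hs hc (by positivity) hD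
    (fun δ τ hδ hτ hτ1 => (mul_le_mul_of_nonneg_left
      (norm_shell_le εc δ εc hδ (abs_of_pos hεc)) hτ.le).trans (mul_shell_le hεc hδ hτ hτ1))
    (fun δ τ hδ hτ hτ1 => by
      have := norm_shell_le εc δ (-εc) hδ (by rw [abs_neg, abs_of_pos hεc])
      rw [Complex.ofReal_neg εc, ← sub_eq_add_neg] at this
      exact (mul_le_mul_of_nonneg_left this hτ.le).trans (mul_shell_le hεc hδ hτ hτ1))
  obtain ⟨C', hC'⟩ := exists_bound_of_tendsto_cocompact (hV 1 one_pos).continuous (hV 1 one_pos).decay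
  refine ⟨C + C' + 1, fun δ hδ x hx => ?_⟩
  have h2 := hC δ 1 _ _ _ _ _ _ hδ one_pos (hV δ hδ) (hV 1 one_pos) x hx
  have h3 := norm_le_norm_add_norm_sub' (V δ x) (V 1 x)
  linarith [hC' x]

lemma exists_energy_ge_fluxCoeff (hri : 0 < ri) (hre : ri < re) (hεc : 0 < εc) (h1 : εc ≠ 1)
    (hf : IsSource re f)
    (hV : ∀ δ : ℝ, 0 < δ → IsSolution ri re εc (-1) δ f (V δ) (Vx δ) (Vy δ)) :
    ∃ c > 0, ∀ (δ : ℝ) (n : ℤ), 0 < δ → δ ≤ 1 → n ≠ 0 →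
      c * (δ / (δ + (ri / re) ^ (2 * n.natAbs)) ^ 2 *
        (‖fluxCoeff re f n‖ ^ 2 / n.natAbs)) ≤ energy ri re δ (Vx δ) (Vy δ) := by
  have hre0 := hri.trans hre
  obtain ⟨r, T, hr, hT, hs⟩ := hf.exists_isSupportedIn hf.outside
  obtain ⟨c, hc, hge⟩ := exists_energy_ge hri hre hεc h1 hr hT hs
  -- The flux coefficient carries `re^m` and the energy bound `re^(2(m+1))`; `re²` is the
  -- difference.
  refine ⟨c * re ^ 2, by positivity, fun δ n hδ hδ1 hn => ?_⟩
  obtain ⟨m, hm⟩ : ∃ m : ℕ, n.natAbs = m + 1 := ⟨n.natAbs - 1, by omega⟩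
  have hE := hge δ _ _ _ hδ hδ1 (hV δ hδ) m
  have hflux := hs.fluxCoeff_eq hre0 hr m
  have conclude : ∀ a : ℂ, fluxCoeff re f n = -((re : ℂ) ^ m * a) →
      c * (δ / (δ + (ri / re) ^ (2 * (m + 1))) ^ 2 * (re ^ (2 * (m + 1)) * ‖a‖ ^ 2 / (m + 1))) ≤
        energy ri re δ (Vx δ) (Vy δ) →
      c * re ^ 2 * (δ / (δ + (ri / re) ^ (2 * n.natAbs)) ^ 2 *
        (‖fluxCoeff re f n‖ ^ 2 / n.natAbs)) ≤ energy ri re δ (Vx δ) (Vy δ) := by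
    intro a ha h
    refine le_trans (le_of_eq ?_) h
    rw [ha, hm, norm_neg, norm_mul, norm_pow, Complex.norm_real, Real.norm_of_nonneg hre0.le]
    push_cast
    ring
  rcases lt_or_gt_of_ne hn with hn | hn
  · obtain rfl : n = -((m + 1 : ℕ) : ℤ) := by omega
    exact conclude _ hflux.1 hE.1
  · obtain rfl : n = ((m + 1 : ℕ) : ℤ) := by omega
    exact conclude _ hflux.2 hE.2

theorem tendsto_energy_atTop (hri : 0 < ri) (hre : ri < re) (hεc : 0 < εc) (h1 : εc ≠ 1)
    (hf : IsSource re f)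
    (hV : ∀ δ : ℝ, 0 < δ → IsSolution ri re εc (-1) δ f (V δ) (Vx δ) (Vy δ))
    (hgap : GapProperty ri re f) :
    Tendsto (fun δ : ℝ => energy ri re δ (Vx δ) (Vy δ)) (𝓝[>] 0) atTop := by
  have hre0 := hri.trans hre
  have hρ0 : 0 < ri / re := div_pos hri hre0
  have hρ : ri / re < 1 := (div_lt_one hre0).2 hre
  obtain ⟨c, hc, hge⟩ := exists_energy_ge_fluxCoeff hri hre hεc h1 hf hV
  obtain ⟨n, hmono, hlim⟩ := hgap
  rw [tendsto_atTop]
  intro M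
  obtain ⟨k₀, hk₀⟩ := eventually_atTop.1 (tendsto_atTop.1 hlim (4 * M / c))
  set τ : ℕ → ℝ := fun k => (ri / re) ^ (2 * (n k).natAbs) with hτ
  have hτ0 : ∀ k, 0 < τ k := fun k => pow_pos hρ0 _
  have hanti : StrictAnti τ := fun j k hjk =>
    pow_lt_pow_right_of_lt_one₀ hρ0 hρ (Nat.mul_lt_mul_of_pos_left (hmono hjk) two_pos)
  have hτlim : Tendsto τ atTop (𝓝 0) :=
    (tendsto_pow_atTop_nhds_zero_of_lt_one hρ0.le hρ).comp
      (tendsto_atTop_mono (fun k => (hmono.le_apply (x := k)).trans (Nat.le_mul_of_pos_left _ two_pos))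
        tendsto_id)
  filter_upwards [Ioo_mem_nhdsGT (hτ0 (k₀ + 1))] with δ hδ
  have hex : ∃ k, τ k ≤ δ := (hτlim.eventually (eventually_le_nhds hδ.1)).exists
  classical
  have hfind := Nat.find_spec hex
  -- Minimality gives `τ (k+1) ≤ δ < τ k` with `k > k₀`. Thus the gap estimate applies at `k`, and
  -- `n k ≠ 0` because `k ≥ 1`.
  have hlt : k₀ + 1 < Nat.find hex := by
    by_contra hle
    exact absurd ((hanti.antitone (not_lt.1 hle)).trans hfind) (not_le.2 hδ.2)
  obtain ⟨k, hk⟩ : ∃ k, Nat.find hex = k + 1 := ⟨Nat.find hex - 1, by omega⟩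
  rw [hk] at hfind
  have hδk : δ < τ k := not_le.1 (Nat.find_min hex (by omega))
  have hpos : 0 < (n k).natAbs := by
    have := hmono (show 0 < k by omega)
    simp only at this
    omega
  have hδ1 : δ ≤ 1 := hδ.2.le.trans (pow_le_one₀ hρ0.le hρ.le)
  have hE := hge δ (n k) hδ.1 hδ1 (Int.natAbs_pos.1 hpos)
  have hg := hk₀ k (by omega)
  have hτk : (ri / re) ^ (2 * ((n (k + 1)).natAbs - (n k).natAbs)) = τ (k + 1) / τ k := by
    have : (n k).natAbs < (n (k + 1)).natAbs := hmono (Nat.lt_succ_self k)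
    rw [hτ, eq_div_iff (hτ0 k).ne', ← pow_add]
    congr 1
    omega
  rw [hτk] at hg
  have hkpos := hτ0 k
  have hn' : (0 : ℝ) < (n k).natAbs := by exact_mod_cast hpos
  -- The numerator uses `τ (k+1) ≤ δ`, the denominator `δ < τ k`. The quotient `τ (k+1)/τ k` is the
  -- factor `ρ^(2(|n_{k+1}| - |n_k|))` of the gap property.
  have h2 : τ (k + 1) / (2 * τ k) ^ 2 ≤ δ / (δ + τ k) ^ 2 :=
    div_le_div₀ hδ.1.le hfind (pow_pos (add_pos hδ.1 hkpos) 2)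
      (pow_le_pow_left₀ (add_pos hδ.1 hkpos).le (by linarith) 2)
  refine le_trans ?_ hE
  calc M = c / 4 * (4 * M / c) := by field_simp
    _ ≤ c / 4 * (τ (k + 1) / τ k * (‖fluxCoeff re f (n k)‖ ^ 2 / ((n k).natAbs * τ k))) :=
        mul_le_mul_of_nonneg_left hg (by positivity)
    _ = c * (τ (k + 1) / (2 * τ k) ^ 2 * (‖fluxCoeff re f (n k)‖ ^ 2 / (n k).natAbs)) := by
        field_simp
        ring
    _ ≤ _ := by gcongr

end Background

lemma tendstoUniformlyOn_div_sqrt {l : Filter ℝ} {s : Set ℂ} {V : ℝ → ℂ → ℂ} {E : ℝ → ℝ} {C : ℝ}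
    (hE : Tendsto E l atTop) (hV : ∀ᶠ δ in l, ∀ x ∈ s, ‖V δ x‖ < C) :
    TendstoUniformlyOn (fun δ x => V δ x / ((√(E δ) : ℝ) : ℂ)) (fun _ => 0) l s := by
  rw [Metric.tendstoUniformlyOn_iff]
  intro ε hε
  have h1 := (Real.tendsto_sqrt_atTop.comp hE).eventually_ge_atTop (C / ε)
  have h2 := (Real.tendsto_sqrt_atTop.comp hE).eventually_gt_atTop 0
  filter_upwards [hV, h1, h2] with δ hδ e1 e2 x hx
  simp only [Function.comp_apply] at e1 e2
  rw [dist_zero_left, norm_div, Complex.norm_real, Real.norm_of_nonneg e2.le, div_lt_iff₀ e2]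
  rw [div_le_iff₀ hε] at e1
  linarith [hδ x hx]

end CALR

theorem theorem4p1 (ri re εc εs : ℝ) (hri : 0 < ri) (hre : ri < re)
    (hεc : 0 < εc) (hεs : εs < 0)
    (f : ℂ → ℂ) (hf : CALR.IsSource re f)
    (V Vx Vy : ℝ → ℂ → ℂ)
    (hV : ∀ δ : ℝ, 0 < δ → CALR.IsSolution ri re εc εs δ f (V δ) (Vx δ) (Vy δ)) :
    -- (i)
    (εc = -εs → -εs ≠ 1 →
      ∃ C : ℝ, ∀ δ : ℝ, 0 < δ → CALR.energy ri re δ (Vx δ) (Vy δ) ≤ C) ∧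
    -- (ii)
    (εc ≠ -εs → -εs = 1 →
      (tsupport f ⊆ Metric.ball 0 (re ^ 2 / ri) →
        ¬ CALR.ExtendsHarmonically re (re ^ 2 / ri) f →
        Filter.limsup (fun δ : ℝ => ((CALR.energy ri re δ (Vx δ) (Vy δ) : ℝ) : EReal))
          (nhdsWithin 0 (Set.Ioi 0)) = ⊤) ∧
      (tsupport f ⊆ {x : ℂ | re ^ 2 / ri < ‖x‖} →
        ∃ C : ℝ, ∀ δ : ℝ, 0 < δ → CALR.energy ri re δ (Vx δ) (Vy δ) ≤ C) ∧
      (∃ C : ℝ, ∀ δ : ℝ, 0 < δ → ∀ x : ℂ, re ^ 3 / ri ^ 2 < ‖x‖ → ‖V δ x‖ < C)) ∧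
    -- (iii)
    (εc ≠ -εs → -εs = 1 → CALR.GapProperty ri re f →
      Filter.Tendsto (fun δ : ℝ => CALR.energy ri re δ (Vx δ) (Vy δ))
        (nhdsWithin 0 (Set.Ioi 0)) Filter.atTop ∧
      TendstoUniformlyOn
        (fun (δ : ℝ) (x : ℂ) => V δ x / ((√(CALR.energy ri re δ (Vx δ) (Vy δ)) : ℝ) : ℂ))
        (fun _ => 0) (nhdsWithin 0 (Set.Ioi 0)) {x : ℂ | re ^ 3 / ri ^ 2 < ‖x‖}) := by
  refine ⟨fun h h1 => ?_, fun h h1 => ?_, fun h h1 hgap => ?_⟩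
  · obtain rfl : εs = -εc := by linarith
    exact CALR.exists_energy_bound_core hri hre hεc (by rwa [neg_neg] at h1) hf hV
  · obtain rfl : εs = -1 := by linarith
    rw [neg_neg] at h
    exact ⟨fun _ hne => CALR.limsup_energy_eq_top hri hre hεc h hf hV hne,
      fun hout => CALR.exists_energy_bound_background hri hre hεc h hf hV hout,
      CALR.exists_exterior_bound_background hri hre hεc h hf hV⟩
  · obtain rfl : εs = -1 := by linarith
    rw [neg_neg] at h
    have hE := CALR.tendsto_energy_atTop hri hre hεc h hf hV hgap
    obtain ⟨C, hC⟩ := CALR.exists_exterior_bound_background hri hre hεc h hf hV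
    exact ⟨hE, CALR.tendstoUniformlyOn_div_sqrt hE (eventually_mem_nhdsWithin.mono hC)⟩
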